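/- Let $(W,S)$ be a Coxeter system with length function $\ell$, set of reflections $T=\{wsw^{-1}: w\in W,\ s\in S\}$ and root system $\Phi$ (in the standard geometric representation); for $\alpha\in\Phi$ let $t_\alpha\in T$ be the corresponding reflection, and for $t\in T$ let $\alpha_t$ be the corresponding positive root. The Bruhat graph of $W$ has the edges $x\xrightarrow{t}y$ with $yx^{-1}=t\in T$ and $\ell(x)<\ell(y)$, and $P_h(u,v)$ is the set of its directed paths of length $h$ from $u$ to $v$. For $u,v\in W$, let $X$ be the set of the middle vertices of the paths in $P_2(u,v)$; there is a unique fixed-point-free involution $f$ of $X$ such that $\ell(x_1)<\ell(x_2)$ and $x_2\neq f(x_1)$ imply $\ell(f(x_1))<\ell(f(x_2))$, and the flip of $u\to x\to v$ is $u\to f(x)\to v$. For $1\le i\le h-1$, the $i$-th flip $f_i$ of a path $x_0\to\cdots\to x_h$ replaces its subpath $x_{i-1}\to x_i\to x_{i+1}$ by the flip of that subpath. An $h$-flipclass from $u$ to $v$ is a minimal nonempty subset of $P_h(u,v)$ closed under all flips. For an $h$-flipclass $F$, let $E(F)$ be the set of vertices of paths of $F$, $T(F)$ the set of labels of edges of paths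 of $F$, $W(F)=\langle T(F)\rangle$ and $\Phi(F)=\{\alpha_t: t\in T(F)\}$. The time-support poset $TSP_F$ consists of the pairs $(a,i)$ such that some path $x_0\to\cdots\to x_h$ in $F$ has $x_i=a$; its order is generated by the relations $(a,i)<(b,i+1)$ whenever some path in $F$ has $x_i=a$ and $x_{i+1}=b$. An $h$-flipclass $F$ of $W$ and an $h$-flipclass $F'$ of a Coxeter group $W'$ are combinatorially isomorphic if there is a bijection $\varepsilon:E(F)\to E(F')$ such that a sequence $(x_0,\dots,x_h)$ of elements of $E(F)$ is a path in $F$ if and only if $(\varepsilon(x_0),\dots,\varepsilon(x_h))$ is a path in $F'$, and such that the induced bijection $F\to F'$ commutes with all flips $f_i$. They are isomorphic if, moreover, there are a bijection $\tau:T(F)\to T(F')$ such that $x_0\xrightarrow{t_1}x_1\xrightarrow{t_2}\cdots\xrightarrow{t_h}x_h$ is a path in $F$ if and only if $\varepsilon(x_0)\xrightarrow{\tau(t_1)}\varepsilon(x_1)\xrightarrow{\tau(t_2)}\cdots\xrightarrow{\tau(t_h)}\varepsilon(x_h)$ is a path in $F'$, and reflection orderings of $W$ and of $W'$ with respect to which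 $\tau$ is order preserving. A subgroup $H$ of $W$ generated by reflections is a Coxeter group with the canonical Coxeter generators $\chi(H)=\{t\in T:\{r\in T\cap H:\ell(rt)<\ell(t)\}=\{t\}\}$; it is a dihedral Coxeter group if $|\chi(H)|=2$. A reflection ordering of $W$ is a total order $\preceq$ on $T$ such that for each dihedral $H$ with $\chi(H)=\{a,b\}$ the reflections of $H$ are ordered as $a\preceq aba\preceq ababa\preceq\cdots\preceq babab\preceq bab\preceq b$ or as the reverse of this. A dihedral group is a (possibly infinite) Coxeter group of rank $2$. Let $h\ge 2$ and let $F$ be an $h$-flipclass in $W$. The following are equivalent. 1. $F$ is isomorphic to a flipclass of a dihedral group. 2. $F$ is combinatorially isomorphic to a flipclass of a dihedral group. 3. $TSP_F$ is isomorphic, as a poset, to a Bruhat interval of a dihedral group. 4. $TSP_F$ has exactly two atoms. 5. $TSP_F$ has exactly two coatoms. 6. $\operatorname{span}\Phi(F)$ has dimension $2$. 7. $\langle t_\alpha:\alpha\in\Phi\cap\operatorname{span}\Phi(F)\rangle$ is a dihedral Coxeter group. 8. $W(F)$ is a dihedral Coxeter group. -/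

import Mathlib

namespace CoxeterMatrix

variable {B : Type*} (M : CoxeterMatrix B)

/-- The linear form `v ↦ 2 (α_i, v)` on `V = ⨁_{i ∈ B} ℝ α_i`, where `(·,·)` is the canonical
symmetric bilinear form with `(α_i, α_j) = - cos (π / M i j)`. Mathlib encodes `m(i,j) = ∞` by
`M i j = 0`; in that case Lean's `π / 0 = 0` gives the usual value `(α_i, α_j) = -1`. -/
noncomputable def simpleCoroot (i : B) : Module.Dual ℝ (B →₀ ℝ) :=
  Finsupp.linearCombination ℝ fun j => 2 * -Real.cos (Real.pi / (M i j : ℝ))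

/-- The simple root `α_i`, a basis vector of `V`. -/
noncomputable def simpleRoot (_M : CoxeterMatrix B) (i : B) : B →₀ ℝ := Finsupp.single i 1

theorem simpleCoroot_simpleRoot (i j : B) :
    M.simpleCoroot i (M.simpleRoot j) = 2 * -Real.cos (Real.pi / (M i j : ℝ)) := by
  simp [simpleCoroot, simpleRoot]

theorem simpleCoroot_simpleRoot_self (i : B) : M.simpleCoroot i (M.simpleRoot i) = 2 := by
  simp [simpleCoroot_simpleRoot]

/-- The simple reflection `v ↦ v - 2 (α_i, v) α_i` of `V`. -/
noncomputable def simpleReflection (i : B) : (B →₀ ℝ) ≃ₗ[ℝ] (B →₀ ℝ) :=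
  Module.reflection (M.simpleCoroot_simpleRoot_self i)

theorem eval_S_mul_sin (n : ℤ) (φ : ℝ) :
    (Polynomial.Chebyshev.S ℝ n).eval (2 * Real.cos φ) * Real.sin φ = Real.sin ((n + 1) * φ) := by
  rw [← Polynomial.Chebyshev.U_real_cos, ← Polynomial.Chebyshev.S_comp_two_mul_X]
  simp

theorem isLiftable_simpleReflection : M.IsLiftable M.simpleReflection := by
  intro i j
  rcases Nat.eq_zero_or_pos (M i j) with h0 | hpos
  · rw [h0, pow_zero]
  by_cases hij : i = j
  · subst hij
    rw [M.diagonal, pow_one]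
    ext1 v
    exact Module.involutive_reflection (M.simpleCoroot_simpleRoot_self i) v
  have h1 : M i j ≠ 1 := M.off_diagonal i j hij
  have hfy : M.simpleCoroot i (M.simpleRoot j) = 2 * -Real.cos (Real.pi / (M i j : ℝ)) :=
    M.simpleCoroot_simpleRoot i j
  have hgx : M.simpleCoroot j (M.simpleRoot i) = 2 * -Real.cos (Real.pi / (M i j : ℝ)) := by
    rw [M.simpleCoroot_simpleRoot j i, M.symmetric]
  generalize hm : M i j = m at *
  set φ : ℝ := 2 * (Real.pi / (m : ℝ)) with hφ
  have ht : 2 * Real.cos φ =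
      M.simpleCoroot i (M.simpleRoot j) * M.simpleCoroot j (M.simpleRoot i) - 2 := by
    rw [hfy, hgx, hφ, Real.cos_two_mul]; ring
  apply LinearEquiv.ext
  intro z
  have key := Module.reflection_mul_reflection_pow_apply (M.simpleCoroot_simpleRoot_self i)
    (M.simpleCoroot_simpleRoot_self j) m z (2 * Real.cos φ) ht
  change ((Module.reflection (M.simpleCoroot_simpleRoot_self i) *
    Module.reflection (M.simpleCoroot_simpleRoot_self j)) ^ m) z = z
  rw [key]
  have hm0 : (m : ℝ) ≠ 0 := by positivity
  by_cases h2 : m = 2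
  · subst h2
    have hc : Real.cos φ = -1 := by
      rw [hφ]; push_cast
      rw [show 2 * (Real.pi / 2) = Real.pi by ring, Real.cos_pi]
    have hz : M.simpleCoroot i (M.simpleRoot j) = 0 := by rw [hfy]; simp
    have hz' : M.simpleCoroot j (M.simpleRoot i) = 0 := by rw [hgx]; simp
    rw [hc, hz, hz']
    norm_num
    module
  have h3 : 3 ≤ m := by omega
  have hsin : Real.sin φ ≠ 0 := by
    apply ne_of_gt
    apply Real.sin_pos_of_pos_of_lt_pi
    · positivity
    · have : (3 : ℝ) ≤ m := by exact_mod_cast h3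
      rw [hφ, ← mul_div_assoc, div_lt_iff₀ (by positivity)]
      nlinarith [Real.pi_pos]
  obtain ⟨k, hk | hk⟩ := Nat.even_or_odd' m
  · have e0 : (Polynomial.Chebyshev.S ℝ ((k : ℤ) - 1)).eval (2 * Real.cos φ) = 0 := by
      apply (mul_eq_zero.mp _).resolve_right hsin
      rw [eval_S_mul_sin]
      push_cast
      have : ((k : ℝ) - 1 + 1) * φ = Real.pi := by
        rw [hφ]; field_simp; rw [hk]; push_cast; ring
      rw [this, Real.sin_pi]
    have a1 : ((m : ℤ) - 2) / 2 = k - 1 := by omega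
    have a2 : ((m : ℤ) - 1) / 2 = k - 1 := by omega
    rw [a1, a2, e0]
    simp
  · have e0 : (Polynomial.Chebyshev.S ℝ (k : ℤ)).eval (2 * Real.cos φ) +
        (Polynomial.Chebyshev.S ℝ ((k : ℤ) - 1)).eval (2 * Real.cos φ) = 0 := by
      apply (mul_eq_zero.mp _).resolve_right hsin
      rw [add_mul, eval_S_mul_sin, eval_S_mul_sin]
      push_cast
      have : ((k : ℝ) + 1) * φ = 2 * Real.pi - ((k : ℝ) - 1 + 1) * φ := by
        rw [hφ]; field_simp; rw [hk]; push_cast; ring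
      rw [this, Real.sin_two_pi_sub]
      ring
    have a1 : ((m : ℤ) - 2) / 2 = k - 1 := by omega
    have a2 : ((m : ℤ) - 1) / 2 = k := by omega
    have a3 : ((m : ℤ) - 3) / 2 = k - 1 := by omega
    have a4 : (m : ℤ) / 2 = k := by omega
    rw [a1, a2, a3, a4, e0]
    simp

end CoxeterMatrix

namespace CoxeterSystem

variable {B W : Type*} [Group W] {M : CoxeterMatrix B} (cs : CoxeterSystem M W)

/-! ### Roots -/

/-- The standard geometric representation of `W`. -/
noncomputable def geomRep : W →* ((B →₀ ℝ) ≃ₗ[ℝ] (B →₀ ℝ)) :=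
  cs.lift ⟨M.simpleReflection, M.isLiftable_simpleReflection⟩

/-- `α` is a root of `W` and `t` is the reflection `t_α` corresponding to it:
`α = w(α_i)` and `t_α = w s_i w⁻¹` for some `w` and `i`. -/
def IsRootOf (α : B →₀ ℝ) (t : W) : Prop :=
  ∃ (w : W) (i : B), α = cs.geomRep w (M.simpleRoot i) ∧ t = w * cs.simple i * w⁻¹

/-- `α` is the positive root `α_t` corresponding to the reflection `t`. -/
def IsPosRootOf (α : B →₀ ℝ) (t : W) : Prop :=
  cs.IsRootOf α t ∧ ∀ i, 0 ≤ α i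

/-! ### Reflection subgroups and reflection orderings -/

/-- The canonical Coxeter generators `χ(H)` of a reflection subgroup `H`: the reflections `t` with
`{r ∈ T ∩ H : ℓ(rt) < ℓ(t)} = {t}`. -/
def canonicalGenerators (H : Subgroup W) : Set W :=
  {t | cs.IsReflection t ∧
    {r | cs.IsReflection r ∧ r ∈ H ∧ cs.length (r * t) < cs.length t} = {t}}

/-- `H` is a dihedral reflection subgroup: it is generated by reflections, and it is a Coxeter
group of rank 2 (possibly infinite) with the elements of `χ(H)` as its simple reflections. -/
def IsDihedralSubgroup (H : Subgroup W) : Prop :=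
  H = Subgroup.closure {t | cs.IsReflection t ∧ t ∈ H} ∧
    ∃ (M' : CoxeterMatrix (Fin 2)) (cs' : CoxeterSystem M' H),
      Set.range (fun i => (cs'.simple i : W)) = cs.canonicalGenerators H

/-- The word `aba…a` of length `2 n + 1`. -/
def oddWord (a b : W) (n : ℕ) : W := (a * b) ^ n * a

/-- The word `aba…a` of length `2 n + 1` is reduced in the dihedral group generated by the
involutions `a`, `b`; recall that `orderOf (a * b) = 0` if `a * b` has infinite order. -/
def OddWordReduced (a b : W) (n : ℕ) : Prop :=
  orderOf (a * b) = 0 ∨ 2 * n + 1 ≤ orderOf (a * b)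

/-- `a ≼ aba ≼ ababa ≼ ⋯ ≼ babab ≼ bab ≼ b`, the expressions being reduced. -/
def IsDihedralChain (le : W → W → Prop) (a b : W) : Prop :=
  ∀ m n : ℕ, OddWordReduced a b m → OddWordReduced a b n →
    (m ≤ n → le (oddWord a b m) (oddWord a b n)) ∧
    (m ≤ n → le (oddWord b a n) (oddWord b a m)) ∧
    le (oddWord a b m) (oddWord b a n)

/-- Reflection orderings: total orders on the set of reflections which on each dihedral reflection
subgroup are one of the two dihedral chains. The order is given by a relation on `W`, of which only
the restriction to the reflections matters. -/
def IsReflectionOrdering (le : W → W → Prop) : Prop :=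
  IsLinearOrder {t : W // cs.IsReflection t} (fun s t => le s t) ∧
    ∀ (H : Subgroup W) (a b : W), cs.IsDihedralSubgroup H → a ≠ b →
      cs.canonicalGenerators H = {a, b} → IsDihedralChain le a b ∨ IsDihedralChain le b a

/-! ### Bruhat graph and Bruhat order -/

/-- There is an edge `u → v` in the Bruhat graph; its label is the reflection `v u⁻¹`. -/
def BruhatEdge (u v : W) : Prop :=
  cs.length u < cs.length v ∧ cs.IsReflection (v * u⁻¹)

/-- The Bruhat order. -/
def BruhatLE (u v : W) : Prop := Relation.ReflTransGen cs.BruhatEdge u v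

/-- The Bruhat interval `[u, v]`. -/
def BruhatInterval (u v : W) : Type _ := {w : W // cs.BruhatLE u w ∧ cs.BruhatLE w v}

instance (u v : W) : LE (cs.BruhatInterval u v) := ⟨fun a b => cs.BruhatLE a.1 b.1⟩

/-- The paths of length `h` from `u` to `v` in the Bruhat graph, as sequences of vertices. -/
def bruhatPaths (h : ℕ) (u v : W) : Set (Fin (h + 1) → W) :=
  {x | x 0 = u ∧ x (Fin.last h) = v ∧ ∀ i : Fin h, cs.BruhatEdge (x i.castSucc) (x i.succ)}

/-! ### Flips and flipclasses -/

/-- The middle vertices of the paths of length 2 from `u` to `v`. -/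
def midpoints (u v : W) : Set W := {x | cs.BruhatEdge u x ∧ cs.BruhatEdge x v}

/-- The characterizing property of the flip on the middle vertices. -/
structure IsFlipInvolution (u v : W) (f : cs.midpoints u v → cs.midpoints u v) : Prop where
  involutive : ∀ x, f (f x) = x
  fixedPointFree : ∀ x, f x ≠ x
  length_lt : ∀ x₁ x₂ : cs.midpoints u v, cs.length (x₁ : W) < cs.length (x₂ : W) → x₂ ≠ f x₁ →
    cs.length (f x₁ : W) < cs.length (f x₂ : W)

/-- The (unique) fixed-point free involution on the middle vertices of the paths of length 2 from
`u` to `v` such that `ℓ(x₁) < ℓ(x₂)` and `x₂ ≠ f(x₁)` imply `ℓ(f(x₁)) < ℓ(f(x₂))`. -/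
noncomputable def flipInvolution (u v : W) : cs.midpoints u v → cs.midpoints u v :=
  @Classical.epsilon _ ⟨id⟩ (cs.IsFlipInvolution u v)

open Classical in
/-- For `x` in the middle of a path of length 2 from `u` to `v`, the middle of the flipped path. -/
noncomputable def flipMid (u v x : W) : W :=
  if hx : x ∈ cs.midpoints u v then cs.flipInvolution u v ⟨x, hx⟩ else x

/-- The `(k+1)`-st flip `f_{k+1}`, for `1 ≤ k + 1 ≤ h - 1`: it replaces the vertex `x_{k+1}`. -/
noncomputable def flip {h : ℕ} (k : ℕ) (hk : k + 2 ≤ h) (x : Fin (h + 1) → W) :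
    Fin (h + 1) → W :=
  Function.update x ⟨k + 1, by omega⟩
    (cs.flipMid (x ⟨k, by omega⟩) (x ⟨k + 2, by omega⟩) (x ⟨k + 1, by omega⟩))

/-- `F` is an `h`-flipclass of `W` from `u` to `v`: a minimal (nonempty) subset of the set of
`h`-paths from `u` to `v` that is closed under flips. -/
def IsFlipclass {h : ℕ} (u v : W) (F : Set (Fin (h + 1) → W)) : Prop :=
  Minimal (fun G : Set (Fin (h + 1) → W) => G.Nonempty ∧ G ⊆ cs.bruhatPaths h u v ∧
    ∀ x ∈ G, ∀ (k : ℕ) (hk : k + 2 ≤ h), cs.flip k hk x ∈ G) F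

end CoxeterSystem

namespace Flipclass

variable {W W' : Type*} [Group W] [Group W'] {h : ℕ}

/-- The label of the `i`-th edge of a path. -/
def label (x : Fin (h + 1) → W) (i : Fin h) : W := x i.succ * (x i.castSucc)⁻¹

/-- `E(F)`, the set of the elements of `W` lying on some path of `F`. -/
def elts (F : Set (Fin (h + 1) → W)) : Set W := {w | ∃ x ∈ F, ∃ i, x i = w}

/-- `T(F)`, the set of the labels of the edges of the paths of `F`. -/
def labels (F : Set (Fin (h + 1) → W)) : Set W := {t | ∃ x ∈ F, ∃ i, label x i = t}

/-- `W(F)`, the subgroup generated by `T(F)`. -/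
def reflSubgroup (F : Set (Fin (h + 1) → W)) : Subgroup W := Subgroup.closure (labels F)

/-- `Φ(F)`, the set of the positive roots `α_t` for `t ∈ T(F)`. -/
def roots {B : Type*} {M : CoxeterMatrix B} (cs : CoxeterSystem M W)
    (F : Set (Fin (h + 1) → W)) : Set (B →₀ ℝ) :=
  {α | ∃ t ∈ labels F, cs.IsPosRootOf α t}

/-! ### Isomorphisms -/

section iso

variable {B B' : Type*} {M : CoxeterMatrix B} {M' : CoxeterMatrix B'}
  (cs : CoxeterSystem M W) (cs' : CoxeterSystem M' W')
  (F : Set (Fin (h + 1) → W)) (F' : Set (Fin (h + 1) → W'))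

/-- The map induced by `ε` on sequences of vertices commutes with all flips: if `x` and its flip `y`
are paths in `F`, then the image of `y` is the corresponding flip of the image of `x`. -/
def FlipPreserving (ε : elts F ≃ elts F') : Prop :=
  ∀ x y : Fin (h + 1) → elts F, (fun j => (x j : W)) ∈ F → (fun j => (y j : W)) ∈ F →
    ∀ (k : ℕ) (hk : k + 2 ≤ h), (fun j => (y j : W)) = cs.flip k hk (fun j => (x j : W)) →
      (fun j => (ε (y j) : W')) = cs'.flip k hk (fun j => (ε (x j) : W'))

/-- `F` and `F'` are combinatorially isomorphic. -/
def CombIso : Prop :=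
  ∃ ε : elts F ≃ elts F',
    (∀ x : Fin (h + 1) → elts F, (fun j => (x j : W)) ∈ F ↔ (fun j => (ε (x j) : W')) ∈ F') ∧
    FlipPreserving cs cs' F F' ε

/-- `F` and `F'` are isomorphic. -/
def Iso : Prop :=
  ∃ (ε : elts F ≃ elts F') (τ : labels F ≃ labels F'),
    (∀ (x : Fin (h + 1) → elts F) (t : Fin h → labels F),
      ((fun j => (x j : W)) ∈ F ∧ ∀ i, label (fun j => (x j : W)) i = t i) ↔
        ((fun j => (ε (x j) : W')) ∈ F' ∧ ∀ i, label (fun j => (ε (x j) : W')) i = τ (t i))) ∧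
    FlipPreserving cs cs' F F' ε ∧
    ∃ (le : W → W → Prop) (le' : W' → W' → Prop),
      cs.IsReflectionOrdering le ∧ cs'.IsReflectionOrdering le' ∧
      ∀ s t : labels F, le s t ↔ le' (τ s) (τ t)

end iso

/-! ### The time-support poset -/

/-- The vertices of the time-support graph of `F`: the pairs `(a, i)` such that some path of `F`
passes through `a` at time `i`. -/
def TSP (F : Set (Fin (h + 1) → W)) : Type _ := {p : W × Fin (h + 1) // ∃ x ∈ F, x p.2 = p.1}

/-- The edges of the time-support graph of `F`: `(a, i) → (b, i + 1)` whenever some path of `F`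
passes through `a → b` between time `i` and time `i + 1`. -/
def TSEdge (F : Set (Fin (h + 1) → W)) (p q : TSP F) : Prop :=
  ∃ x ∈ F, ∃ i : Fin h, p.1 = (x i.castSucc, i.castSucc) ∧ q.1 = (x i.succ, i.succ)

theorem TSEdge.le_time {W : Type*} {h : ℕ} {F : Set (Fin (h + 1) → W)} {p q : TSP F}
    (hpq : Relation.ReflTransGen (TSEdge F) p q) : p = q ∨ p.1.2 < q.1.2 := by
  induction hpq with
  | refl => exact Or.inl rfl
  | tail _ hbc ih =>
    obtain ⟨x, -, i, h1, h2⟩ := hbc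
    right
    rw [h2]
    rcases ih with rfl | ih
    · rw [h1]; exact Fin.castSucc_lt_succ
    · rw [h1] at ih; exact ih.trans Fin.castSucc_lt_succ

/-- The time-support poset of `F`, i.e. the poset generated by the time-support graph. -/
instance (F : Set (Fin (h + 1) → W)) : PartialOrder (TSP F) where
  le := Relation.ReflTransGen (TSEdge F)
  le_refl _ := Relation.ReflTransGen.refl
  le_trans _ _ _ := Relation.ReflTransGen.trans
  le_antisymm p q hpq hqp := by
    rcases TSEdge.le_time hpq with h1 | h1
    · exact h1
    · rcases TSEdge.le_time hqp with h2 | h2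
      · exact h2.symm
      · exact absurd h1 (lt_asymm h2)

/-- The atoms of a poset: the elements covering the least element. -/
def atoms (P : Type*) [PartialOrder P] : Set P := {q | ∃ p, IsBot p ∧ p ⋖ q}

/-- The coatoms of a poset: the elements covered by the greatest element. -/
def coatoms (P : Type*) [PartialOrder P] : Set P := {q | ∃ p, IsTop p ∧ q ⋖ p}

end Flipclass

/-! Everything is reduced to condition 6, that the roots of the labels span a plane.

A plane of roots gives a dihedral group. Let `P` be a plane containing the positive roots of two
distinct reflections. A second linear coordinate orders the rays of the roots in `P`, and inversion
sets and their complements are convex for this order. With finiteness of inversion sets this yields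
two extreme reflections, which are the canonical generators of a dihedral group
(`IsPlanar.exists_min_max`, `IsPlanar.canonicalGenerators_eq`). When all reflections with root in
`P` are taken, each coset of this group, based at its element `z` of minimal length, carries a copy
of the Bruhat graph of a rank-two Coxeter group (`IsDihedralEmbedding.bruhatEdge_iff`). Midpoints
never leave the coset, because `t₂ t₁ = r₂ r₁` with `r₁ ≠ r₂` forces the roots of `r₁`, `r₂` into
every subspace containing those of `t₁`, `t₂` (`IsReflection.posRoot_mem_span`). Flips therefore
become the exchange `swap` of the two simple reflections (`IsDihedralEmbedding.flipMid_eq`). Thus 6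
gives 1; the reflection ordering required there is a lexicographic order of normalized roots, pulled
back to the dihedral group.

In rank two there are at most two elements of each length, and the Bruhat order merely compares
lengths. A flipclass there has one vertex at each end and exactly two at each intermediate time,
with all possible edges between consecutive times. This depends only on the coincidences of vertices
in paths, so it passes through combinatorial isomorphisms, and the time-support poset is an interval
`[1, w]` with `ℓ(w) = h`. This gives 2 ⇒ 3, and reading off levels gives 3 ⇒ 4 and 3 ⇒ 5.

Conversely, a path and its flip have distinct first labels, whose roots span the plane of all four
labels. Hence a subspace containing the roots of all first labels contains the roots of all labels
(`IsFlipclass.posRoot_mem_of_first_labels`), so two atoms force dimension two; coatoms are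
symmetric. Conditions 7 and 8 are equivalent to 6 since all roots of a dihedral reflection subgroup
lie in the span of the roots of two generators. -/

/-! ### Reflection representations and the extended pairing. -/

namespace CoxeterMatrix

variable {B : Type*} (M : CoxeterMatrix B)

/-- The powers of a product of two reflections depend only on the pairings of the vectors with the
functionals, so the Chebyshev computation for simple reflections applies to any system with the same
pairings. It is needed for the action on `V × V*`. -/
theorem isLiftable_reflection {V : Type*} [AddCommGroup V] [Module ℝ V] (a : B → V)
    (f : B → Module.Dual ℝ V)
    (hf : ∀ i j, f i (a j) = 2 * -Real.cos (Real.pi / (M i j : ℝ))) (h2 : ∀ i, f i (a i) = 2) :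
    M.IsLiftable (fun i => Module.reflection (h2 i)) := by
  intro i j
  rcases Nat.eq_zero_or_pos (M i j) with h0 | hpos
  · rw [h0, pow_zero]
  by_cases hij : i = j
  · subst hij
    rw [M.diagonal, pow_one]
    ext1 v
    exact Module.involutive_reflection (h2 i) v
  have h1 : M i j ≠ 1 := M.off_diagonal i j hij
  have hfy : f i (a j) = 2 * -Real.cos (Real.pi / (M i j : ℝ)) := hf i j
  have hgx : f j (a i) = 2 * -Real.cos (Real.pi / (M i j : ℝ)) := by
    rw [hf j i, M.symmetric]
  generalize hm : M i j = m at *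
  set φ : ℝ := 2 * (Real.pi / (m : ℝ)) with hφ
  have ht : 2 * Real.cos φ = f i (a j) * f j (a i) - 2 := by
    rw [hfy, hgx, hφ, Real.cos_two_mul]; ring
  apply LinearEquiv.ext
  intro z
  have key := Module.reflection_mul_reflection_pow_apply (h2 i) (h2 j) m z (2 * Real.cos φ) ht
  change ((Module.reflection (h2 i) * Module.reflection (h2 j)) ^ m) z = z
  rw [key]
  have hm0 : (m : ℝ) ≠ 0 := by positivity
  -- Here `φ = π`, so `sin φ = 0` and the division by `sin φ` used below is impossible.
  by_cases h2 : m = 2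
  · subst h2
    have hc : Real.cos φ = -1 := by
      rw [hφ]; push_cast
      rw [show 2 * (Real.pi / 2) = Real.pi by ring, Real.cos_pi]
    have hz : f i (a j) = 0 := by rw [hfy]; simp
    have hz' : f j (a i) = 0 := by rw [hgx]; simp
    rw [hc, hz, hz']
    norm_num
    module
  have h3 : 3 ≤ m := by omega
  have hsin : Real.sin φ ≠ 0 := by
    apply ne_of_gt
    apply Real.sin_pos_of_pos_of_lt_pi
    · positivity
    · have : (3 : ℝ) ≤ m := by exact_mod_cast h3
      rw [hφ, ← mul_div_assoc, div_lt_iff₀ (by positivity)]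
      nlinarith [Real.pi_pos]
  -- If `m = 2k` then `kφ = π`; if `m = 2k + 1` then `kφ` and `(k + 1)φ` add up to `2π`. Either way
  -- the Chebyshev coefficient in the formula vanishes.
  obtain ⟨k, hk | hk⟩ := Nat.even_or_odd' m
  · have e0 : (Polynomial.Chebyshev.S ℝ ((k : ℤ) - 1)).eval (2 * Real.cos φ) = 0 := by
      apply (mul_eq_zero.mp _).resolve_right hsin
      rw [eval_S_mul_sin]
      push_cast
      have : ((k : ℝ) - 1 + 1) * φ = Real.pi := by
        rw [hφ]; field_simp; rw [hk]; push_cast; ring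
      rw [this, Real.sin_pi]
    have a1 : ((m : ℤ) - 2) / 2 = k - 1 := by omega
    have a2 : ((m : ℤ) - 1) / 2 = k - 1 := by omega
    rw [a1, a2, e0]
    simp
  · have e0 : (Polynomial.Chebyshev.S ℝ (k : ℤ)).eval (2 * Real.cos φ) +
        (Polynomial.Chebyshev.S ℝ ((k : ℤ) - 1)).eval (2 * Real.cos φ) = 0 := by
      apply (mul_eq_zero.mp _).resolve_right hsin
      rw [add_mul, eval_S_mul_sin, eval_S_mul_sin]
      push_cast
      have : ((k : ℝ) + 1) * φ = 2 * Real.pi - ((k : ℝ) - 1 + 1) * φ := by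
        rw [hφ]; field_simp; rw [hk]; push_cast; ring
      rw [this, Real.sin_two_pi_sub]
      ring
    have a1 : ((m : ℤ) - 2) / 2 = k - 1 := by omega
    have a2 : ((m : ℤ) - 1) / 2 = k := by omega
    have a3 : ((m : ℤ) - 3) / 2 = k - 1 := by omega
    have a4 : (m : ℤ) / 2 = k := by omega
    rw [a1, a2, a3, a4, e0]
    simp

/-- Twice the canonical bilinear form. -/
noncomputable def bilin : (B →₀ ℝ) →ₗ[ℝ] Module.Dual ℝ (B →₀ ℝ) :=
  Finsupp.linearCombination ℝ M.simpleCoroot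

theorem bilin_simpleRoot (i : B) : M.bilin (M.simpleRoot i) = M.simpleCoroot i := by
  simp [bilin, simpleRoot]

theorem bilin_symm (x y : B →₀ ℝ) : M.bilin x y = M.bilin y x := by
  have : M.bilin = M.bilin.flip := by
    ext i j
    have h1 := M.simpleCoroot_simpleRoot i j
    have h2 := M.simpleCoroot_simpleRoot j i
    rw [M.symmetric j i] at h2
    have hi := M.bilin_simpleRoot i
    have hj := M.bilin_simpleRoot j
    simp only [simpleRoot] at *
    simp [hi, hj, h1, h2]
  conv_lhs => rw [this]
  rfl

/-- The pairing of `V` with `V × V*`, in which the coroots of independent roots are independent. -/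
noncomputable def extPairing :
    (B →₀ ℝ) →ₗ[ℝ] Module.Dual ℝ ((B →₀ ℝ) × Module.Dual ℝ (B →₀ ℝ)) :=
  LinearMap.mk₂ ℝ (fun α x => M.bilin α x.1 + x.2 α)
    (by intros; simp; ring) (by intros; simp; ring) (by intros; simp; ring) (by intros; simp; ring)

theorem extPairing_apply (α : B →₀ ℝ) (x : (B →₀ ℝ) × Module.Dual ℝ (B →₀ ℝ)) :
    M.extPairing α x = M.bilin α x.1 + x.2 α := rfl

theorem extPairing_self (i : B) :
    M.extPairing (M.simpleRoot i) (M.simpleRoot i, 0) = 2 := by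
  simp [extPairing_apply, bilin_simpleRoot, simpleCoroot_simpleRoot_self]

end CoxeterMatrix

/-! ### Roots under the geometric representation and its extension. -/

namespace CoxeterSystem

variable {B W : Type*} [Group W] {M : CoxeterMatrix B} (cs : CoxeterSystem M W)

theorem geomRep_simple (i : B) (v : B →₀ ℝ) :
    cs.geomRep (cs.simple i) v = v - M.bilin (M.simpleRoot i) v • M.simpleRoot i := by
  rw [geomRep, lift_apply_simple, CoxeterMatrix.simpleReflection, Module.reflection_apply,
    CoxeterMatrix.bilin_simpleRoot]

/-- The geometric representation extended to `V × V*`. -/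
noncomputable def extRep :
    W →* (((B →₀ ℝ) × Module.Dual ℝ (B →₀ ℝ)) ≃ₗ[ℝ] ((B →₀ ℝ) × Module.Dual ℝ (B →₀ ℝ))) :=
  cs.lift ⟨_, M.isLiftable_reflection (fun i => (M.simpleRoot i, 0))
    (fun i => M.extPairing (M.simpleRoot i))
    (fun i j => by simp [CoxeterMatrix.extPairing_apply, CoxeterMatrix.bilin_simpleRoot,
      CoxeterMatrix.simpleCoroot_simpleRoot]) M.extPairing_self⟩

theorem extRep_simple (i : B) (x : (B →₀ ℝ) × Module.Dual ℝ (B →₀ ℝ)) :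
    cs.extRep (cs.simple i) x =
      x - M.extPairing (M.simpleRoot i) x • (M.simpleRoot i, 0) := by
  rw [extRep, lift_apply_simple, Module.reflection_apply]

theorem extRep_inl (w : W) (v : B →₀ ℝ) : cs.extRep w (v, 0) = (cs.geomRep w v, 0) := by
  induction w using cs.simple_induction_left with
  | one => simp
  | mul_simple_left w i ih =>
    rw [map_mul, map_mul, LinearEquiv.mul_apply, LinearEquiv.mul_apply, ih, extRep_simple,
      geomRep_simple]
    simp [CoxeterMatrix.extPairing_apply]

/-- This invariance carries the reflection formula from simple roots to all roots by conjugation.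
Restricted to `V`, it is the invariance of the bilinear form. -/
theorem extPairing_extRep (w : W) (α : B →₀ ℝ) (x : (B →₀ ℝ) × Module.Dual ℝ (B →₀ ℝ)) :
    M.extPairing (cs.geomRep w α) (cs.extRep w x) = M.extPairing α x := by
  induction w using cs.simple_induction_left with
  | one => simp
  | mul_simple_left w i ih =>
    rw [map_mul, map_mul, LinearEquiv.mul_apply, LinearEquiv.mul_apply, extRep_simple,
      geomRep_simple, ← ih]
    generalize cs.geomRep w α = β
    generalize cs.extRep w x = y
    have h1 : M.extPairing β (M.simpleRoot i, 0) = M.bilin (M.simpleRoot i) β := by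
      simp [CoxeterMatrix.extPairing_apply, M.bilin_symm β]
    simp only [map_sub, map_smul, LinearMap.sub_apply, LinearMap.smul_apply, smul_eq_mul, h1,
      M.extPairing_self]
    ring

theorem bilin_geomRep (w : W) (α β : B →₀ ℝ) :
    M.bilin (cs.geomRep w α) (cs.geomRep w β) = M.bilin α β := by
  have := cs.extPairing_extRep w α (β, 0)
  rw [extRep_inl] at this
  simpa [CoxeterMatrix.extPairing_apply] using this

theorem geomRep_mul_inv_cancel (w : W) (v : B →₀ ℝ) : cs.geomRep w (cs.geomRep w⁻¹ v) = v := by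
  rw [← LinearEquiv.mul_apply, ← map_mul]; simp

variable {cs}

theorem IsRootOf.extRep_apply {α : B →₀ ℝ} {t : W} (h : cs.IsRootOf α t)
    (x : (B →₀ ℝ) × Module.Dual ℝ (B →₀ ℝ)) :
    cs.extRep t x = x - M.extPairing α x • (α, 0) := by
  obtain ⟨w, i, rfl, rfl⟩ := h
  have h1 : M.extPairing (M.simpleRoot i) (cs.extRep w⁻¹ x) =
      M.extPairing (cs.geomRep w (M.simpleRoot i)) x := by
    rw [← cs.extPairing_extRep w, ← LinearEquiv.mul_apply, ← map_mul]; simp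
  rw [map_mul, map_mul, LinearEquiv.mul_apply, LinearEquiv.mul_apply, extRep_simple, h1,
    map_sub, map_smul, extRep_inl, ← LinearEquiv.mul_apply, ← map_mul]
  simp

theorem IsRootOf.geomRep_apply {α : B →₀ ℝ} {t : W} (h : cs.IsRootOf α t) (v : B →₀ ℝ) :
    cs.geomRep t v = v - M.bilin α v • α := by
  have := h.extRep_apply (v, 0)
  rw [extRep_inl] at this
  simpa [CoxeterMatrix.extPairing_apply] using congrArg Prod.fst this

theorem IsRootOf.bilin_self {α : B →₀ ℝ} {t : W} (h : cs.IsRootOf α t) : M.bilin α α = 2 := by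
  obtain ⟨w, i, rfl, rfl⟩ := h
  rw [bilin_geomRep, M.bilin_simpleRoot, M.simpleCoroot_simpleRoot_self]

theorem IsRootOf.isReflection {α : B →₀ ℝ} {t : W} (h : cs.IsRootOf α t) : cs.IsReflection t := by
  obtain ⟨w, i, rfl, rfl⟩ := h
  exact ⟨w, i, rfl⟩

theorem IsRootOf.conj {α : B →₀ ℝ} {t : W} (h : cs.IsRootOf α t) (w : W) :
    cs.IsRootOf (cs.geomRep w α) (w * t * w⁻¹) := by
  obtain ⟨x, i, rfl, rfl⟩ := h
  exact ⟨w * x, i, by simp, by group⟩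

theorem IsRootOf.neg {α : B →₀ ℝ} {t : W} (h : cs.IsRootOf α t) : cs.IsRootOf (-α) t := by
  have h1 := h.conj t
  rw [h.geomRep_apply, h.bilin_self, h.isReflection.mul_self, one_mul, h.isReflection.inv] at h1
  convert h1 using 1
  module

variable (cs) in
theorem isRootOf_simple (i : B) : cs.IsRootOf (M.simpleRoot i) (cs.simple i) :=
  ⟨1, i, by simp, by simp⟩

end CoxeterSystem

/-! ### Every root is positive or negative. -/

namespace CoxeterSystem

variable {B W : Type*} [Group W] {M : CoxeterMatrix B} (cs : CoxeterSystem M W)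

/-- The coefficients of the roots of the parabolic dihedral subgroups. -/
noncomputable def dihedralCoeff (M : CoxeterMatrix B) (i j : B) (k : ℕ) : ℝ :=
  (Polynomial.Chebyshev.S ℝ ((k : ℤ) - 1)).eval (2 * Real.cos (Real.pi / (M i j : ℝ)))

theorem dihedralCoeff_zero (i j : B) : dihedralCoeff M i j 0 = 0 := by
  simp [dihedralCoeff]

theorem dihedralCoeff_one (i j : B) : dihedralCoeff M i j 1 = 1 := by
  simp [dihedralCoeff]

theorem dihedralCoeff_add_two (i j : B) (k : ℕ) : dihedralCoeff M i j (k + 2) =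
    2 * Real.cos (Real.pi / (M i j : ℝ)) * dihedralCoeff M i j (k + 1) -
      dihedralCoeff M i j k := by
  have := Polynomial.Chebyshev.S_add_two ℝ ((k : ℤ) - 1)
  simp only [dihedralCoeff]
  push_cast
  rw [show (k : ℤ) + 2 - 1 = k - 1 + 2 by ring, this, show (k : ℤ) + 1 - 1 = k - 1 + 1 by ring]
  simp

/-- For finite `m = M i j` the coefficient is `sin(kπ/m) / sin(π/m)`. For `M i j = 0` the argument
of the Chebyshev polynomial is `2`, since `π / 0 = 0`, and the value is `k`. -/
theorem dihedralCoeff_nonneg (i j : B) (hij : i ≠ j) (k : ℕ) (hk : M i j = 0 ∨ k ≤ M i j) :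
    0 ≤ dihedralCoeff M i j k := by
  rcases Nat.eq_zero_or_pos (M i j) with h0 | hpos
  · rw [dihedralCoeff, h0]
    simp
  · have h1 : M i j ≠ 1 := M.off_diagonal i j hij
    have hk' : k ≤ M i j := by omega
    have h2 : (2 : ℝ) ≤ M i j := by exact_mod_cast (by omega : 2 ≤ M i j)
    have hk2 : (k : ℝ) ≤ M i j := by exact_mod_cast hk'
    have hsin : 0 < Real.sin (Real.pi / (M i j : ℝ)) := by
      apply Real.sin_pos_of_pos_of_lt_pi
      · positivity
      · rw [div_lt_iff₀ (by positivity)]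
        nlinarith [Real.pi_pos]
    have key := CoxeterMatrix.eval_S_mul_sin ((k : ℤ) - 1) (Real.pi / (M i j : ℝ))
    have hsin2 : 0 ≤ Real.sin ((((k : ℤ) - 1 : ℤ) + 1 : ℝ) * (Real.pi / (M i j : ℝ))) := by
      apply Real.sin_nonneg_of_nonneg_of_le_pi
      · push_cast
        rw [sub_add_cancel]
        positivity
      · push_cast
        rw [sub_add_cancel, ← mul_div_assoc, div_le_iff₀ (by positivity)]
        nlinarith [Real.pi_pos]
    rw [← key] at hsin2
    exact nonneg_of_mul_nonneg_left hsin2 hsin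

theorem geomRep_simple_simpleRoot_self (i : B) :
    cs.geomRep (cs.simple i) (M.simpleRoot i) = -M.simpleRoot i := by
  rw [geomRep_simple, M.bilin_simpleRoot, M.simpleCoroot_simpleRoot_self]
  module

theorem geomRep_simple_simpleRoot (i j : B) :
    cs.geomRep (cs.simple i) (M.simpleRoot j) =
      M.simpleRoot j + (2 * Real.cos (Real.pi / (M i j : ℝ))) • M.simpleRoot i := by
  rw [geomRep_simple, M.bilin_simpleRoot, M.simpleCoroot_simpleRoot]
  module

/-- The word ends in `j`, and each longer word is obtained by a new letter on the left, determined
by the parity of `k`. That letter changes one of the two coordinates by the recursion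
`dihedralCoeff_add_two`. -/
theorem geomRep_alternatingWord (i j : B) (k : ℕ) :
    cs.geomRep (cs.wordProd (alternatingWord i j k)) (M.simpleRoot i) =
      if Even k then dihedralCoeff M i j (k + 1) • M.simpleRoot i +
        dihedralCoeff M i j k • M.simpleRoot j
      else dihedralCoeff M i j k • M.simpleRoot i +
        dihedralCoeff M i j (k + 1) • M.simpleRoot j := by
  induction k with
  | zero => simp [alternatingWord, dihedralCoeff_zero, dihedralCoeff_one]
  | succ k ih =>
    rw [alternatingWord_succ', wordProd_cons, map_mul, LinearEquiv.mul_apply, ih,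
      dihedralCoeff_add_two]
    by_cases hk : Even k
    · have hk' : ¬ Even (k + 1) := by simpa [Nat.even_add_one] using hk
      simp only [hk, hk', if_true, if_false, map_add, map_smul, geomRep_simple_simpleRoot_self,
        geomRep_simple_simpleRoot, M.symmetric j i]
      module
    · have hk' : Even (k + 1) := by simpa [Nat.even_add_one] using hk
      simp only [hk, hk', if_true, if_false, map_add, map_smul, geomRep_simple_simpleRoot_self,
        geomRep_simple_simpleRoot]
      module

theorem simpleRoot_nonneg (M : CoxeterMatrix B) (i : B) : 0 ≤ M.simpleRoot i := by
  simp [CoxeterMatrix.simpleRoot]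

theorem geomRep_alternatingWord_nonneg (i j : B) (hij : i ≠ j) (k : ℕ)
    (hk : M i j = 0 ∨ k < M i j) : ∃ a b : ℝ, 0 ≤ a ∧ 0 ≤ b ∧
    cs.geomRep (cs.wordProd (alternatingWord i j k)) (M.simpleRoot i) =
      a • M.simpleRoot i + b • M.simpleRoot j := by
  have h1 := dihedralCoeff_nonneg (M := M) i j hij k (by omega)
  have h2 := dihedralCoeff_nonneg (M := M) i j hij (k + 1) (by omega)
  rw [geomRep_alternatingWord]
  split_ifs
  exacts [⟨_, _, h2, h1, rfl⟩, ⟨_, _, h1, h2, rfl⟩]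

/-- Choose a right descent `j` of `w` and write `w = w' · alt`, where `alt` is the longest
alternating word in `i`, `j` that can be split off with lengths adding up. Then `alt` maps `α_i` to
a nonnegative combination of `α_i` and `α_j`, while `w'` is shorter and has neither `i` nor `j` as a
descent, so induction applies to both. -/
theorem geomRep_simpleRoot_nonneg {w : W} {i : B} (h : ¬ cs.IsRightDescent w i) :
    0 ≤ cs.geomRep w (M.simpleRoot i) := by
  induction hn : cs.length w using Nat.strong_induction_on generalizing w i with
  | _ n ih =>
  by_cases hw : w = 1
  · subst hw; simpa using simpleRoot_nonneg M i
  obtain ⟨j, hj⟩ := cs.exists_rightDescent_of_ne_one hw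
  have hij : i ≠ j := by rintro rfl; exact h hj
  set alt : ℕ → W := fun k => cs.wordProd (alternatingWord i j k) with halt
  -- `P k` says that the alternating word of length `k` splits off from the right of `w` with
  -- lengths adding up. It is inherited by smaller `k` and fails for `k > ℓ(w)`.
  let P : ℕ → Prop := fun k => cs.length (w * (alt k)⁻¹) + k = cs.length w
  have hle : ∀ k, cs.length (alt k) ≤ k := fun k => by
    simpa using cs.length_wordProd_le (alternatingWord i j k)
  have hge : ∀ k, cs.length w ≤ cs.length (w * (alt k)⁻¹) + k := fun k => by
    have := cs.length_mul_le (w * (alt k)⁻¹) (alt k)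
    rw [inv_mul_cancel_right] at this
    have := hle k
    omega
  have hsucc : ∀ k, w * (alt k)⁻¹ =
      w * (alt (k + 1))⁻¹ * cs.simple (if Even k then j else i) := by
    intro k
    simp only [halt, alternatingWord_succ', wordProd_cons, mul_inv_rev, inv_simple]
    rw [mul_assoc, mul_assoc, simple_mul_simple_self, mul_one]
  have hPdown : ∀ k, P (k + 1) → P k := by
    intro k hk
    have h1 := cs.length_mul_le (w * (alt (k + 1))⁻¹) (cs.simple (if Even k then j else i))
    rw [← hsucc, length_simple] at h1
    have := hge k
    simp only [P] at hk ⊢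
    omega
  have hP1 : P 1 := by
    simp only [P, halt, alternatingWord, List.concat_nil, wordProd_singleton, inv_simple]
    rw [isRightDescent_iff] at hj
    exact hj
  obtain ⟨k, hk1, hPk, hPk1⟩ : ∃ k, 1 ≤ k ∧ P k ∧ ¬ P (k + 1) := by
    by_contra! hcon
    have hall : ∀ k, 1 ≤ k → P k := fun k hk => by
      induction k, hk using Nat.le_induction with
      | base => exact hP1
      | succ k hk ih => exact hcon k hk ih
    have := hall (cs.length w + 1) (by omega)
    simp only [P] at this
    omega
  -- A split-off word of length `M i j` could be rewritten by the braid relation so as to end in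
  -- `i`, making `i` a right descent of `w`.
  have hkm : M i j = 0 ∨ k < M i j := by
    by_contra! hcon
    obtain ⟨h0, hmk⟩ := hcon
    have hPm : P (M i j) := by
      refine Nat.decreasingInduction (motive := fun n _ => P n) (fun n _ => hPdown n) hPk hmk
    obtain ⟨m, hm⟩ := Nat.exists_eq_succ_of_ne_zero h0
    have hb : alt (M i j) = cs.wordProd (alternatingWord i j m) * cs.simple i := by
      have h1 := cs.wordProd_braidWord_eq i j
      simp only [halt]
      rw [braidWord, braidWord, M.symmetric j i] at h1
      rw [h1, hm, alternatingWord_succ, wordProd_concat]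
    have hws : w * cs.simple i =
        w * (alt (M i j))⁻¹ * cs.wordProd (alternatingWord i j m) := by
      rw [hb]; simp [mul_assoc]
    have h2 := cs.length_mul_le (w * (alt (M i j))⁻¹) (cs.wordProd (alternatingWord i j m))
    rw [← hws] at h2
    have h3 : cs.length (cs.wordProd (alternatingWord i j m)) ≤ m := hle m
    rw [isRightDescent_iff] at h
    have h4 := cs.length_mul_simple w i
    simp only [P] at hPm
    omega
  have hcross : ∀ k, P (k + 1) → ¬ cs.IsRightDescent (w * (alt (k + 1))⁻¹)
      (if Even k then j else i) := by
    intro k hk hd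
    rw [isRightDescent_iff, ← hsucc] at hd
    have := hge k
    simp only [P] at hk
    omega
  have hup : ¬ cs.IsRightDescent (w * (alt k)⁻¹) (if Even k then j else i) := by
    intro hd
    rw [isRightDescent_iff, hsucc, simple_mul_simple_cancel_right, ← hsucc] at hd
    simp only [P] at hPk hPk1
    omega
  obtain ⟨l, rfl⟩ : ∃ l, k = l + 1 := ⟨k - 1, by omega⟩
  have hcr := hcross l hPk
  -- Of the letters `i`, `j`, one was just removed, and the other would extend the word beyond its
  -- maximal length.
  have hboth : ∀ p, (p = i ∨ p = j) → ¬ cs.IsRightDescent (w * (alt (l + 1))⁻¹) p := by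
    by_cases hl : Even l
    · have hl' : ¬ Even (l + 1) := by simpa [Nat.even_add_one] using hl
      rw [if_pos hl] at hcr
      rw [if_neg hl'] at hup
      rintro p (rfl | rfl)
      exacts [hup, hcr]
    · have hl' : Even (l + 1) := by simpa [Nat.even_add_one] using hl
      rw [if_neg hl] at hcr
      rw [if_pos hl'] at hup
      rintro p (rfl | rfl)
      exacts [hcr, hup]
  have hlt : cs.length (w * (alt (l + 1))⁻¹) < n := by
    simp only [P] at hPk; omega
  have hi := ih _ hlt (hboth i (Or.inl rfl)) rfl
  have hj' := ih _ hlt (hboth j (Or.inr rfl)) rfl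
  obtain ⟨a, b, ha, hb, hab⟩ := cs.geomRep_alternatingWord_nonneg i j hij (l + 1) hkm
  have : cs.geomRep w (M.simpleRoot i) =
      cs.geomRep (w * (alt (l + 1))⁻¹) (cs.geomRep (alt (l + 1)) (M.simpleRoot i)) := by
    rw [← LinearEquiv.mul_apply, ← map_mul, inv_mul_cancel_right]
  rw [this]
  simp only [halt] at hi hj' ⊢
  rw [hab, map_add, map_smul, map_smul]
  exact add_nonneg (smul_nonneg ha hi) (smul_nonneg hb hj')

theorem geomRep_simpleRoot_nonpos {w : W} {i : B} (h : cs.IsRightDescent w i) :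
    cs.geomRep w (M.simpleRoot i) ≤ 0 := by
  rw [isRightDescent_iff_not_isRightDescent_mul] at h
  have := cs.geomRep_simpleRoot_nonneg h
  rw [map_mul, LinearEquiv.mul_apply, geomRep_simple_simpleRoot_self, map_neg] at this
  simpa using this

end CoxeterSystem

/-! ### Positive roots of reflections and the length function. -/

namespace CoxeterSystem

variable {B W : Type*} [Group W] {M : CoxeterMatrix B} {cs : CoxeterSystem M W}

theorem geomRep_injective (cs : CoxeterSystem M W) : Function.Injective cs.geomRep := by
  rw [injective_iff_map_eq_one]
  intro w hw
  by_contra hne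
  obtain ⟨i, hi⟩ := cs.exists_rightDescent_of_ne_one hne
  have h := cs.geomRep_simpleRoot_nonpos hi
  rw [hw, LinearEquiv.coe_one, id] at h
  have := h i
  simp [CoxeterMatrix.simpleRoot] at this
  linarith

theorem IsRootOf.ne_zero {α : B →₀ ℝ} {t : W} (h : cs.IsRootOf α t) : α ≠ 0 := by
  rintro rfl
  have := h.bilin_self
  simp at this

theorem IsRootOf.nonneg_or_nonpos {α : B →₀ ℝ} {t : W} (h : cs.IsRootOf α t) :
    0 ≤ α ∨ α ≤ 0 := by
  obtain ⟨w, i, rfl, rfl⟩ := h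
  by_cases hd : cs.IsRightDescent w i
  · exact Or.inr (cs.geomRep_simpleRoot_nonpos hd)
  · exact Or.inl (cs.geomRep_simpleRoot_nonneg hd)

theorem IsRootOf.not_nonneg_iff {α : B →₀ ℝ} {t : W} (h : cs.IsRootOf α t) :
    ¬ 0 ≤ α ↔ α ≤ 0 := by
  refine ⟨fun h1 => h.nonneg_or_nonpos.resolve_left h1, fun h1 h2 => h.ne_zero ?_⟩
  exact le_antisymm h1 h2

/-- Roots have norm `2`, so `c² = 1`. The reflection formula does not see the sign, and the
representation is faithful. -/
theorem IsRootOf.eq_of_smul {α : B →₀ ℝ} {c : ℝ} {r t : W} (h : cs.IsRootOf α t)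
    (h' : cs.IsRootOf (c • α) r) : r = t := by
  apply cs.geomRep_injective
  have hc : c * c = 1 := by
    have h1 := h'.bilin_self
    simp only [map_smul, LinearMap.smul_apply, smul_eq_mul, h.bilin_self] at h1
    linarith
  ext1 v
  rw [h.geomRep_apply, h'.geomRep_apply, map_smul, LinearMap.smul_apply, smul_smul, smul_eq_mul,
    mul_right_comm, hc, one_mul]

theorem IsRootOf.eq_or_eq_neg {α β : B →₀ ℝ} {t : W} (h : cs.IsRootOf α t)
    (h' : cs.IsRootOf β t) : β = α ∨ β = -α := by
  have h1 := h.geomRep_apply α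
  have h2 := h'.geomRep_apply α
  rw [h1, h.bilin_self] at h2
  have h3 : α = (M.bilin β α / 2) • β := by
    have : (2 : ℝ) • α = M.bilin β α • β := sub_right_injective h2
    rw [div_eq_inv_mul, mul_smul, ← this, smul_smul]
    norm_num
  have hc : (M.bilin β α / 2) * (M.bilin β α / 2) = 1 := by
    have h4 := h.bilin_self
    rw [h3] at h4
    simp only [map_smul, LinearMap.smul_apply, smul_eq_mul, h'.bilin_self] at h4
    generalize M.bilin β α = x at *
    have h5 := congrArg (M.bilin β) h3
    linarith
  rcases mul_self_eq_one_iff.mp hc with h4 | h4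
  · left; rw [h3, h4, one_smul]
  · right; rw [h3, h4]; simp

theorem exists_isPosRootOf {t : W} (ht : cs.IsReflection t) : ∃ α, cs.IsPosRootOf α t := by
  obtain ⟨w, i, rfl⟩ := ht
  have h : cs.IsRootOf (cs.geomRep w (M.simpleRoot i)) (w * cs.simple i * w⁻¹) := ⟨w, i, rfl, rfl⟩
  rcases h.nonneg_or_nonpos with h1 | h1
  · exact ⟨_, h, h1⟩
  · refine ⟨_, h.neg, fun j => ?_⟩
    have := h1 j
    simpa using this

open Classical in
/-- The positive root of a reflection. -/
noncomputable def posRoot (cs : CoxeterSystem M W) (t : W) : B →₀ ℝ :=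
  if h : ∃ α, cs.IsPosRootOf α t then h.choose else 0

theorem IsReflection.isPosRootOf {t : W} (ht : cs.IsReflection t) :
    cs.IsPosRootOf (cs.posRoot t) t := by
  have h := exists_isPosRootOf ht
  rw [posRoot, dif_pos h]
  exact h.choose_spec

theorem IsReflection.isRootOf {t : W} (ht : cs.IsReflection t) :
    cs.IsRootOf (cs.posRoot t) t := ht.isPosRootOf.1

theorem posRoot_nonneg (cs : CoxeterSystem M W) (t : W) : 0 ≤ cs.posRoot t := by
  rw [posRoot]
  split_ifs with h
  exacts [h.choose_spec.2, le_rfl]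

theorem IsRootOf.eq_posRoot_or {α : B →₀ ℝ} {t : W} (h : cs.IsRootOf α t) :
    α = cs.posRoot t ∨ α = -cs.posRoot t :=
  h.isReflection.isRootOf.eq_or_eq_neg h

theorem IsRootOf.eq_posRoot {α : B →₀ ℝ} {t : W} (h : cs.IsRootOf α t) (h0 : 0 ≤ α) :
    α = cs.posRoot t := by
  rcases h.eq_posRoot_or with h1 | h1
  · exact h1
  · exfalso
    apply h.ne_zero
    have := cs.posRoot_nonneg t
    refine le_antisymm ?_ h0
    rw [h1]
    simpa using this

theorem isPosRootOf_iff {α : B →₀ ℝ} {t : W} :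
    cs.IsPosRootOf α t ↔ cs.IsReflection t ∧ α = cs.posRoot t := by
  constructor
  · rintro ⟨h, h0⟩
    exact ⟨h.isReflection, h.eq_posRoot h0⟩
  · rintro ⟨h, rfl⟩
    exact h.isPosRootOf

theorem posRoot_linearIndependent {s t : W} (hs : cs.IsReflection s) (ht : cs.IsReflection t)
    (hst : s ≠ t) : LinearIndependent ℝ ![cs.posRoot s, cs.posRoot t] := by
  rw [LinearIndependent.pair_iff]
  intro a b hab
  have hb : b = 0 := by
    by_contra hb
    apply hst
    refine (hs.isRootOf.eq_of_smul (c := -a / b) (r := t) ?_).symm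
    convert ht.isRootOf using 1
    have h1 : b • cs.posRoot t = -(a • cs.posRoot s) := eq_neg_of_add_eq_zero_right hab
    rw [div_eq_inv_mul, mul_smul, neg_smul, ← h1, smul_smul, inv_mul_cancel₀ hb, one_smul]
  subst hb
  refine ⟨?_, rfl⟩
  rw [zero_smul, add_zero] at hab
  exact (smul_eq_zero.mp hab).resolve_right hs.isRootOf.ne_zero

/-- A simple reflection changes only the `j`-th coordinate. If it turned `β` negative, the other
coordinates would vanish and `β` would be a multiple of `α_j`. -/
theorem geomRep_simple_nonneg {t : W} {j : B} {β : B →₀ ℝ} (h : cs.IsRootOf β t) (h0 : 0 ≤ β)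
    (htj : t ≠ cs.simple j) : 0 ≤ cs.geomRep (cs.simple j) β := by
  rcases (h.conj (cs.simple j)).nonneg_or_nonpos with h1 | h1
  · exact h1
  exfalso
  apply htj
  refine (cs.isRootOf_simple j).eq_of_smul (c := β j) ?_
  convert h using 1
  ext i
  by_cases hij : i = j
  · subst hij
    simp [CoxeterMatrix.simpleRoot]
  · have h2 := h1 i
    have h3 := h0 i
    rw [geomRep_simple] at h2
    have hz : M.simpleRoot j i = 0 := by
      simp [CoxeterMatrix.simpleRoot, Ne.symm hij]
    simp only [Finsupp.coe_sub, Finsupp.coe_smul, Pi.sub_apply, Pi.smul_apply, hz, smul_zero,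
      sub_zero, Finsupp.coe_zero, Pi.zero_apply] at h2 h3 ⊢
    linarith

/-- Induction over `w = s_j u`. The image under `u` is positive, and `s_j` can make it negative only
if `u t u⁻¹ = s_j`; then `w t = u` is shorter than `w`. -/
theorem geomRep_posRoot_nonneg_of_lt {t : W} (ht : cs.IsReflection t) {w : W}
    (h : cs.length w < cs.length (w * t)) : 0 ≤ cs.geomRep w (cs.posRoot t) := by
  induction hn : cs.length w using Nat.strong_induction_on generalizing w with
  | _ n ih =>
  by_cases hw : w = 1
  · subst hw; simpa using cs.posRoot_nonneg t
  obtain ⟨j, hj⟩ := cs.exists_leftDescent_of_ne_one hw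
  rw [isLeftDescent_iff] at hj
  have hmul : w = cs.simple j * (cs.simple j * w) := by simp
  generalize cs.simple j * w = u at *
  subst hmul
  have h1 := cs.length_simple_mul (u * t) j
  rw [mul_assoc] at h
  have h2 := ih (cs.length u) (by omega) (w := u) (by omega) rfl
  rw [map_mul, LinearEquiv.mul_apply]
  apply geomRep_simple_nonneg (ht.isRootOf.conj u) h2
  intro h3
  have e : cs.simple j * (u * t) = u := by
    rw [← h3, mul_assoc, inv_mul_cancel_left, mul_assoc, ht.mul_self, mul_one]
  rw [e] at h
  omega

theorem IsReflection.length_mul_right_lt_iff {t : W} (ht : cs.IsReflection t) {w : W} :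
    cs.length (w * t) < cs.length w ↔ cs.geomRep w (cs.posRoot t) ≤ 0 := by
  constructor
  · intro h
    have := geomRep_posRoot_nonneg_of_lt ht (w := w * t) (by rwa [mul_assoc, ht.mul_self, mul_one])
    rw [map_mul, LinearEquiv.mul_apply, ht.isRootOf.geomRep_apply, ht.isRootOf.bilin_self] at this
    have e : cs.posRoot t - (2 : ℝ) • cs.posRoot t = -cs.posRoot t := by module
    rw [e, map_neg] at this
    simpa using this
  · intro h
    by_contra hlt
    have h1 : cs.length w < cs.length (w * t) :=
      lt_of_le_of_ne (not_lt.mp hlt) (ht.length_mul_left_ne w).symm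
    have h2 := geomRep_posRoot_nonneg_of_lt ht h1
    exact (ht.isRootOf.conj w).ne_zero (le_antisymm h h2)

theorem IsReflection.length_mul_left_lt_iff {t : W} (ht : cs.IsReflection t) {w : W} :
    cs.length (t * w) < cs.length w ↔ cs.geomRep w⁻¹ (cs.posRoot t) ≤ 0 := by
  rw [← ht.length_mul_right_lt_iff, ← cs.length_inv (t * w), mul_inv_rev, ht.inv, cs.length_inv w]

/-- Apply `b a` to `(0, φ)` in `V × V*`: the first component is a combination of the roots of `a`
and `b` with coefficients governed by the values of `φ`. As independent roots can be given arbitrary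
values, these components fill the plane of `r₁`, `r₂`, while those of `t₂ t₁` stay in `P`. The
factor `V*` makes this work even when the bilinear form is degenerate on the plane. -/
theorem IsReflection.posRoot_mem_span {t₁ t₂ r₁ r₂ : W} (h1 : cs.IsReflection t₁)
    (h2 : cs.IsReflection t₂) (h3 : cs.IsReflection r₁) (h4 : cs.IsReflection r₂)
    (hr : r₁ ≠ r₂) (h : t₂ * t₁ = r₂ * r₁) {P : Submodule ℝ (B →₀ ℝ)}
    (hP1 : cs.posRoot t₁ ∈ P) (hP2 : cs.posRoot t₂ ∈ P) :
    cs.posRoot r₁ ∈ P ∧ cs.posRoot r₂ ∈ P := by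
  have hdual : ∀ x y : ℝ, ∃ φ : Module.Dual ℝ (B →₀ ℝ),
      φ (cs.posRoot r₁) = x ∧ φ (cs.posRoot r₂) = y := by
    intro x y
    have hli := posRoot_linearIndependent h3 h4 hr
    obtain ⟨φ, hφ⟩ := LinearMap.exists_extend
      ((Finsupp.linearCombination ℝ ![x, y]).comp hli.repr)
    have key : ∀ i : Fin 2, φ (![cs.posRoot r₁, cs.posRoot r₂] i) = ![x, y] i := by
      intro i
      have := LinearMap.congr_fun hφ ⟨_, Submodule.subset_span (Set.mem_range_self i)⟩
      simp only [LinearMap.comp_apply, Submodule.subtype_apply] at this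
      rw [this]
      simp [hli.repr_eq_single i]
    exact ⟨φ, key 0, key 1⟩
  have hcalc : ∀ {a b : W}, cs.IsReflection a → cs.IsReflection b →
      ∀ φ : Module.Dual ℝ (B →₀ ℝ), (cs.extRep (b * a) (0, φ)).1 =
      -(φ (cs.posRoot a) • cs.posRoot a) - (φ (cs.posRoot b) -
        φ (cs.posRoot a) * M.bilin (cs.posRoot b) (cs.posRoot a)) • cs.posRoot b := by
    intro a b ha hb φ
    rw [map_mul, LinearEquiv.mul_apply, ha.isRootOf.extRep_apply, hb.isRootOf.extRep_apply]
    simp [CoxeterMatrix.extPairing_apply]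
    module
  have hmem : ∀ φ : Module.Dual ℝ (B →₀ ℝ), -(φ (cs.posRoot r₁) • cs.posRoot r₁) -
      (φ (cs.posRoot r₂) - φ (cs.posRoot r₁) * M.bilin (cs.posRoot r₂) (cs.posRoot r₁)) •
        cs.posRoot r₂ ∈ P := by
    intro φ
    rw [← hcalc h3 h4, ← h, hcalc h1 h2]
    exact P.sub_mem (P.neg_mem (P.smul_mem _ hP1)) (P.smul_mem _ hP2)
  constructor
  -- These values cancel the coefficient of the root of `r₂`; the values `0`, `1` below cancel that
  -- of `r₁`.
  · obtain ⟨φ, e1, e2⟩ := hdual 1 (M.bilin (cs.posRoot r₂) (cs.posRoot r₁))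
    have := hmem φ
    rw [e1, e2] at this
    simpa using this
  · obtain ⟨φ, e1, e2⟩ := hdual 0 1
    have := hmem φ
    rw [e1, e2] at this
    simpa using this

/-- The sum of the coordinates. -/
noncomputable def coordSum (B : Type*) : (B →₀ ℝ) →ₗ[ℝ] ℝ :=
  Finsupp.linearCombination ℝ fun _ => 1

theorem coordSum_pos {α : B →₀ ℝ} (h : 0 ≤ α) (h0 : α ≠ 0) : 0 < coordSum B α := by
  rw [coordSum, Finsupp.linearCombination_apply, Finsupp.sum]
  simp only [smul_eq_mul, mul_one]
  obtain ⟨i, hi⟩ := Finsupp.ne_iff.mp h0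
  apply Finset.sum_pos'
  · exact fun i _ => h i
  · exact ⟨i, Finsupp.mem_support_iff.mpr hi, lt_of_le_of_ne (h i) (Ne.symm hi)⟩

theorem IsReflection.coordSum_posRoot_pos {t : W} (ht : cs.IsReflection t) :
    0 < coordSum B (cs.posRoot t) :=
  coordSum_pos (cs.posRoot_nonneg t) ht.isRootOf.ne_zero

end CoxeterSystem

/-! ### Reflection subgroups whose roots lie in a plane. -/

namespace CoxeterSystem

variable {B W : Type*} [Group W] {M : CoxeterMatrix B} {cs : CoxeterSystem M W}

/-- The reflections in a subgroup. -/
def reflectionsIn (cs : CoxeterSystem M W) (H : Subgroup W) : Set W :=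
  {t | cs.IsReflection t ∧ t ∈ H}

theorem conj_mem_reflectionsIn {H : Subgroup W} {x t : W} (hx : x ∈ cs.reflectionsIn H)
    (ht : t ∈ cs.reflectionsIn H) : x * t * x ∈ cs.reflectionsIn H := by
  refine ⟨?_, H.mul_mem (H.mul_mem hx.2 ht.2) hx.2⟩
  have := ht.1.conj x
  rwa [hx.1.inv] at this

/-- Left multiplication by `s_i` conjugates inversions by `s_i`, with `s_i` itself as the only
possible exception. -/
theorem finite_leftInversions (cs : CoxeterSystem M W) (w : W) :
    {t | cs.IsLeftInversion w t}.Finite := by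
  induction w using cs.simple_induction_left with
  | one => simp [IsLeftInversion]
  | mul_simple_left w i ih =>
    apply ((ih.image fun t => cs.simple i * t * cs.simple i).insert (cs.simple i)).subset
    rintro t ⟨ht, hlt⟩
    by_cases hti : t = cs.simple i
    · exact Or.inl hti
    refine Or.inr ⟨cs.simple i * t * cs.simple i, ⟨?_, ?_⟩, ?_⟩
    · simpa using ht.conj (cs.simple i)
    · have h1 := geomRep_simple_nonneg ht.isRootOf (cs.posRoot_nonneg t) hti
      have h2 := ht.isRootOf.conj (cs.simple i)
      have h3 := h2.eq_posRoot h1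
      rw [inv_simple] at h2 h3
      rw [h2.isReflection.length_mul_left_lt_iff, ← h3]
      rw [ht.length_mul_left_lt_iff, mul_inv_rev, map_mul, LinearEquiv.mul_apply,
        inv_simple] at hlt
      exact hlt
    · simp [mul_assoc]

/-- All roots of the reflections of `H` lie in a plane `P`, on which `g` and the sum of the
coordinates are coordinates. -/
structure IsPlanar (cs : CoxeterSystem M W) (H : Subgroup W) (P : Submodule ℝ (B →₀ ℝ))
    (g : Module.Dual ℝ (B →₀ ℝ)) : Prop where
  mem : ∀ t ∈ cs.reflectionsIn H, cs.posRoot t ∈ P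
  eq_zero : ∀ x ∈ P, coordSum B x = 0 → g x = 0 → x = 0

/-- The slope of the positive root of a reflection. -/
noncomputable def slope (cs : CoxeterSystem M W) (g : Module.Dual ℝ (B →₀ ℝ)) (t : W) : ℝ :=
  g (cs.posRoot t) / coordSum B (cs.posRoot t)

/-- The area form with respect to the coordinates `coordSum` and `g`. -/
noncomputable def area (g : Module.Dual ℝ (B →₀ ℝ)) (x y : B →₀ ℝ) : ℝ :=
  coordSum B x * g y - coordSum B y * g x

theorem slope_lt_iff {g : Module.Dual ℝ (B →₀ ℝ)} {s t : W} (hs : cs.IsReflection s)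
    (ht : cs.IsReflection t) :
    cs.slope g s < cs.slope g t ↔ 0 < area g (cs.posRoot s) (cs.posRoot t) := by
  rw [slope, slope, div_lt_div_iff₀ hs.coordSum_posRoot_pos ht.coordSum_posRoot_pos, area, sub_pos,
    mul_comm (g _), mul_comm (g _)]

theorem slope_neg (g : Module.Dual ℝ (B →₀ ℝ)) (t : W) : cs.slope (-g) t = -cs.slope g t := by
  simp [slope, neg_div]

theorem IsReflection.mul_mul_mul_mul_cancel {a : W} (ha : cs.IsReflection a) (t : W) :
    a * (a * t * a) * a = t := by
  simp only [mul_assoc, ha.mul_self, mul_one]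
  rw [← mul_assoc, ha.mul_self, one_mul]

theorem IsReflection.conj_ne {a t : W} (ha : cs.IsReflection a) (hta : t ≠ a) :
    a * t * a ≠ a := by
  intro he
  apply hta
  rw [← ha.mul_mul_mul_mul_cancel t, he, ha.mul_self, one_mul]

theorem slope_neg_le {H : Subgroup W} {g : Module.Dual ℝ (B →₀ ℝ)} {b : W}
    (hmax : ∀ t ∈ cs.reflectionsIn H, cs.slope g t ≤ cs.slope g b) :
    ∀ t ∈ cs.reflectionsIn H, cs.slope (-g) b ≤ cs.slope (-g) t :=
  fun t ht => by simpa [slope_neg] using hmax t ht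

namespace IsPlanar

variable {H : Subgroup W} {P : Submodule ℝ (B →₀ ℝ)} {g : Module.Dual ℝ (B →₀ ℝ)}
  (h : cs.IsPlanar H P g)

include h

theorem neg : cs.IsPlanar H P (-g) :=
  ⟨h.mem, fun x hx h1 h2 => h.eq_zero x hx h1 (by simpa using h2)⟩

/-- Cramer's relation between three vectors of a plane. It is the source of all betweenness
statements below. -/
theorem area_smul_add {x y z : B →₀ ℝ} (hx : x ∈ P) (hy : y ∈ P) (hz : z ∈ P) :
    area g x y • z + area g y z • x + area g z x • y = 0 := by
  apply h.eq_zero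
  · exact P.add_mem (P.add_mem (P.smul_mem _ hz) (P.smul_mem _ hx)) (P.smul_mem _ hy)
  · simp [area]; ring
  · simp [area]; ring

theorem slope_injOn : Set.InjOn (cs.slope g) (cs.reflectionsIn H) := by
  intro s hs t ht hst
  by_contra hne
  have h1 : area g (cs.posRoot s) (cs.posRoot t) = 0 := by
    rw [slope, slope, div_eq_div_iff hs.1.coordSum_posRoot_pos.ne'
      ht.1.coordSum_posRoot_pos.ne'] at hst
    rw [area]; linarith
  have h2 : coordSum B (cs.posRoot s) • cs.posRoot t - coordSum B (cs.posRoot t) • cs.posRoot s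
      = 0 := by
    apply h.eq_zero
    · exact P.sub_mem (P.smul_mem _ (h.mem t ht)) (P.smul_mem _ (h.mem s hs))
    · simp; ring
    · simpa [area] using h1
  have h3 := LinearIndependent.pair_iff.mp (posRoot_linearIndependent hs.1 ht.1 hne)
    (-coordSum B (cs.posRoot t)) (coordSum B (cs.posRoot s)) (by rw [← h2]; module)
  exact hs.1.coordSum_posRoot_pos.ne' h3.2

theorem exists_posRoot_eq {x y z : W} (hx : x ∈ cs.reflectionsIn H) (hy : y ∈ cs.reflectionsIn H)
    (hz : z ∈ cs.reflectionsIn H) (hxy : cs.slope g x < cs.slope g y)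
    (hyz : cs.slope g y < cs.slope g z) : ∃ p q : ℝ, 0 < p ∧ 0 < q ∧
      cs.posRoot y = p • cs.posRoot x + q • cs.posRoot z := by
  have hxz := hxy.trans hyz
  rw [slope_lt_iff hx.1 hy.1] at hxy
  rw [slope_lt_iff hy.1 hz.1] at hyz
  rw [slope_lt_iff hx.1 hz.1] at hxz
  have key := h.area_smul_add (h.mem x hx) (h.mem y hy) (h.mem z hz)
  refine ⟨_, _, div_pos hyz hxz, div_pos hxy hxz, ?_⟩
  generalize cs.posRoot x = a at *
  generalize cs.posRoot y = b at *
  generalize cs.posRoot z = c at *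
  have h1 : area g a c • b = area g a b • c + area g b c • a := by
    have : area g c a = - area g a c := by simp [area]
    rw [this, neg_smul] at key
    exact (add_neg_eq_zero.mp key).symm
  rw [div_eq_inv_mul, div_eq_inv_mul, mul_smul, mul_smul, ← smul_add, add_comm, ← h1, smul_smul,
    inv_mul_cancel₀ hxz.ne', one_smul]

/-- A root between two others is a positive combination of them, so `w⁻¹` makes it negative if it
makes both of them negative. The companion lemma is the same for positive signs: inversions and
noninversions are both convex. -/
theorem length_lt_of_between {w x y z : W} (hx : x ∈ cs.reflectionsIn H)
    (hy : y ∈ cs.reflectionsIn H) (hz : z ∈ cs.reflectionsIn H)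
    (hxy : cs.slope g x < cs.slope g y) (hyz : cs.slope g y < cs.slope g z)
    (h1 : cs.length (x * w) < cs.length w) (h2 : cs.length (z * w) < cs.length w) :
    cs.length (y * w) < cs.length w := by
  obtain ⟨p, q, hp, hq, hpq⟩ := h.exists_posRoot_eq hx hy hz hxy hyz
  rw [hx.1.length_mul_left_lt_iff] at h1
  rw [hz.1.length_mul_left_lt_iff] at h2
  rw [hy.1.length_mul_left_lt_iff, hpq, map_add, map_smul, map_smul]
  exact add_nonpos (smul_nonpos_of_nonneg_of_nonpos hp.le h1)
    (smul_nonpos_of_nonneg_of_nonpos hq.le h2)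

theorem not_length_lt_of_between {w x y z : W} (hx : x ∈ cs.reflectionsIn H)
    (hy : y ∈ cs.reflectionsIn H) (hz : z ∈ cs.reflectionsIn H)
    (hxy : cs.slope g x < cs.slope g y) (hyz : cs.slope g y < cs.slope g z)
    (h1 : ¬ cs.length (x * w) < cs.length w) (h2 : ¬ cs.length (z * w) < cs.length w) :
    ¬ cs.length (y * w) < cs.length w := by
  obtain ⟨p, q, hp, hq, hpq⟩ := h.exists_posRoot_eq hx hy hz hxy hyz
  rw [hx.1.length_mul_left_lt_iff] at h1
  rw [hz.1.length_mul_left_lt_iff] at h2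
  rw [hy.1.length_mul_left_lt_iff]
  have h1' := (hx.1.isRootOf.conj w⁻¹).nonneg_or_nonpos.resolve_right h1
  have h2' := (hz.1.isRootOf.conj w⁻¹).nonneg_or_nonpos.resolve_right h2
  have h3 := hy.1.isRootOf.conj w⁻¹
  rw [← h3.not_nonneg_iff, not_not, hpq, map_add, map_smul, map_smul]
  exact add_nonneg (smul_nonneg hp.le h1') (smul_nonneg hq.le h2')

section minimal

variable {a : W} (ha : a ∈ cs.reflectionsIn H)
  (hmin : ∀ t ∈ cs.reflectionsIn H, cs.slope g a ≤ cs.slope g t)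

include ha hmin

theorem slope_lt_of_ne {t : W} (ht : t ∈ cs.reflectionsIn H) (hta : t ≠ a) :
    cs.slope g a < cs.slope g t :=
  lt_of_le_of_ne (hmin t ht) fun he => hta (h.slope_injOn ha ht he).symm

/-- If `a` made the root of `t` negative, its opposite would be the positive root of `a t a`. Adding
a multiple of the root of `a` does not change the area with it, so this root would lie strictly
below `a`, against minimality. -/
theorem geomRep_posRoot_nonneg {t : W} (ht : t ∈ cs.reflectionsIn H) (hta : t ≠ a) :
    0 ≤ cs.geomRep a (cs.posRoot t) := by
  have h1 := ht.1.isRootOf.conj a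
  by_contra hneg
  rw [h1.not_nonneg_iff] at hneg
  have h2 := h1.neg.eq_posRoot (by simpa using hneg)
  rw [ha.1.inv] at h2
  have h3 := conj_mem_reflectionsIn ha ht
  have h4 := h.slope_lt_of_ne ha hmin ht hta
  have h5 := hmin _ h3
  rw [← not_lt, slope_lt_iff h3.1 ha.1, ← h2, ha.1.isRootOf.geomRep_apply] at h5
  rw [slope_lt_iff ha.1 ht.1] at h4
  apply h5
  simp only [area, map_neg, map_sub, map_smul, smul_eq_mul] at h4 ⊢
  linarith

theorem posRoot_conj {t : W} (ht : t ∈ cs.reflectionsIn H) (hta : t ≠ a) :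
    cs.posRoot (a * t * a) = cs.geomRep a (cs.posRoot t) := by
  have h1 := (ht.1.isRootOf.conj a).eq_posRoot (h.geomRep_posRoot_nonneg ha hmin ht hta)
  rw [ha.1.inv] at h1
  exact h1.symm

/-- The reflection `a` reverses orientation in the plane and preserves positivity away from its own
root, hence it reverses the order of slopes. -/
theorem slope_conj_lt {s t : W} (hs : s ∈ cs.reflectionsIn H) (hsa : s ≠ a)
    (ht : t ∈ cs.reflectionsIn H) (hta : t ≠ a) (hst : cs.slope g s < cs.slope g t) :
    cs.slope g (a * t * a) < cs.slope g (a * s * a) := by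
  rw [slope_lt_iff (conj_mem_reflectionsIn ha ht).1 (conj_mem_reflectionsIn ha hs).1,
    h.posRoot_conj ha hmin ht hta, h.posRoot_conj ha hmin hs hsa, ha.1.isRootOf.geomRep_apply,
    ha.1.isRootOf.geomRep_apply]
  rw [slope_lt_iff hs.1 ht.1] at hst
  have key := congrArg (M.bilin (cs.posRoot a))
    (h.area_smul_add (h.mem s hs) (h.mem t ht) (h.mem a ha))
  simp only [map_add, map_smul, ha.1.isRootOf.bilin_self, smul_eq_mul, map_zero] at key
  simp only [area, map_sub, map_smul, smul_eq_mul] at *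
  nlinarith

theorem length_mul_lt_iff_of_min {t : W} (ht : t ∈ cs.reflectionsIn H) :
    cs.length (t * a) < cs.length a ↔ t = a := by
  constructor
  · intro hlt
    by_contra hta
    rw [ht.1.length_mul_left_lt_iff, ha.1.inv] at hlt
    have h1 := h.geomRep_posRoot_nonneg ha hmin ht hta
    exact (ht.1.isRootOf.conj a).ne_zero (le_antisymm hlt h1)
  · rintro rfl
    rw [ha.1.mul_self, length_one]
    exact ha.1.odd_length.pos

theorem mem_canonicalGenerators_of_min : a ∈ cs.canonicalGenerators H := by
  refine ⟨ha.1, ?_⟩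
  ext t
  simp only [Set.mem_ofPred_eq, Set.mem_singleton_iff]
  constructor
  · rintro ⟨h1, h2, h3⟩
    exact (h.length_mul_lt_iff_of_min ha hmin ⟨h1, h2⟩).mp h3
  · rintro rfl
    exact ⟨ha.1, ha.2, (h.length_mul_lt_iff_of_min ha hmin ha).mpr rfl⟩

/-- First `t a` is shorter than `t`. Next, `t` sends the root of `a` to the opposite of the positive
root of `t a t`, which `a` keeps positive, so multiplying `t a` by `a` on the left shortens it
again. The case `t a t = a` would make the two roots proportional. -/
theorem length_conj_lt_of_min {t : W} (ht : t ∈ cs.reflectionsIn H) (hta : t ≠ a)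
    (hlt : cs.length (a * t) < cs.length t) : cs.length (a * t * a) < cs.length t := by
  have h1 : cs.length (t * a) < cs.length t := by
    rwa [← cs.length_inv (t * a), mul_inv_rev, ht.1.inv, ha.1.inv]
  rw [mul_assoc]
  refine lt_trans ?_ h1
  rw [ha.1.length_mul_left_lt_iff, mul_inv_rev, ha.1.inv, ht.1.inv, map_mul,
    LinearEquiv.mul_apply]
  rw [ha.1.length_mul_left_lt_iff, ht.1.inv] at hlt
  have h2 := (ha.1.isRootOf.conj t)
  have h3 := h2.neg.eq_posRoot (by simpa using hlt)
  rw [ht.1.inv] at h3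
  by_cases htat : t * a * t = a
  · exfalso
    rw [htat, ht.1.isRootOf.geomRep_apply] at h3
    have h4 := LinearIndependent.pair_iff.mp (posRoot_linearIndependent ha.1 ht.1 (Ne.symm hta))
      2 (-M.bilin (cs.posRoot t) (cs.posRoot a)) (by
        rw [← sub_eq_zero.mpr h3.symm]
        module)
    exact two_ne_zero h4.1
  · have h5 := h.geomRep_posRoot_nonneg ha hmin (conj_mem_reflectionsIn ht ha) htat
    rw [← h3, map_neg] at h5
    simpa using h5

/-- Without a maximum, the reflections not above `c` are few: they are all inversions of `c`, a
finite set. So there is a second smallest reflection `d`, and since conjugation by `a` reverses the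
order, `a d a` is the maximum after all. -/
theorem exists_max_of_min {c : W} (hc : c ∈ cs.reflectionsIn H) (hca : c ≠ a) :
    ∃ b ∈ cs.reflectionsIn H, ∀ t ∈ cs.reflectionsIn H, cs.slope g t ≤ cs.slope g b := by
  by_contra! hno
  have hself : cs.length (c * c) < cs.length c := by
    rw [hc.1.mul_self, length_one]; exact hc.1.odd_length.pos
  have hfin : {t | t ∈ cs.reflectionsIn H ∧ cs.length (t * c) < cs.length c}.Finite :=
    (cs.finite_leftInversions c).subset fun t ht => ⟨ht.1.1, ht.2⟩
  obtain ⟨q, hq, hqmax⟩ := Set.exists_max_image _ (cs.slope g) hfin ⟨c, hc, hself⟩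
  obtain ⟨y, hy, hqy⟩ := hno q hq.1
  have hyN : ¬ cs.length (y * c) < cs.length c := fun hyN => by
    have := hqmax y ⟨hy, hyN⟩
    linarith
  have hcy : cs.slope g c < cs.slope g y := lt_of_le_of_lt (hqmax c ⟨hc, hself⟩) hqy
  have hac := h.slope_lt_of_ne ha hmin hc hca
  -- Otherwise `c` lies between the two noninversions `a` and `y` of `c`, although it is an
  -- inversion of itself.
  have haN : cs.length (a * c) < cs.length c := by
    by_contra haN
    exact h.not_length_lt_of_between ha hc hy hac hcy haN hyN hself
  have hfin2 : {t | t ∈ cs.reflectionsIn H ∧ t ≠ a ∧ cs.slope g t ≤ cs.slope g c}.Finite := by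
    apply hfin.subset
    rintro t ⟨ht, hta, htc⟩
    refine ⟨ht, ?_⟩
    rcases htc.lt_or_eq with htc | htc
    · exact h.length_lt_of_between ha ht hc (h.slope_lt_of_ne ha hmin ht hta) htc haN hself
    · rw [h.slope_injOn ht hc htc]; exact hself
  obtain ⟨d, ⟨hd, hda, hdc⟩, hdmin⟩ :=
    Set.exists_min_image _ (cs.slope g) hfin2 ⟨c, hc, hca, le_rfl⟩
  have hdmin' : ∀ t ∈ cs.reflectionsIn H, t ≠ a → cs.slope g d ≤ cs.slope g t := by
    intro t ht hta
    rcases le_or_gt (cs.slope g t) (cs.slope g c) with htc | htc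
    · exact hdmin t ⟨ht, hta, htc⟩
    · exact hdc.trans htc.le
  obtain ⟨z, hz, hdz⟩ := hno _ (conj_mem_reflectionsIn ha hd)
  have hza : z ≠ a := by
    rintro rfl
    have := hmin _ (conj_mem_reflectionsIn ha hd)
    linarith
  have h1 := h.slope_conj_lt ha hmin (conj_mem_reflectionsIn ha hd)
    (ha.1.conj_ne hda) hz hza hdz
  rw [ha.1.mul_mul_mul_mul_cancel] at h1
  have := hdmin' _ (conj_mem_reflectionsIn ha hz) (ha.1.conj_ne hza)
  linarith

end minimal

/-- With neither extreme, there are reflections on both sides of the finite inversion set of `c`;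
then `c`, an inversion of itself, lies between two noninversions. -/
theorem exists_min_or_max {c : W} (hc : c ∈ cs.reflectionsIn H) :
    (∃ a ∈ cs.reflectionsIn H, ∀ t ∈ cs.reflectionsIn H, cs.slope g a ≤ cs.slope g t) ∨
    (∃ b ∈ cs.reflectionsIn H, ∀ t ∈ cs.reflectionsIn H, cs.slope g t ≤ cs.slope g b) := by
  by_contra! hno
  obtain ⟨hno1, hno2⟩ := hno
  have hself : cs.length (c * c) < cs.length c := by
    rw [hc.1.mul_self, length_one]; exact hc.1.odd_length.pos
  have hfin : {t | t ∈ cs.reflectionsIn H ∧ cs.length (t * c) < cs.length c}.Finite :=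
    (cs.finite_leftInversions c).subset fun t ht => ⟨ht.1.1, ht.2⟩
  obtain ⟨p, hp, hpmin⟩ := Set.exists_min_image _ (cs.slope g) hfin ⟨c, hc, hself⟩
  obtain ⟨q, hq, hqmax⟩ := Set.exists_max_image _ (cs.slope g) hfin ⟨c, hc, hself⟩
  obtain ⟨x, hx, hxp⟩ := hno1 p hp.1
  obtain ⟨y, hy, hqy⟩ := hno2 q hq.1
  have hxN : ¬ cs.length (x * c) < cs.length c := fun hN => by
    have := hpmin x ⟨hx, hN⟩
    linarith
  have hyN : ¬ cs.length (y * c) < cs.length c := fun hN => by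
    have := hqmax y ⟨hy, hN⟩
    linarith
  exact h.not_length_lt_of_between hx hc hy (lt_of_lt_of_le hxp (hpmin c ⟨hc, hself⟩))
    (lt_of_le_of_lt (hqmax c ⟨hc, hself⟩) hqy) hxN hyN hself

theorem exists_min_max {c d : W} (hc : c ∈ cs.reflectionsIn H) (hd : d ∈ cs.reflectionsIn H)
    (hcd : c ≠ d) :
    ∃ a ∈ cs.reflectionsIn H, ∃ b ∈ cs.reflectionsIn H, a ≠ b ∧
      (∀ t ∈ cs.reflectionsIn H, cs.slope g a ≤ cs.slope g t) ∧
      (∀ t ∈ cs.reflectionsIn H, cs.slope g t ≤ cs.slope g b) := by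
  have hne : ∀ x : W, ∃ e ∈ cs.reflectionsIn H, e ≠ x := fun x => by
    by_cases hcx : c = x
    · exact ⟨d, hd, fun h => hcd (hcx.trans h.symm)⟩
    · exact ⟨c, hc, hcx⟩
  have hab : ∀ {a b : W}, (∀ t ∈ cs.reflectionsIn H, cs.slope g a ≤ cs.slope g t) →
      (∀ t ∈ cs.reflectionsIn H, cs.slope g t ≤ cs.slope g b) → a ≠ b := by
    rintro a b h1 h2 rfl
    exact hcd (h.slope_injOn hc hd (le_antisymm ((h2 c hc).trans (h1 d hd))
      ((h2 d hd).trans (h1 c hc))))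
  rcases h.exists_min_or_max hc with ⟨a, ha, hmin⟩ | ⟨b, hb, hmax⟩
  · obtain ⟨e, he, hea⟩ := hne a
    obtain ⟨b, hb, hmax⟩ := h.exists_max_of_min ha hmin he hea
    exact ⟨a, ha, b, hb, hab hmin hmax, hmin, hmax⟩
  · obtain ⟨e, he, heb⟩ := hne b
    obtain ⟨a, ha, hmin⟩ := h.neg.exists_max_of_min hb
      (slope_neg_le hmax) he heb
    have hmin' : ∀ t ∈ cs.reflectionsIn H, cs.slope g a ≤ cs.slope g t :=
      fun t ht => by simpa [slope_neg] using hmin t ht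
    exact ⟨a, ha, b, hb, hab hmin' hmax, hmin', hmax⟩

variable {a b : W} (ha : a ∈ cs.reflectionsIn H) (hb : b ∈ cs.reflectionsIn H) (hab : a ≠ b)
  (hmin : ∀ t ∈ cs.reflectionsIn H, cs.slope g a ≤ cs.slope g t)
  (hmax : ∀ t ∈ cs.reflectionsIn H, cs.slope g t ≤ cs.slope g b)

include ha hb hmin hmax

theorem length_lt_or_length_lt {t w : W} (ht : t ∈ cs.reflectionsIn H)
    (hlt : cs.length (t * w) < cs.length w) :
    cs.length (a * w) < cs.length w ∨ cs.length (b * w) < cs.length w := by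
  by_contra! hno
  by_cases hta : t = a
  · subst hta; omega
  by_cases htb : t = b
  · subst htb; omega
  have h2 := h.neg.slope_lt_of_ne hb (slope_neg_le hmax) ht htb
  rw [slope_neg, slope_neg, neg_lt_neg_iff] at h2
  exact h.not_length_lt_of_between ha ht hb (h.slope_lt_of_ne ha hmin ht hta) h2
    (not_lt.mpr hno.1) (not_lt.mpr hno.2) hlt

/-- Convexity of noninversions shows that `a` or `b` shortens `t`, and then conjugation by it
shortens `t` too; induction on length. -/
theorem reflectionsIn_subset_closure : cs.reflectionsIn H ⊆ Subgroup.closure {a, b} := by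
  intro t ht
  induction hn : cs.length t using Nat.strong_induction_on generalizing t with
  | _ n ih =>
  have hmem : ∀ x ∈ ({a, b} : Set W), x ∈ Subgroup.closure ({a, b} : Set W) :=
    fun x hx => Subgroup.subset_closure hx
  have hself : cs.length (t * t) < cs.length t := by
    rw [ht.1.mul_self, length_one]; exact ht.1.odd_length.pos
  have step : ∀ x ∈ ({a, b} : Set W), x ∈ cs.reflectionsIn H →
      cs.length (x * t * x) < cs.length t → t ∈ Subgroup.closure ({a, b} : Set W) := by
    intro x hx hxH hlt
    have h1 := ih _ (hn ▸ hlt) (conj_mem_reflectionsIn hxH ht) rfl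
    rw [← hxH.1.mul_mul_mul_mul_cancel t]
    exact Subgroup.mul_mem _ (Subgroup.mul_mem _ (hmem x hx) h1) (hmem x hx)
  by_cases hta : t = a
  · exact hmem t (by simp [hta])
  by_cases htb : t = b
  · exact hmem t (by simp [htb])
  rcases h.length_lt_or_length_lt ha hb hmin hmax ht hself with hlt | hlt
  · exact step a (by simp) ha (h.length_conj_lt_of_min ha hmin ht hta hlt)
  · exact step b (by simp) hb (h.neg.length_conj_lt_of_min hb (slope_neg_le hmax)
      ht htb hlt)

theorem canonicalGenerators_eq : cs.canonicalGenerators H = {a, b} := by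
  ext t
  constructor
  · rintro ⟨ht, hN⟩
    have ht' : t ∈ {r | cs.IsReflection r ∧ r ∈ H ∧ cs.length (r * t) < cs.length t} := by
      rw [hN]; rfl
    rcases h.length_lt_or_length_lt ha hb hmin hmax ⟨ht, ht'.2.1⟩ ht'.2.2 with hlt | hlt
    · have : a ∈ {r | cs.IsReflection r ∧ r ∈ H ∧ cs.length (r * t) < cs.length t} :=
        ⟨ha.1, ha.2, hlt⟩
      rw [hN] at this
      exact Or.inl this.symm
    · have : b ∈ {r | cs.IsReflection r ∧ r ∈ H ∧ cs.length (r * t) < cs.length t} :=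
        ⟨hb.1, hb.2, hlt⟩
      rw [hN] at this
      exact Or.inr this.symm
  · rintro (rfl | rfl)
    · exact h.mem_canonicalGenerators_of_min ha hmin
    · exact h.neg.mem_canonicalGenerators_of_min hb (slope_neg_le hmax)

end IsPlanar

end CoxeterSystem

/-! ### Coxeter groups of rank two -/

namespace CoxeterSystem

section RankTwo

variable {D : CoxeterMatrix (Fin 2)} {G : Type*} [Group G] (ds : CoxeterSystem D G)

theorem simple_zero_mul_zpow (k : ℤ) : ds.simple 0 * (ds.simple 0 * ds.simple 1) ^ k =
    (ds.simple 0 * ds.simple 1) ^ (-k) * ds.simple 0 := by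
  have h : ds.simple 0 * (ds.simple 0 * ds.simple 1) * (ds.simple 0)⁻¹ =
      (ds.simple 0 * ds.simple 1)⁻¹ := by simp
  rw [zpow_neg, ← inv_zpow, ← h, conj_zpow]
  simp

theorem eq_zpow_or (w : G) : ∃ k : ℤ, w = (ds.simple 0 * ds.simple 1) ^ k ∨
    w = (ds.simple 0 * ds.simple 1) ^ k * ds.simple 0 := by
  induction w using ds.simple_induction_left with
  | one => exact ⟨0, by simp⟩
  | mul_simple_left w i ih =>
    have h0 : ∀ x : G, (∃ k : ℤ, x = (ds.simple 0 * ds.simple 1) ^ k ∨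
        x = (ds.simple 0 * ds.simple 1) ^ k * ds.simple 0) →
        ∃ k : ℤ, ds.simple 0 * x = (ds.simple 0 * ds.simple 1) ^ k ∨
        ds.simple 0 * x = (ds.simple 0 * ds.simple 1) ^ k * ds.simple 0 := by
      rintro x ⟨k, rfl | rfl⟩
      · exact ⟨-k, Or.inr (ds.simple_zero_mul_zpow k)⟩
      · refine ⟨-k, Or.inl ?_⟩
        rw [← mul_assoc, simple_zero_mul_zpow, simple_mul_simple_cancel_right]
    fin_cases i
    · exact h0 w ih
    · have : ds.simple 1 * w = ds.simple 0 * ((ds.simple 0 * ds.simple 1) * w) := by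
        rw [mul_assoc, simple_mul_simple_cancel_left]
      simp only [Fin.mk_one]
      rw [this]
      apply h0
      obtain ⟨k, rfl | rfl⟩ := ih
      · exact ⟨1 + k, Or.inl (by rw [zpow_add, zpow_one])⟩
      · exact ⟨1 + k, Or.inr (by rw [zpow_add, zpow_one]; simp only [mul_assoc])⟩

/-- Parity forces the form `r^k s₀` with `r = s₀ s₁`. This is the conjugate by `r^j` of `s₀` if `k =
2j`, and of `s₀ s₁ s₀` if `k = 2j + 1`. -/
theorem isReflection_of_odd {w : G} (h : Odd (ds.length w)) : ds.IsReflection w := by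
  have hpar : ds.lengthParity w = Multiplicative.ofAdd 1 := by
    rw [lengthParity_eq_ofAdd_length, (ZMod.natCast_eq_one_iff_odd).mpr h]
  obtain ⟨k, hk | hk⟩ := ds.eq_zpow_or w
  · exfalso
    rw [hk, map_zpow, map_mul, lengthParity_simple, lengthParity_simple] at hpar
    have : (Multiplicative.ofAdd (1 : ZMod 2) * Multiplicative.ofAdd (1 : ZMod 2)) = 1 := rfl
    rw [this, one_zpow] at hpar
    exact absurd hpar (by decide)
  · obtain ⟨j, rfl | rfl⟩ := Int.even_or_odd' k
    · have := (ds.isReflection_simple 0).conj ((ds.simple 0 * ds.simple 1) ^ j)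
      convert this using 1
      have h2 := ds.simple_zero_mul_zpow (-j)
      rw [zpow_neg, neg_neg] at h2
      rw [hk, mul_assoc, h2, ← mul_assoc, two_mul, zpow_add]
    · have := ((ds.isReflection_simple 1).conj (ds.simple 0)).conj
        ((ds.simple 0 * ds.simple 1) ^ j)
      convert this using 1
      have h2 := ds.simple_zero_mul_zpow (-j)
      rw [zpow_neg, neg_neg] at h2
      rw [hk, inv_simple, mul_assoc, mul_assoc (_ * _) (ds.simple 0), h2, ← mul_assoc,
        ← mul_assoc, two_mul, zpow_add, zpow_add, zpow_one]
      congr 1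
      rw [mul_assoc, mul_assoc]
      congr 1
      rw [← zpow_one_add, add_comm, zpow_add_one]

theorem isReflection_iff_odd {w : G} : ds.IsReflection w ↔ Odd (ds.length w) :=
  ⟨fun h => h.odd_length, ds.isReflection_of_odd⟩

theorem bruhatEdge_iff {x y : G} : ds.BruhatEdge x y ↔
    ds.length x < ds.length y ∧ Odd (ds.length x + ds.length y) := by
  rw [BruhatEdge, isReflection_iff_odd, Nat.odd_iff, length_mul_mod_two, length_inv, add_comm,
    Nat.odd_iff]

/-- The nontrivial permutation of `Fin 2`. -/
abbrev other (i : Fin 2) : Fin 2 := Equiv.swap 0 1 i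

theorem eq_or_eq_other (i j : Fin 2) : j = i ∨ j = other i := by
  fin_cases i <;> fin_cases j <;> simp [other]

theorem isLiftable_simple_other : D.IsLiftable fun i => ds.simple (other i) := by
  intro i j
  have : D i j = D (other i) (other j) := by
    have := D.symmetric 0 1
    fin_cases i <;> fin_cases j <;> simp [other, this]
  rw [this]
  exact ds.simple_mul_simple_pow _ _

/-- The automorphism exchanging the two simple reflections. -/
def swap : G →* G := ds.lift ⟨fun i => ds.simple (other i), ds.isLiftable_simple_other⟩

theorem swap_simple (i : Fin 2) : ds.swap (ds.simple i) = ds.simple (other i) := by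
  rw [swap, lift_apply_simple]

theorem swap_swap (x : G) : ds.swap (ds.swap x) = x := by
  have : ds.swap.comp ds.swap = MonoidHom.id G :=
    ds.ext_simple fun i => by simp [swap_simple]
  exact DFunLike.congr_fun this x

theorem swap_wordProd (ω : List (Fin 2)) :
    ds.swap (ds.wordProd ω) = ds.wordProd (ω.map other) := by
  induction ω with
  | nil => simp
  | cons i ω ih => rw [wordProd_cons, map_mul, ih, List.map_cons, wordProd_cons, swap_simple]

theorem length_swap (x : G) : ds.length (ds.swap x) = ds.length x := by
  have hle : ∀ y, ds.length (ds.swap y) ≤ ds.length y := by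
    intro y
    obtain ⟨ω, hω, rfl⟩ := ds.exists_isReduced y
    rw [swap_wordProd, hω.eq]
    exact (ds.length_wordProd_le _).trans (by simp)
  refine le_antisymm (hle x) ?_
  conv_lhs => rw [← ds.swap_swap x]
  exact hle _

/-- The alternating product of length `n` starting with the simple reflection `i`. -/
def altProd (i : Fin 2) : ℕ → G
  | 0 => 1
  | n + 1 => ds.simple i * altProd (other i) n

theorem length_altProd_le (i : Fin 2) (n : ℕ) : ds.length (ds.altProd i n) ≤ n := by
  induction n generalizing i with
  | zero => simp [altProd]
  | succ n ih =>
    rw [altProd]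
    have := ds.length_mul_le (ds.simple i) (ds.altProd (other i) n)
    rw [length_simple] at this
    have := ih (other i)
    omega

theorem swap_altProd (i : Fin 2) (n : ℕ) :
    ds.swap (ds.altProd i n) = ds.altProd (other i) n := by
  induction n generalizing i with
  | zero => simp [altProd]
  | succ n ih => rw [altProd, map_mul, ih, swap_simple, altProd]

theorem simple_mul_altProd (i : Fin 2) (n : ℕ) :
    ds.simple i * ds.altProd i (n + 1) = ds.altProd (other i) n := by
  rw [altProd, simple_mul_simple_cancel_left]

theorem exists_eq_altProd (x : G) : ∃ i, x = ds.altProd i (ds.length x) := by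
  induction hn : ds.length x generalizing x with
  | zero =>
    rw [length_eq_zero_iff] at hn
    exact ⟨0, by simp [altProd, hn]⟩
  | succ n ih =>
    have hx : x ≠ 1 := by
      rintro rfl
      simp at hn
    obtain ⟨i, hi⟩ := ds.exists_leftDescent_of_ne_one hx
    rw [isLeftDescent_iff] at hi
    obtain ⟨j, hj⟩ := ih (ds.simple i * x) (by omega)
    have hx2 : x = ds.simple i * ds.altProd j n := by rw [← hj, simple_mul_simple_cancel_left]
    rcases eq_or_eq_other i j with rfl | rfl
    · rcases n with _ | n
      · exact ⟨j, by rw [hx2]; simp [altProd]⟩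
      · exfalso
        rw [simple_mul_altProd] at hx2
        have := ds.length_altProd_le (other j) n
        rw [← hx2] at this
        omega
    · exact ⟨i, by rw [hx2, altProd]⟩

/-- Every element is an alternating product of its length, determined by its first letter, and
`swap` exchanges the two possible first letters. -/
theorem eq_or_eq_swap {x y : G} (h : ds.length x = ds.length y) : y = x ∨ y = ds.swap x := by
  obtain ⟨i, hi⟩ := ds.exists_eq_altProd x
  obtain ⟨j, hj⟩ := ds.exists_eq_altProd y
  rw [← h] at hj
  generalize ds.length x = n at *
  subst hi hj
  rw [swap_altProd]
  rcases eq_or_eq_other i j with rfl | rfl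
  exacts [Or.inl rfl, Or.inr rfl]

theorem exists_length_altProd_eq (y : G) {k : ℕ} (hk : k ≤ ds.length y) :
    ∃ j, ds.length (ds.altProd j k) = k := by
  obtain ⟨i, hi⟩ := ds.exists_eq_altProd y
  have hlen : ds.length (ds.altProd i (ds.length y)) = ds.length y := by rw [← hi]
  clear hi
  revert hlen
  generalize ds.length y = n at *
  intro hlen
  refine Nat.decreasingInduction (motive := fun n _ => ∃ j, ds.length (ds.altProd j n) = n)
    (fun m _ ⟨j, hj⟩ => ⟨other j, ?_⟩) ⟨i, hlen⟩ hk
  have h1 := ds.length_mul_le (ds.simple j) (ds.altProd (other j) m)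
  rw [length_simple, ← altProd, hj] at h1
  have h2 := ds.length_altProd_le (other j) m
  omega

theorem exists_length_eq (y : G) {k : ℕ} (hk : k ≤ ds.length y) : ∃ w, ds.length w = k :=
  let ⟨_, hj⟩ := ds.exists_length_altProd_eq y hk
  ⟨_, hj⟩

/-- If `x` were fixed, both alternating products of length `ℓ(x)` would equal `x`, so every simple
reflection would shorten `x`. But a reduced alternating product of length `ℓ(x) + 1` exists below
the length of `y`. -/
theorem swap_ne {x y : G} (hx : 0 < ds.length x) (hxy : ds.length x < ds.length y) :
    ds.swap x ≠ x := by
  intro he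
  obtain ⟨j, hj⟩ := ds.exists_length_altProd_eq y (k := ds.length x + 1) (by omega)
  obtain ⟨i, hi⟩ := ds.exists_eq_altProd x
  have hall : ∀ j', ds.altProd j' (ds.length x) = x := by
    intro j'
    have h1 := ds.swap_altProd i (ds.length x)
    rw [← hi, he] at h1
    rcases eq_or_eq_other i j' with rfl | rfl
    exacts [hi.symm, h1.symm]
  rw [altProd, hall] at hj
  obtain ⟨n, hn⟩ := Nat.exists_eq_succ_of_ne_zero hx.ne'
  have h2 := hall j
  rw [hn, Nat.succ_eq_add_one] at h2
  rw [← h2, simple_mul_altProd] at hj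
  have := ds.length_altProd_le (other j) n
  rw [h2] at hj
  omega

/-- A length increase of odd parity is an edge. For an even increase, any element of length `ℓ(x) +
1` serves as an intermediate vertex. -/
theorem bruhatLE_iff {x y : G} : ds.BruhatLE x y ↔ x = y ∨ ds.length x < ds.length y := by
  constructor
  · intro h
    induction h with
    | refl => exact Or.inl rfl
    | tail _ h2 ih =>
      right
      rcases ih with rfl | ih
      exacts [h2.1, ih.trans h2.1]
  · rintro (rfl | h)
    · exact Relation.ReflTransGen.refl
    by_cases hodd : Odd (ds.length x + ds.length y)
    · exact Relation.ReflTransGen.single (ds.bruhatEdge_iff.mpr ⟨h, hodd⟩)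
    · rw [Nat.odd_iff] at hodd
      obtain ⟨w, hw⟩ := ds.exists_length_eq y (k := ds.length x + 1) (by omega)
      refine (Relation.ReflTransGen.single (b := w) (ds.bruhatEdge_iff.mpr ?_)).tail
        (ds.bruhatEdge_iff.mpr ?_)
      · rw [Nat.odd_iff]; omega
      · rw [Nat.odd_iff]; omega

theorem swap_mem_midpoints {u v x : G} (h : x ∈ ds.midpoints u v) :
    ds.swap x ∈ ds.midpoints u v := by
  simpa only [midpoints, Set.mem_ofPred_eq, bruhatEdge_iff, length_swap] using h

theorem swap_ne_of_mem_midpoints {u v x : G} (hx : x ∈ ds.midpoints u v) : ds.swap x ≠ x :=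
  ds.swap_ne (Nat.zero_lt_of_lt hx.1.1) hx.2.1

end RankTwo

end CoxeterSystem

/-! ### Cosets of dihedral subgroups and the description of flips. -/

namespace CoxeterSystem

variable {B W : Type*} [Group W] {M : CoxeterMatrix B} {cs : CoxeterSystem M W}

/-- The hypothesis says that `a` sends the root of `t` to a positive root, which is then the
positive root of `a t a`. -/
theorem length_mul_mul_lt_iff {a t x : W} (ha : cs.IsReflection a) (ht : cs.IsReflection t)
    (h : ¬ cs.length (t * a) < cs.length a) :
    cs.length (t * (a * x)) < cs.length (a * x) ↔ cs.length (a * t * a * x) < cs.length x := by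
  have h1 := ht.isRootOf.conj a
  rw [ht.length_mul_left_lt_iff, ha.inv, ← h1.not_nonneg_iff, not_not] at h
  have h2 := h1.eq_posRoot h
  have h3 := h1.isReflection
  rw [ha.inv] at h2 h3
  rw [ht.length_mul_left_lt_iff, h3.length_mul_left_lt_iff, ← h2, mul_inv_rev, map_mul,
    LinearEquiv.mul_apply, ha.inv]

variable {D : CoxeterMatrix (Fin 2)} {G : Type*} [Group G] {ds : CoxeterSystem D G}

/-- `φ` embeds a Coxeter group of rank two as a maximal dihedral reflection subgroup, so that the
canonical generators are the images of the simple reflections. -/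
structure IsDihedralEmbedding (ds : CoxeterSystem D G) (cs : CoxeterSystem M W) (φ : G →* W) :
    Prop where
  injective : Function.Injective φ
  isReflection_iff : ∀ t, cs.IsReflection (φ t) ↔ ds.IsReflection t
  inversion : ∀ i t, ds.IsReflection t →
    (cs.length (φ t * φ (ds.simple i)) < cs.length (φ (ds.simple i)) ↔ t = ds.simple i)
  closed : ∀ t₁ t₂ r₁ r₂, cs.IsReflection (φ t₁) → cs.IsReflection (φ t₂) →
    cs.IsReflection r₁ → cs.IsReflection r₂ → r₁ ≠ r₂ → φ t₂ * φ t₁ = r₂ * r₁ → r₁ ∈ φ.range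

theorem inversion_simple (ds : CoxeterSystem D G) (i : Fin 2) (t : G) :
    ds.length (t * ds.simple i) < ds.length (ds.simple i) ↔ t = ds.simple i := by
  rw [length_simple, Nat.lt_one_iff, length_eq_zero_iff, mul_eq_one_iff_eq_inv, inv_simple]

theorem isDihedralEmbedding_id (ds : CoxeterSystem D G) :
    IsDihedralEmbedding ds ds (MonoidHom.id G) where
  injective := Function.injective_id
  isReflection_iff _ := Iff.rfl
  inversion i t _ := ds.inversion_simple i t
  closed _ _ r _ _ _ _ _ _ _ := ⟨r, rfl⟩

namespace IsDihedralEmbedding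

variable {φ : G →* W} (h : IsDihedralEmbedding ds cs φ) {z : W}

include h in
theorem apply_mul_left_inj {x y : G} : φ x * z = φ y * z ↔ x = y := by
  rw [mul_left_inj, h.injective.eq_iff]

variable (hz : ∀ g, cs.length z ≤ cs.length (φ g * z))

include h hz

/-- Inversions of products follow the rule `length_mul_mul_lt_iff` both in the rank-two group and in
the coset, and the simple generators have the same inversions in both. Minimality of `z` starts the
induction on `w`. -/
theorem length_lt_iff {t : G} (ht : ds.IsReflection t) (w : G) :
    cs.length (φ t * (φ w * z)) < cs.length (φ w * z) ↔
      ds.length (t * w) < ds.length w := by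
  induction w using ds.simple_induction_left generalizing t with
  | one => simpa using hz t
  | mul_simple_left w i ih =>
    have hs := ds.isReflection_simple i
    have hφs := (h.isReflection_iff _).mpr hs
    have hφt := (h.isReflection_iff _).mpr ht
    by_cases hti : t = ds.simple i
    · subst hti
      have h1 := ih hs
      have e1 : φ (ds.simple i) * (φ (ds.simple i * w) * z) = φ w * z := by
        rw [map_mul, ← mul_assoc, ← mul_assoc, hφs.mul_self, one_mul]
      have e2 : φ (ds.simple i * w) * z = φ (ds.simple i) * (φ w * z) := by
        rw [map_mul, mul_assoc]
      rw [e1, e2, simple_mul_simple_cancel_left]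
      have h2 := hφs.length_mul_right_ne (φ w * z)
      have h3 := ds.length_simple_mul_ne w i
      omega
    · have h1 := length_mul_mul_lt_iff hφs hφt (x := φ w * z)
        (by rwa [h.inversion i t ht])
      have h2 := length_mul_mul_lt_iff hs ht (x := w) (by rwa [ds.inversion_simple])
      have h3 : ds.IsReflection (ds.simple i * t * ds.simple i) := by
        simpa using ht.conj (ds.simple i)
      have h4 := ih h3
      rw [map_mul, map_mul] at h4
      rw [map_mul, mul_assoc (φ _) (φ w), h1, h2, h4]

theorem bruhatEdge_iff {x y : G} :
    cs.BruhatEdge (φ x * z) (φ y * z) ↔ ds.BruhatEdge x y := by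
  have e : φ y * z * (φ x * z)⁻¹ = φ (y * x⁻¹) := by simp [mul_assoc]
  rw [BruhatEdge, BruhatEdge, e, h.isReflection_iff]
  apply and_congr_left
  intro ht
  have h1 := h.length_lt_iff hz ht x
  have e2 : φ (y * x⁻¹) * (φ x * z) = φ y * z := by simp [mul_assoc]
  rw [e2, inv_mul_cancel_right] at h1
  have h2 := ((h.isReflection_iff _).mpr ht).length_mul_right_ne (φ x * z)
  have h3 := ht.length_mul_right_ne x
  rw [e2] at h2
  rw [inv_mul_cancel_right] at h3
  omega

/-- Lengths are not preserved by the embedding, but increasing chains of edges are. So the levels of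
the rank-two group stay separated in the coset. -/
theorem length_lt_of_length_lt {x y : G} (hxy : ds.length x < ds.length y) :
    cs.length (φ x * z) < cs.length (φ y * z) := by
  have hle := ds.bruhatLE_iff.mpr (Or.inr hxy)
  have key : ∀ y, ds.BruhatLE x y → cs.length (φ x * z) ≤ cs.length (φ y * z) := by
    intro y hy
    induction hy with
    | refl => exact le_rfl
    | tail _ h2 ih => exact ih.trans ((h.bruhatEdge_iff hz).mpr h2).1.le
  rcases Relation.ReflTransGen.cases_tail hle with he | ⟨w, hw, hwy⟩
  · subst he; omega
  · exact lt_of_le_of_lt (key w hw) ((h.bruhatEdge_iff hz).mpr hwy).1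

theorem mem_midpoints_iff {u v x : G} :
    φ x * z ∈ cs.midpoints (φ u * z) (φ v * z) ↔ x ∈ ds.midpoints u v := by
  simp only [midpoints, Set.mem_ofPred_eq, h.bruhatEdge_iff hz]

/-- The labels through `p` and those through `x` have the same product, so closedness puts the first
label of `p` in the image of `φ`. -/
theorem exists_eq_of_mem_midpoints {u v x : G} (hx : x ∈ ds.midpoints u v) {p : W}
    (hp : p ∈ cs.midpoints (φ u * z) (φ v * z)) :
    ∃ y ∈ ds.midpoints u v, p = φ y * z := by
  have hx' := (h.mem_midpoints_iff hz).mpr hx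
  have e1 : φ x * z * (φ u * z)⁻¹ = φ (x * u⁻¹) := by simp [mul_assoc]
  have e2 : φ v * z * (φ x * z)⁻¹ = φ (v * x⁻¹) := by simp [mul_assoc]
  have hmem := h.closed (x * u⁻¹) (v * x⁻¹) _ _ (e1 ▸ hx'.1.2) (e2 ▸ hx'.2.2) hp.1.2 hp.2.2
    (by
      intro he
      have h1 := hp.2.2.mul_self
      rw [← he] at h1
      have h3 : φ v * z * p⁻¹ * (p * (φ u * z)⁻¹) = 1 := by rw [← he, h1]
      have h4 : φ v * z = φ u * z := by
        rw [mul_assoc, inv_mul_cancel_left] at h3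
        exact mul_inv_eq_one.mp h3
      have := hp.1.1.trans hp.2.1
      rw [h4] at this
      exact lt_irrefl _ this)
    (by simp [mul_assoc])
  obtain ⟨r, hr⟩ := hmem
  have hpr : p = φ (r * u) * z := by
    rw [map_mul, hr, mul_assoc, inv_mul_cancel_right]
  refine ⟨r * u, ?_, hpr⟩
  rw [← h.mem_midpoints_iff hz, ← hpr]
  exact hp

/-- The involution is `swap`. A pair `p`, `q` with `ℓ(p) < ℓ(q)` and `q` not the flip of `p` must
lie on different levels, as a level consists of an element and its `swap`. -/
theorem exists_isFlipInvolution {u v x : G} (hx : x ∈ ds.midpoints u v) :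
    ∃ f, cs.IsFlipInvolution (φ u * z) (φ v * z) f := by
  choose r hr1 hr2 using fun p : cs.midpoints (φ u * z) (φ v * z) =>
    h.exists_eq_of_mem_midpoints hz hx p.2
  let f : cs.midpoints (φ u * z) (φ v * z) → cs.midpoints (φ u * z) (φ v * z) :=
    fun p => ⟨φ (ds.swap (r p)) * z, (h.mem_midpoints_iff hz).mpr (ds.swap_mem_midpoints (hr1 p))⟩
  have hrf : ∀ p, r (f p) = ds.swap (r p) := fun p => by
    have := hr2 (f p)
    rwa [h.apply_mul_left_inj, eq_comm] at this
  refine ⟨f, fun p => ?_, fun p hp => ?_, fun p q hpq hne => ?_⟩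
  · ext
    change φ (ds.swap (r (f p))) * z = p
    rw [hrf, swap_swap, ← hr2]
  · have h1 : φ (ds.swap (r p)) * z = φ (r p) * z := by rw [← hr2 p]; exact congrArg Subtype.val hp
    rw [h.apply_mul_left_inj] at h1
    exact ds.swap_ne_of_mem_midpoints (hr1 p) h1
  · change cs.length (φ (ds.swap (r p)) * z) < cs.length (φ (ds.swap (r q)) * z)
    apply h.length_lt_of_length_lt hz
    rw [length_swap, length_swap]
    by_contra hlt
    rcases (not_lt.mp hlt).lt_or_eq with h1 | h1
    · have := h.length_lt_of_length_lt hz h1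
      rw [← hr2, ← hr2] at this
      omega
    · rcases ds.eq_or_eq_swap h1.symm with h2 | h2
      · rw [hr2 p, hr2 q, h2] at hpq
        exact lt_irrefl _ hpq
      · apply hne
        ext
        rw [hr2 q, h2]

/-- Existence makes the chosen involution satisfy the defining property; uniqueness is proved by
induction over the levels of the rank-two group. -/
theorem flipMid_eq {u v x : G} (hx : x ∈ ds.midpoints u v) :
    cs.flipMid (φ u * z) (φ v * z) (φ x * z) = φ (ds.swap x) * z := by
  have hf : cs.IsFlipInvolution (φ u * z) (φ v * z) (cs.flipInvolution (φ u * z) (φ v * z)) :=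
    Classical.epsilon_spec_aux _ _ (h.exists_isFlipInvolution hz hx)
  rw [flipMid, dif_pos ((h.mem_midpoints_iff hz).mpr hx)]
  generalize cs.flipInvolution (φ u * z) (φ v * z) = f at hf
  choose r hr1 hr2 using fun p : cs.midpoints (φ u * z) (φ v * z) =>
    h.exists_eq_of_mem_midpoints hz hx p.2
  let m : ∀ y ∈ ds.midpoints u v, cs.midpoints (φ u * z) (φ v * z) :=
    fun y hy => ⟨φ y * z, (h.mem_midpoints_iff hz).mpr hy⟩
  have hrinj : Function.Injective r := fun p q hpq => by
    ext; rw [hr2 p, hr2 q, hpq]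
  suffices key : ∀ n, ∀ p : cs.midpoints (φ u * z) (φ v * z), ds.length (r p) = n →
      r (f p) = ds.swap (r p) by
    set p : cs.midpoints (φ u * z) (φ v * z) := ⟨φ x * z, (h.mem_midpoints_iff hz).mpr hx⟩ with hp
    have h1 := hr2 p
    rw [h.apply_mul_left_inj] at h1
    rw [hr2 (f p), key _ p rfl, ← h1]
  intro n
  induction n using Nat.strong_induction_on with
  | _ n ih =>
  -- Lower levels are already matched among themselves, and on level `n` there are only `p`, which
  -- is not fixed, and its `swap`. A wrong partner therefore lies higher.
  have hbig : ∀ p : cs.midpoints (φ u * z) (φ v * z), ds.length (r p) = n →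
      r (f p) ≠ ds.swap (r p) → n < ds.length (r (f p)) := by
    intro p hp hne
    by_contra hlt
    rcases (not_lt.mp hlt).lt_or_eq with h1 | h1
    · have h2 := ih _ h1 (f p) rfl
      rw [hf.involutive] at h2
      have := congrArg ds.length h2
      rw [length_swap] at this
      omega
    · rcases ds.eq_or_eq_swap (hp.trans h1.symm) with h2 | h2
      · exact hf.fixedPointFree p (hrinj h2)
      · exact hne h2
  intro p hp
  by_contra hne
  set q := m _ (ds.swap_mem_midpoints (hr1 p)) with hq
  have hrq : r q = ds.swap (r p) := by
    have := hr2 q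
    rwa [h.apply_mul_left_inj, eq_comm] at this
  have hqn : ds.length (r q) = n := by rw [hrq, length_swap, hp]
  have hne2 : r (f q) ≠ ds.swap (r q) := by
    rw [hrq, swap_swap]
    intro h1
    have h2 := hrinj h1
    apply hne
    rw [← h2, hf.involutive, hrq, h1]
  -- Both `p` and its swap `q` would have partners on higher levels. Then `ℓ(q) < ℓ(f p)` gives `ℓ(f
  -- q) < ℓ(p)`, although `f q` lies on a higher level than `p`.
  have h1 := hbig p hp hne
  have h2 := hbig q hqn hne2
  have hpq : p ≠ q := by
    intro h3
    rw [← h3] at hrq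
    exact ds.swap_ne_of_mem_midpoints (hr1 p) hrq.symm
  have h4 : f p ≠ f q := fun h5 => hpq (by rw [← hf.involutive p, h5, hf.involutive])
  have h5 : cs.length (q : W) < cs.length (f p : W) := by
    rw [hr2 q, hr2 (f p)]
    exact h.length_lt_of_length_lt hz (by omega)
  have h6 := hf.length_lt q (f p) h5 h4
  rw [hf.involutive] at h6
  have h7 : cs.length (p : W) < cs.length (f q : W) := by
    rw [hr2 p, hr2 (f q)]
    exact h.length_lt_of_length_lt hz (by omega)
  omega

end IsDihedralEmbedding

theorem flipMid_eq_swap {u v x : G} (hx : x ∈ ds.midpoints u v) :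
    ds.flipMid u v x = ds.swap x := by
  have := ds.isDihedralEmbedding_id.flipMid_eq (z := 1) (by simp) hx
  simpa using this

end CoxeterSystem

/-! ### The dihedral group attached to a plane of roots. -/

namespace CoxeterMatrix

/-- The Coxeter matrix of rank two with off-diagonal entry `m`. -/
def dihedral (m : ℕ) (hm : m ≠ 1) : CoxeterMatrix (Fin 2) where
  M := Matrix.of fun i j => if i = j then 1 else m
  isSymm := by
    ext i j
    simp [Matrix.transpose_apply, eq_comm]
  diagonal i := by simp
  off_diagonal i j hij := by simpa [hij] using hm

end CoxeterMatrix

theorem Submodule.exists_forall_eq_smul_of_finrank_eq_two {V : Type*} [AddCommGroup V]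
    [Module ℝ V] {P : Submodule ℝ V} (hP : Module.finrank ℝ P = 2) {σ : Module.Dual ℝ V} {α : V}
    (hα : α ∈ P) (h0 : σ α ≠ 0) : ∃ e : V, e ≠ 0 ∧ ∀ x ∈ P, σ x = 0 → ∃ c : ℝ, x = c • e := by
  have : FiniteDimensional ℝ P := Module.finite_of_finrank_eq_succ hP
  let f : P →ₗ[ℝ] ℝ := σ.domRestrict P
  have hrange : LinearMap.range f = ⊤ := by
    rw [LinearMap.range_eq_top]
    intro y
    refine ⟨(y / σ α) • ⟨α, hα⟩, ?_⟩
    simp only [f, map_smul, LinearMap.domRestrict_apply, smul_eq_mul]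
    field_simp
  have hker : Module.finrank ℝ (LinearMap.ker f) = 1 := by
    have := LinearMap.finrank_range_add_finrank_ker f
    rw [hrange, finrank_top, Module.finrank_self, hP] at this
    omega
  obtain ⟨e, he0, he⟩ := finrank_eq_one_iff'.mp hker
  refine ⟨(e : P), fun h => he0 ?_, fun x hx h1 => ?_⟩
  · ext1; ext1; exact h
  · obtain ⟨c, hc⟩ := he ⟨⟨x, hx⟩, h1⟩
    exact ⟨c, (congrArg (fun y : LinearMap.ker f => ((y : P) : V)) hc).symm⟩

namespace CoxeterSystem

variable {B W : Type*} [Group W] {M : CoxeterMatrix B} {cs : CoxeterSystem M W}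

/-- The coordinate sum vanishes only on a line of `P`; any coordinate that is nonzero on this line
completes it to a coordinate system. -/
theorem exists_dual_of_finrank_eq_two {P : Submodule ℝ (B →₀ ℝ)} (hP : Module.finrank ℝ P = 2)
    {α : B →₀ ℝ} (hα : α ∈ P) (h0 : 0 < coordSum B α) :
    ∃ g : Module.Dual ℝ (B →₀ ℝ), ∀ x ∈ P, coordSum B x = 0 → g x = 0 → x = 0 := by
  obtain ⟨e, he0, he⟩ := Submodule.exists_forall_eq_smul_of_finrank_eq_two hP hα h0.ne'
  obtain ⟨i, hi⟩ := Finsupp.ne_iff.mp he0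
  refine ⟨Finsupp.lapply i, fun x hx h1 h2 => ?_⟩
  obtain ⟨c, rfl⟩ := he x hx h1
  simp only [Finsupp.lapply_apply, Finsupp.coe_smul, Pi.smul_apply, smul_eq_mul,
    mul_eq_zero] at h2
  rw [h2.resolve_right hi, zero_smul]

/-- Every element of the subgroup moves every vector by an element of `P`, and `t` moves its own
root by `-2` times that root. -/
theorem posRoot_mem_of_mem_closure {S : Set W} {P : Submodule ℝ (B →₀ ℝ)}
    (hS : ∀ t ∈ S, cs.IsReflection t ∧ cs.posRoot t ∈ P) {t : W} (ht : cs.IsReflection t)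
    (htS : t ∈ Subgroup.closure S) : cs.posRoot t ∈ P := by
  have key : ∀ x ∈ Subgroup.closure S, ∀ v, cs.geomRep x v - v ∈ P := by
    intro x hx
    induction hx using Subgroup.closure_induction with
    | mem x hx =>
      intro v
      rw [(hS x hx).1.isRootOf.geomRep_apply, sub_sub_cancel_left]
      exact P.neg_mem (P.smul_mem _ (hS x hx).2)
    | one => simp
    | mul x y _ _ hx hy =>
      intro v
      rw [map_mul, LinearEquiv.mul_apply]
      have := P.add_mem (hx (cs.geomRep y v)) (hy v)
      rwa [sub_add_sub_cancel] at this
    | inv x _ hx =>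
      intro v
      have := P.neg_mem (hx (cs.geomRep x⁻¹ v))
      rwa [geomRep_mul_inv_cancel, neg_sub] at this
  have h1 := key t htS (cs.posRoot t)
  rw [ht.isRootOf.geomRep_apply, ht.isRootOf.bilin_self, sub_sub_cancel_left] at h1
  have h2 := P.smul_mem (-(1 / 2 : ℝ)) h1
  rwa [show (-(1 / 2 : ℝ)) • (-((2 : ℝ) • cs.posRoot t)) = cs.posRoot t by module] at h2

/-- The entry of the Coxeter matrix is the order of `a * b`, with `0` meaning infinite in both
conventions. Parity of length excludes kernel elements of the form `r^k s₀` and identifies the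
reflections, since in rank two these are exactly the elements of odd length. -/
theorem exists_hom_dihedral {a b : W} (ha : cs.IsReflection a) (hb : cs.IsReflection b)
    (hab : a ≠ b) : ∃ (D : CoxeterMatrix (Fin 2)) (φ : D.Group →* W),
      φ (D.toCoxeterSystem.simple 0) = a ∧ φ (D.toCoxeterSystem.simple 1) = b ∧
      Function.Injective φ ∧ φ.range = Subgroup.closure {a, b} ∧
      ∀ t, cs.IsReflection (φ t) ↔ D.toCoxeterSystem.IsReflection t := by
  have hm : orderOf (a * b) ≠ 1 := by
    rw [Ne, orderOf_eq_one_iff, mul_eq_one_iff_eq_inv, hb.inv]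
    exact hab
  set D := CoxeterMatrix.dihedral _ hm with hD
  have hlift : D.IsLiftable ![a, b] := by
    intro i j
    have e1 : ∀ x : W, x * x = 1 → (x * x) ^ 1 = 1 := fun x hx => by rw [hx, one_pow]
    fin_cases i <;> fin_cases j
    · exact e1 a ha.mul_self
    · exact pow_orderOf_eq_one (a * b)
    · change (b * a) ^ orderOf (a * b) = 1
      have : b * a = (a * b)⁻¹ := by rw [mul_inv_rev, ha.inv, hb.inv]
      rw [this, inv_pow, pow_orderOf_eq_one, inv_one]
    · exact e1 b hb.mul_self
  set ds := D.toCoxeterSystem with hds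
  let φ : D.Group →* W := ds.lift ⟨![a, b], hlift⟩
  have h0 : φ (ds.simple 0) = a := ds.lift_apply_simple hlift 0
  have h1 : φ (ds.simple 1) = b := ds.lift_apply_simple hlift 1
  have hpar : ∀ x, cs.lengthParity (φ x) = ds.lengthParity x := by
    have : cs.lengthParity.comp φ = ds.lengthParity := by
      apply ds.ext_simple
      intro i
      rw [MonoidHom.comp_apply, lengthParity_simple, lengthParity_eq_ofAdd_length]
      have hodd : ∀ t, cs.IsReflection t → ((cs.length t : ℕ) : ZMod 2) = 1 :=
        fun t ht => (ZMod.natCast_eq_one_iff_odd).mpr ht.odd_length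
      fin_cases i
      · simp only [Fin.zero_eta, h0, hodd a ha]
      · simp only [Fin.mk_one, h1, hodd b hb]
    exact DFunLike.congr_fun this
  have hodd : ∀ x, Odd (cs.length (φ x)) ↔ Odd (ds.length x) := by
    intro x
    have := hpar x
    rw [lengthParity_eq_ofAdd_length, lengthParity_eq_ofAdd_length,
      Multiplicative.ofAdd.apply_eq_iff_eq] at this
    rw [← ZMod.natCast_eq_one_iff_odd, this, ZMod.natCast_eq_one_iff_odd]
  have hrefl : ∀ t, cs.IsReflection (φ t) ↔ ds.IsReflection t := by
    intro t
    constructor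
    · intro ht
      exact ds.isReflection_of_odd ((hodd t).mp ht.odd_length)
    · rintro ⟨w, i, rfl⟩
      rw [map_mul, map_mul, map_inv, isReflection_conj_iff]
      fin_cases i
      · simpa [h0] using ha
      · simpa [h1] using hb
  refine ⟨D, φ, h0, h1, ?_, ?_, hrefl⟩
  · rw [injective_iff_map_eq_one]
    intro x hx
    obtain ⟨k, rfl | rfl⟩ := ds.eq_zpow_or x
    · rw [map_zpow, map_mul, h0, h1, ← orderOf_dvd_iff_zpow_eq_one] at hx
      obtain ⟨l, rfl⟩ := hx
      have : (ds.simple 0 * ds.simple 1) ^ orderOf (a * b) = 1 := ds.simple_mul_simple_pow 0 1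
      rw [zpow_mul, zpow_natCast, this, one_zpow]
    · exfalso
      have h2 := hpar ((ds.simple 0 * ds.simple 1) ^ k * ds.simple 0)
      rw [hx, map_one, map_mul, map_zpow, map_mul, lengthParity_simple, lengthParity_simple] at h2
      have : (Multiplicative.ofAdd (1 : ZMod 2) * Multiplicative.ofAdd (1 : ZMod 2)) = 1 := rfl
      rw [this, one_zpow, one_mul] at h2
      exact absurd h2 (by decide)
  · rw [MonoidHom.range_eq_map, ← ds.subgroup_closure_range_simple, MonoidHom.map_closure]
    congr 1
    rw [← Set.range_comp]
    ext x
    simp only [Set.mem_range, Function.comp_apply, Fin.exists_fin_two, h0, h1,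
      Set.mem_insert_iff, Set.mem_singleton_iff]
    rw [eq_comm, eq_comm (a := b)]

theorem closure_eq_closure_reflectionsIn {S : Set W} (hS : ∀ t ∈ S, cs.IsReflection t) :
    Subgroup.closure S = Subgroup.closure (cs.reflectionsIn (Subgroup.closure S)) := by
  apply le_antisymm
  · exact Subgroup.closure_mono fun t ht => ⟨hS t ht, Subgroup.subset_closure ht⟩
  · rw [Subgroup.closure_le]
    exact fun t ht => ht.2

theorem IsPlanar.exists_hom_dihedral {H : Subgroup W} {P : Submodule ℝ (B →₀ ℝ)}
    {g : Module.Dual ℝ (B →₀ ℝ)} (h : cs.IsPlanar H P g)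
    (hH : H = Subgroup.closure (cs.reflectionsIn H)) {c d : W} (hc : c ∈ cs.reflectionsIn H)
    (hd : d ∈ cs.reflectionsIn H) (hcd : c ≠ d) :
    ∃ (D : CoxeterMatrix (Fin 2)) (φ : D.Group →* W), Function.Injective φ ∧ φ.range = H ∧
      (∀ t, cs.IsReflection (φ t) ↔ D.toCoxeterSystem.IsReflection t) ∧
      (∀ i t, D.toCoxeterSystem.IsReflection t →
        (cs.length (φ t * φ (D.toCoxeterSystem.simple i)) <
          cs.length (φ (D.toCoxeterSystem.simple i)) ↔ t = D.toCoxeterSystem.simple i)) ∧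
      cs.canonicalGenerators H = Set.range fun i => φ (D.toCoxeterSystem.simple i) := by
  obtain ⟨a, ha, b, hb, hab, hmin, hmax⟩ := h.exists_min_max hc hd hcd
  obtain ⟨D, φ, h0, h1, hinj, hrange, hrefl⟩ := CoxeterSystem.exists_hom_dihedral ha.1 hb.1 hab
  have hHab : φ.range = H := by
    rw [hrange]
    apply le_antisymm
    · rw [Subgroup.closure_le]
      rintro x (rfl | rfl)
      exacts [ha.2, hb.2]
    · rw [hH, Subgroup.closure_le]
      exact h.reflectionsIn_subset_closure ha hb hmin hmax
  refine ⟨D, φ, hinj, hHab, hrefl, ?_, ?_⟩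
  · intro i t ht
    have hφt : φ t ∈ cs.reflectionsIn H := ⟨(hrefl t).mpr ht, hHab ▸ ⟨t, rfl⟩⟩
    fin_cases i
    · simp only [Fin.zero_eta]
      rw [h0, h.length_mul_lt_iff_of_min ha hmin hφt, ← h0, hinj.eq_iff]
    · simp only [Fin.mk_one]
      rw [h1, h.neg.length_mul_lt_iff_of_min hb (slope_neg_le hmax) hφt, ← h1, hinj.eq_iff]
  · rw [h.canonicalGenerators_eq ha hb hmin hmax]
    ext x
    simp only [Set.mem_range, Fin.exists_fin_two, h0, h1, Set.mem_insert_iff,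
      Set.mem_singleton_iff]
    rw [eq_comm, eq_comm (a := b)]

/-- All reflections with root in `P` are taken, not only `c` and `d`. This maximality and
`posRoot_mem_span` give the closedness required of an embedding. -/
theorem exists_isDihedralEmbedding {P : Submodule ℝ (B →₀ ℝ)} (hP : Module.finrank ℝ P = 2)
    {c d : W} (hc : cs.IsReflection c) (hd : cs.IsReflection d) (hcd : c ≠ d)
    (hcP : cs.posRoot c ∈ P) (hdP : cs.posRoot d ∈ P) :
    ∃ (D : CoxeterMatrix (Fin 2)) (φ : D.Group →* W),
      IsDihedralEmbedding D.toCoxeterSystem cs φ ∧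
      ∀ t, cs.IsReflection t → cs.posRoot t ∈ P → t ∈ φ.range := by
  set S : Set W := {t | cs.IsReflection t ∧ cs.posRoot t ∈ P} with hS
  obtain ⟨g, hg⟩ := exists_dual_of_finrank_eq_two hP hcP hc.coordSum_posRoot_pos
  have hpl : cs.IsPlanar (Subgroup.closure S) P g :=
    ⟨fun t ht => posRoot_mem_of_mem_closure (fun t ht => ht) ht.1 ht.2, hg⟩
  obtain ⟨D, φ, hinj, hrange, hrefl, hinv, -⟩ := hpl.exists_hom_dihedral
    (closure_eq_closure_reflectionsIn fun t ht => ht.1)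
    (c := c) (d := d) ⟨hc, Subgroup.subset_closure ⟨hc, hcP⟩⟩
    ⟨hd, Subgroup.subset_closure ⟨hd, hdP⟩⟩ hcd
  refine ⟨D, φ, ⟨hinj, hrefl, hinv, ?_⟩, ?_⟩
  · intro t₁ t₂ r₁ r₂ h1 h2 h3 h4 hne he
    have hm : ∀ t, cs.IsReflection (φ t) → cs.posRoot (φ t) ∈ P :=
      fun t ht => hpl.mem _ ⟨ht, hrange ▸ ⟨t, rfl⟩⟩
    rw [hrange]
    exact Subgroup.subset_closure
      ⟨h3, (h1.posRoot_mem_span h2 h3 h4 hne he (hm t₁ h1) (hm t₂ h2)).1⟩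
  · intro t ht htP
    rw [hrange]
    exact Subgroup.subset_closure ⟨ht, htP⟩

theorem isDihedralSubgroup_closure {P : Submodule ℝ (B →₀ ℝ)} (hP : Module.finrank ℝ P = 2)
    {S : Set W} (hS : ∀ t ∈ S, cs.IsReflection t ∧ cs.posRoot t ∈ P) {c d : W} (hc : c ∈ S)
    (hd : d ∈ S) (hcd : c ≠ d) : cs.IsDihedralSubgroup (Subgroup.closure S) := by
  obtain ⟨g, hg⟩ := exists_dual_of_finrank_eq_two hP (hS c hc).2 (hS c hc).1.coordSum_posRoot_pos
  have hpl : cs.IsPlanar (Subgroup.closure S) P g :=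
    ⟨fun t ht => posRoot_mem_of_mem_closure hS ht.1 ht.2, hg⟩
  have hcl := closure_eq_closure_reflectionsIn fun t ht => (hS t ht).1
  obtain ⟨D, φ, hinj, hrange, -, -, hcan⟩ := hpl.exists_hom_dihedral hcl
    (c := c) (d := d) ⟨(hS c hc).1, Subgroup.subset_closure hc⟩
    ⟨(hS d hd).1, Subgroup.subset_closure hd⟩ hcd
  refine ⟨hcl, D, ⟨(MulEquiv.subgroupCongr hrange).symm.trans (MonoidHom.ofInjective hinj).symm⟩,
    ?_⟩
  rw [hcan]
  rfl

theorem IsDihedralSubgroup.exists_closure_eq {H : Subgroup W} (h : cs.IsDihedralSubgroup H) :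
    ∃ a b, cs.IsReflection a ∧ cs.IsReflection b ∧ H = Subgroup.closure {a, b} ∧
      cs.canonicalGenerators H = {a, b} := by
  obtain ⟨-, D, ds, hds⟩ := h
  have hrange : (Set.range fun i => (ds.simple i : W)) = {(ds.simple 0 : W), (ds.simple 1 : W)} := by
    ext x
    simp only [Set.mem_range, Fin.exists_fin_two, Set.mem_insert_iff, Set.mem_singleton_iff]
    rw [eq_comm, eq_comm (b := x)]
  have hmem : ∀ i, (ds.simple i : W) ∈ cs.canonicalGenerators H := fun i => hds ▸ ⟨i, rfl⟩
  refine ⟨ds.simple 0, ds.simple 1, (hmem 0).1, (hmem 1).1, ?_, by rw [← hds, hrange]⟩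
  rw [← hrange, show (Set.range fun i => (ds.simple i : W)) = H.subtype '' Set.range ds.simple by
    rw [← Set.range_comp]; rfl, ← MonoidHom.map_closure, ds.subgroup_closure_range_simple,
    ← MonoidHom.range_eq_map, Subgroup.range_subtype]

theorem IsDihedralSubgroup.exists_plane {H : Subgroup W} (h : cs.IsDihedralSubgroup H) :
    ∃ P : Submodule ℝ (B →₀ ℝ), Module.Finite ℝ P ∧ Module.finrank ℝ P ≤ 2 ∧
      ∀ t ∈ H, cs.IsReflection t → cs.posRoot t ∈ P := by
  classical
  obtain ⟨a, b, ha, hb, hH, -⟩ := h.exists_closure_eq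
  refine ⟨Submodule.span ℝ {cs.posRoot a, cs.posRoot b},
    FiniteDimensional.span_of_finite ℝ (Set.toFinite _), ?_, fun t htH ht => ?_⟩
  · have h1 := finrank_span_finset_le_card (R := ℝ)
      ({cs.posRoot a, cs.posRoot b} : Finset (B →₀ ℝ))
    rw [Finset.coe_pair] at h1
    exact h1.trans Finset.card_le_two
  · rw [hH] at htH
    refine posRoot_mem_of_mem_closure ?_ ht htH
    rintro x (rfl | rfl)
    exacts [⟨ha, Submodule.subset_span (by simp)⟩, ⟨hb, Submodule.subset_span (by simp)⟩]

theorem finrank_span_eq_two {S : Set (B →₀ ℝ)} {P : Submodule ℝ (B →₀ ℝ)} (hfin : Module.Finite ℝ P)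
    (hP : Module.finrank ℝ P ≤ 2) (hS : S ⊆ P) {c d : W} (hc : cs.IsReflection c)
    (hd : cs.IsReflection d) (hcd : c ≠ d) (hcS : cs.posRoot c ∈ S) (hdS : cs.posRoot d ∈ S) :
    Module.finrank ℝ (Submodule.span ℝ S) = 2 := by
  have hle : Submodule.span ℝ S ≤ P := Submodule.span_le.mpr hS
  have hfin' : Module.Finite ℝ (Submodule.span ℝ S) := Submodule.finiteDimensional_of_le hle
  apply le_antisymm ((Submodule.finrank_mono hle).trans hP)
  have h1 := finrank_span_eq_card (posRoot_linearIndependent hc hd hcd)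
  rw [Fintype.card_fin] at h1
  refine h1.ge.trans (Submodule.finrank_mono ?_)
  rw [Submodule.span_le]
  rintro _ ⟨i, rfl⟩
  fin_cases i
  exacts [Submodule.subset_span hcS, Submodule.subset_span hdS]

end CoxeterSystem

/-! ### Alternating words ordered by slope. -/

namespace CoxeterSystem

variable {B W : Type*} [Group W] {M : CoxeterMatrix B} {cs : CoxeterSystem M W}

section oddWord

variable {a b : W}

theorem mul_pow_eq_zpow_neg (ha : cs.IsReflection a) (hb : cs.IsReflection b) (n : ℕ) : (b * a) ^ n = (a * b) ^ (-(n : ℤ)) := by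
  have : b * a = (a * b)⁻¹ := by rw [mul_inv_rev, ha.inv, hb.inv]
  rw [this, zpow_neg, zpow_natCast, inv_pow]

theorem mul_oddWord_mul (n : ℕ) : a * oddWord b a n * a = oddWord a b (n + 1) := by
  have : a * (b * a) ^ n = (a * b) ^ n * a := by
    induction n with
    | zero => simp
    | succ n ih => rw [pow_succ, ← mul_assoc, ih, pow_succ]; simp only [mul_assoc]
  rw [oddWord, oddWord, ← mul_assoc, this, pow_succ]
  simp only [mul_assoc]

theorem mul_oddWord_succ_mul (ha : cs.IsReflection a) (n : ℕ) : a * oddWord a b (n + 1) * a = oddWord b a n := by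
  rw [← mul_oddWord_mul, ha.mul_mul_mul_mul_cancel]

theorem oddWord_mem (ha : cs.IsReflection a) (hb : cs.IsReflection b) {H : Subgroup W} (haH : a ∈ H) (hbH : b ∈ H) (n : ℕ) :
    oddWord a b n ∈ cs.reflectionsIn H := by
  induction n generalizing a b with
  | zero => simpa [oddWord] using ⟨ha, haH⟩
  | succ n ih =>
    rw [← mul_oddWord_mul]
    exact conj_mem_reflectionsIn ⟨ha, haH⟩ (ih hb ha hbH haH)

theorem oddWord_ne (hb : cs.IsReflection b) {n : ℕ} (hn : orderOf (a * b) = 0 ∨ n + 1 < orderOf (a * b)) :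
    oddWord a b n ≠ b := by
  intro h
  have h1 : (a * b) ^ (n + 1) = 1 := by
    rw [pow_succ, ← mul_assoc, ← oddWord, h, hb.mul_self]
  have h2 := orderOf_dvd_of_pow_eq_one h1
  rcases hn with h0 | h0
  · rw [h0] at h2
    simp at h2
  · exact absurd (Nat.le_of_dvd (by omega) h2) (by omega)

theorem oddWord_ne_left {n : ℕ} (hn0 : n ≠ 0)
    (hn : orderOf (a * b) = 0 ∨ n < orderOf (a * b)) : oddWord a b n ≠ a := by
  intro h
  have h1 : (a * b) ^ n = 1 := by
    rw [oddWord] at h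
    exact mul_eq_right.mp h
  have h2 := orderOf_dvd_of_pow_eq_one h1
  rcases hn with h0 | h0
  · rw [h0] at h2
    simp [hn0] at h2
  · exact absurd (Nat.le_of_dvd (by omega) h2) (by omega)

theorem orderOf_mul_comm (ha : cs.IsReflection a) (hb : cs.IsReflection b) : orderOf (b * a) = orderOf (a * b) := by
  have : b * a = (a * b)⁻¹ := by rw [mul_inv_rev, ha.inv, hb.inv]
  rw [this, orderOf_inv]

/-- For finite order the words starting with `b` are the words starting with `a`, counted from the
other end. -/
theorem oddWord_eq_oddWord (ha : cs.IsReflection a) (hb : cs.IsReflection b) {m n : ℕ}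
    (h : m + n + 1 = orderOf (a * b)) :
    oddWord b a n = oddWord a b m := by
  have h1 : (a * b) ^ (m + n + 1) = 1 := by rw [h, pow_orderOf_eq_one]
  have h2 : b = (a * b) ^ (-1 : ℤ) * a := by
    rw [zpow_neg, zpow_one, mul_inv_rev, ha.inv, hb.inv, mul_assoc, ha.mul_self, mul_one]
  rw [oddWord, oddWord, mul_pow_eq_zpow_neg ha hb]
  nth_rewrite 2 [h2]
  rw [← mul_assoc, ← zpow_add]
  congr 1
  have h3 : (a * b) ^ (-(n : ℤ) + -1) * (a * b) ^ (m + n + 1) = (a * b) ^ m := by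
    rw [← zpow_natCast, ← zpow_natCast, ← zpow_add]
    congr 1
    push_cast
    ring
  rw [← h3, h1, mul_one]

end oddWord

namespace IsPlanar

variable {H : Subgroup W} {P : Submodule ℝ (B →₀ ℝ)} {g : Module.Dual ℝ (B →₀ ℝ)}
  (h : cs.IsPlanar H P g) {a b : W} (ha : a ∈ cs.reflectionsIn H) (hb : b ∈ cs.reflectionsIn H)
  (hmin : ∀ t ∈ cs.reflectionsIn H, cs.slope g a ≤ cs.slope g t)
  (hmax : ∀ t ∈ cs.reflectionsIn H, cs.slope g t ≤ cs.slope g b)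

include h

theorem slope_lt_of_ne_max {t : W} (hb : b ∈ cs.reflectionsIn H)
    (hmax : ∀ t ∈ cs.reflectionsIn H, cs.slope g t ≤ cs.slope g b) (ht : t ∈ cs.reflectionsIn H)
    (htb : t ≠ b) : cs.slope g t < cs.slope g b :=
  lt_of_le_of_ne (hmax t ht) fun he => htb (h.slope_injOn ht hb he)

theorem slope_conj_lt_of_max {s t : W} (hb : b ∈ cs.reflectionsIn H)
    (hmax : ∀ t ∈ cs.reflectionsIn H, cs.slope g t ≤ cs.slope g b)
    (hs : s ∈ cs.reflectionsIn H) (hsb : s ≠ b)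
    (ht : t ∈ cs.reflectionsIn H) (htb : t ≠ b) (hst : cs.slope g s < cs.slope g t) :
    cs.slope g (b * t * b) < cs.slope g (b * s * b) := by
  have := h.neg.slope_conj_lt hb (slope_neg_le hmax) ht htb hs hsb (by simpa [slope_neg] using hst)
  simpa [slope_neg] using this

include ha hb hmin hmax

/-- Conjugation by an extreme generator lengthens words starting with the other generator and
reverses slopes, so the two inequalities prove each other's next case. -/
theorem slope_oddWord_lt (k : ℕ) (hk : orderOf (a * b) = 0 ∨ k + 1 < orderOf (a * b)) :
    cs.slope g (oddWord a b k) < cs.slope g (oddWord a b (k + 1)) ∧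
    cs.slope g (oddWord b a (k + 1)) < cs.slope g (oddWord b a k) := by
  have hord := orderOf_mul_comm ha.1 hb.1
  have hA := oddWord_mem ha.1 hb.1 ha.2 hb.2
  have hB := oddWord_mem hb.1 ha.1 hb.2 ha.2
  induction k with
  | zero =>
    constructor
    · have := h.slope_lt_of_ne ha hmin (hA 1) (oddWord_ne_left one_ne_zero (by omega))
      simpa [oddWord] using this
    · have := h.slope_lt_of_ne_max hb hmax (hB 1) (oddWord_ne_left one_ne_zero (by omega))
      simpa [oddWord] using this
  | succ k ih =>
    obtain ⟨h1, h2⟩ := ih (by omega)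
    constructor
    · have := h.slope_conj_lt ha hmin (hB (k + 1)) (oddWord_ne ha.1 (by omega)) (hB k)
        (oddWord_ne ha.1 (by omega)) h2
      rwa [mul_oddWord_mul, mul_oddWord_mul] at this
    · have := h.slope_conj_lt_of_max hb hmax (hA k) (oddWord_ne hb.1 (by omega)) (hA (k + 1))
        (oddWord_ne hb.1 (by omega)) h1
      rwa [mul_oddWord_mul, mul_oddWord_mul] at this

theorem slope_oddWord_mono {m n : ℕ} (hmn : m ≤ n)
    (hn : orderOf (a * b) = 0 ∨ n < orderOf (a * b)) :
    cs.slope g (oddWord a b m) ≤ cs.slope g (oddWord a b n) ∧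
    cs.slope g (oddWord b a n) ≤ cs.slope g (oddWord b a m) := by
  induction n, hmn using Nat.le_induction with
  | base => exact ⟨le_rfl, le_rfl⟩
  | succ n _ ih =>
    obtain ⟨h1, h2⟩ := ih (by omega)
    obtain ⟨h3, h4⟩ := h.slope_oddWord_lt ha hb hmin hmax n hn
    exact ⟨h1.trans h3.le, h4.le.trans h2⟩

theorem slope_oddWord_lt_oddWord (hord : orderOf (a * b) = 0) (m n : ℕ) :
    cs.slope g (oddWord a b m) < cs.slope g (oddWord b a n) := by
  have hord' := orderOf_mul_comm ha.1 hb.1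
  rw [hord] at hord'
  have hA := oddWord_mem ha.1 hb.1 ha.2 hb.2
  have hB := oddWord_mem hb.1 ha.1 hb.2 ha.2
  have hA1 : ∀ n, oddWord a b n ≠ b := fun n => oddWord_ne hb.1 (Or.inl hord)
  have hA2 : ∀ n, oddWord a b (n + 1) ≠ a :=
    fun n => oddWord_ne_left n.succ_ne_zero (Or.inl hord)
  have hB1 : ∀ n, oddWord b a n ≠ a := fun n => oddWord_ne ha.1 (Or.inl hord')
  have hB2 : ∀ n, oddWord b a (n + 1) ≠ b :=
    fun n => oddWord_ne_left n.succ_ne_zero (Or.inl hord')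
  have hA0 : oddWord a b 0 = a := by simp [oddWord]
  have hB0 : oddWord b a 0 = b := by simp [oddWord]
  induction m using Nat.strong_induction_on generalizing n with
  | _ m ih =>
  match m, ih with
  | 0, _ =>
    rw [hA0]
    exact h.slope_lt_of_ne ha hmin (hB n) (hB1 n)
  | 1, _ =>
    have h1 : cs.slope g (oddWord a b (n + 1)) < cs.slope g (oddWord b a 0) := by
      rw [hB0]
      exact h.slope_lt_of_ne_max hb hmax (hA (n + 1)) (hA1 _)
    have := h.slope_conj_lt ha hmin (hA (n + 1)) (hA2 n) (hB 0) (hB1 0) h1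
    rwa [mul_oddWord_mul, mul_oddWord_succ_mul ha.1] at this
  -- Conjugating by `b` and then by `a` preserves the order and turns the comparison of indices `m`,
  -- `n + 2` into that of `m + 2`, `n`.
  | m + 2, ih =>
    have h1 := ih m (by omega) (n + 2)
    have h2 := h.slope_conj_lt_of_max hb hmax (hA m) (hA1 m) (hB (n + 2)) (hB2 (n + 1)) h1
    rw [mul_oddWord_mul, mul_oddWord_succ_mul hb.1] at h2
    have h3 := h.slope_conj_lt ha hmin (hA (n + 1)) (hA2 n) (hB (m + 1)) (hB1 _) h2
    rwa [mul_oddWord_mul, mul_oddWord_succ_mul ha.1] at h3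

theorem isDihedralChain {le : W → W → Prop} (hle : ∀ s ∈ cs.reflectionsIn H,
    ∀ t ∈ cs.reflectionsIn H, cs.slope g s ≤ cs.slope g t → le s t) : IsDihedralChain le a b := by
  have hA := oddWord_mem ha.1 hb.1 ha.2 hb.2
  have hB := oddWord_mem hb.1 ha.1 hb.2 ha.2
  intro m n hm hn
  simp only [OddWordReduced] at hm hn
  refine ⟨fun hmn => ?_, fun hmn => ?_, ?_⟩
  · exact hle _ (hA m) _ (hA n) (h.slope_oddWord_mono ha hb hmin hmax hmn (by omega)).1
  · exact hle _ (hB n) _ (hB m) (h.slope_oddWord_mono ha hb hmin hmax hmn (by omega)).2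
  · apply hle _ (hA m) _ (hB n)
    by_cases hord : orderOf (a * b) = 0
    · exact (h.slope_oddWord_lt_oddWord ha hb hmin hmax hord m n).le
    -- Reducedness gives `2m + 1` and `2n + 1` at most the order, hence `m ≤ orderOf (a * b) - 1 -
    -- n`, and monotonicity along words starting with `a` suffices.
    · rw [oddWord_eq_oddWord ha.1 hb.1 (m := orderOf (a * b) - 1 - n) (by omega)]
      exact (h.slope_oddWord_mono ha hb hmin hmax (by omega) (by omega)).1

end IsPlanar

end CoxeterSystem

/-! ### Existence and restriction of reflection orderings. -/

namespace CoxeterSystem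

variable {B W : Type*} [Group W] {M : CoxeterMatrix B} {cs : CoxeterSystem M W}

/-- The positive root of a reflection, scaled to have coordinate sum `1`. -/
noncomputable def normRoot (cs : CoxeterSystem M W) (t : W) : B →₀ ℝ :=
  (coordSum B (cs.posRoot t))⁻¹ • cs.posRoot t

theorem normRoot_injOn {s t : W} (hs : cs.IsReflection s) (ht : cs.IsReflection t)
    (h : cs.normRoot s = cs.normRoot t) : s = t := by
  refine ht.isRootOf.eq_of_smul
    (c := coordSum B (cs.posRoot s) * (coordSum B (cs.posRoot t))⁻¹) (r := s) ?_
  rw [mul_smul, ← normRoot, ← h, normRoot, smul_smul,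
    mul_inv_cancel₀ hs.coordSum_posRoot_pos.ne', one_smul]
  exact hs.isRootOf

/-- Normalized roots of a plane lie on an affine line, on which the slope is an affine coordinate.
-/
theorem IsPlanar.normRoot_sub {H : Subgroup W} {P : Submodule ℝ (B →₀ ℝ)}
    {g : Module.Dual ℝ (B →₀ ℝ)} (h : cs.IsPlanar H P g) {a b s t : W}
    (ha : a ∈ cs.reflectionsIn H) (hb : b ∈ cs.reflectionsIn H) (hs : s ∈ cs.reflectionsIn H)
    (ht : t ∈ cs.reflectionsIn H) (hab : cs.slope g a < cs.slope g b) :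
    cs.normRoot t - cs.normRoot s =
      ((cs.slope g t - cs.slope g s) / (cs.slope g b - cs.slope g a)) •
        (cs.normRoot b - cs.normRoot a) := by
  have hg : ∀ x, g (cs.normRoot x) = cs.slope g x := fun x => by
    rw [normRoot, slope, map_smul, smul_eq_mul, div_eq_inv_mul]
  have hσ : ∀ x ∈ cs.reflectionsIn H, coordSum B (cs.normRoot x) = 1 := fun x hx => by
    rw [normRoot, map_smul, smul_eq_mul, inv_mul_cancel₀ hx.1.coordSum_posRoot_pos.ne']
  have hmem : ∀ x ∈ cs.reflectionsIn H, cs.normRoot x ∈ P :=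
    fun x hx => P.smul_mem _ (h.mem x hx)
  rw [← sub_eq_zero]
  apply h.eq_zero
  · exact P.sub_mem (P.sub_mem (hmem t ht) (hmem s hs))
      (P.smul_mem _ (P.sub_mem (hmem b hb) (hmem a ha)))
  · simp [hσ a ha, hσ b hb, hσ s hs, hσ t ht]
  · simp only [map_sub, map_smul, hg, smul_eq_mul]
    rw [div_mul_cancel₀ _ (sub_ne_zero.mpr hab.ne'), sub_self]

theorem toLex_smul_pos [LinearOrder B] {x : B →₀ ℝ} (hx : 0 < toLex x) {c : ℝ} (hc : 0 < c) :
    0 < toLex (c • x) := by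
  rw [Finsupp.Lex.lt_iff] at hx ⊢
  obtain ⟨i, h1, h2⟩ := hx
  refine ⟨i, fun j hj => ?_, ?_⟩
  · have : 0 = x j := h1 j hj
    change 0 = c * x j
    rw [← this, mul_zero]
  · have : 0 < x i := h2
    change 0 < c * x i
    positivity

/-- A translation-invariant total order compatible with positive scaling is monotone along every
line. On a dihedral subgroup it therefore agrees with the order of slopes or with its reverse. -/
theorem isReflectionOrdering_toLex [LinearOrder B] (cs : CoxeterSystem M W) :
    cs.IsReflectionOrdering fun s t => toLex (cs.normRoot s) ≤ toLex (cs.normRoot t) := by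
  refine ⟨?_, ?_⟩
  · exact
    { refl := fun s => le_refl _
      trans := fun s t r => le_trans
      antisymm := fun s t h1 h2 =>
        Subtype.ext (normRoot_injOn s.2 t.2 (toLex.injective (le_antisymm h1 h2)))
      total := fun s t => le_total _ _ }
  · intro H x y hH hxy hcan
    have hx : x ∈ cs.canonicalGenerators H := by rw [hcan]; exact Or.inl rfl
    have hy : y ∈ cs.canonicalGenerators H := by rw [hcan]; exact Or.inr rfl
    obtain ⟨x', y', hx', hy', hHxy, hcan'⟩ := hH.exists_closure_eq
    have hHxy : H = Subgroup.closure {x, y} := by rw [hHxy, ← hcan', hcan]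
    have hrefl : ∀ t ∈ ({x, y} : Set W), cs.IsReflection t := by
      rintro t (rfl | rfl)
      exacts [hx.1, hy.1]
    have hxH : x ∈ cs.reflectionsIn H := ⟨hx.1, hHxy ▸ Subgroup.subset_closure (by simp)⟩
    have hyH : y ∈ cs.reflectionsIn H := ⟨hy.1, hHxy ▸ Subgroup.subset_closure (by simp)⟩
    set P := Submodule.span ℝ (Set.range ![cs.posRoot x, cs.posRoot y]) with hP
    have hfin : Module.finrank ℝ P = 2 := by
      rw [hP, finrank_span_eq_card (posRoot_linearIndependent hx.1 hy.1 hxy), Fintype.card_fin]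
    have hxP : cs.posRoot x ∈ P := Submodule.subset_span ⟨0, rfl⟩
    have hyP : cs.posRoot y ∈ P := Submodule.subset_span ⟨1, rfl⟩
    obtain ⟨g, hg⟩ := exists_dual_of_finrank_eq_two hfin hxP hx.1.coordSum_posRoot_pos
    have hpl : cs.IsPlanar H P g := by
      refine ⟨fun t ht => posRoot_mem_of_mem_closure (S := {x, y}) ?_ ht.1 (hHxy ▸ ht.2), hg⟩
      rintro t (rfl | rfl)
      exacts [⟨hx.1, hxP⟩, ⟨hy.1, hyP⟩]
    obtain ⟨a, ha, b, hb, hab, hmin, hmax⟩ := hpl.exists_min_max hxH hyH hxy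
    have hsl := hpl.slope_lt_of_ne ha hmin hb hab.symm
    have hchain : IsDihedralChain (fun s t => toLex (cs.normRoot s) ≤ toLex (cs.normRoot t)) a b ∨
        IsDihedralChain (fun s t => toLex (cs.normRoot s) ≤ toLex (cs.normRoot t)) b a := by
      have key : ∀ s t : W, toLex (cs.normRoot s) ≤ toLex (cs.normRoot t) ↔
          0 ≤ toLex (cs.normRoot t - cs.normRoot s) := fun s t => by
        rw [toLex_sub, sub_nonneg]
      rcases lt_trichotomy (toLex (cs.normRoot a)) (toLex (cs.normRoot b)) with h1 | h1 | h1
      · left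
        apply hpl.isDihedralChain ha hb hmin hmax
        intro s hs t ht hst
        rcases hst.lt_or_eq with hst | hst
        · rw [key, hpl.normRoot_sub ha hb hs ht hsl]
          rw [← sub_pos, ← toLex_sub] at h1
          exact (toLex_smul_pos h1 (div_pos (by linarith) (by linarith))).le
        · rw [hpl.slope_injOn hs ht hst]
      · exact absurd (normRoot_injOn ha.1 hb.1 (toLex.injective h1)) hab
      · right
        apply hpl.neg.isDihedralChain hb ha (slope_neg_le hmax)
          (fun t ht => by simpa [slope_neg] using hmin t ht)
        intro s hs t ht hst
        rw [slope_neg, slope_neg, neg_le_neg_iff] at hst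
        rcases hst.lt_or_eq with hst | hst
        · rw [key, hpl.neg.normRoot_sub hb ha hs ht (by simpa [slope_neg] using hsl)]
          rw [← sub_pos, ← toLex_sub] at h1
          refine (toLex_smul_pos h1 (div_pos ?_ ?_)).le <;> simp only [slope_neg] <;> linarith
        · rw [hpl.slope_injOn ht hs hst]
    rw [hpl.canonicalGenerators_eq ha hb hmin hmax] at hcan
    have hxmem : x ∈ ({a, b} : Set W) := hcan ▸ Or.inl rfl
    have hymem : y ∈ ({a, b} : Set W) := hcan ▸ Or.inr rfl
    rcases hxmem with rfl | rfl <;> rcases hymem with rfl | rfl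
    · exact absurd rfl hxy
    · exact hchain
    · exact hchain.symm
    · exact absurd rfl hxy

theorem exists_isReflectionOrdering (cs : CoxeterSystem M W) :
    ∃ le : W → W → Prop, cs.IsReflectionOrdering le := by
  classical
  let : LinearOrder B := linearOrderOfSTO WellOrderingRel
  exact ⟨_, cs.isReflectionOrdering_toLex⟩

variable {D : CoxeterMatrix (Fin 2)} {G : Type*} [Group G] {ds : CoxeterSystem D G}

namespace IsDihedralEmbedding

variable {φ : G →* W} (h : IsDihedralEmbedding ds cs φ)

include h

theorem canonicalGenerators_map (H : Subgroup G) :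
    cs.canonicalGenerators (H.map φ) = φ '' ds.canonicalGenerators H := by
  have hlt : ∀ r t : G, ds.IsReflection r →
      (cs.length (φ r * φ t) < cs.length (φ t) ↔ ds.length (r * t) < ds.length t) := by
    intro r t hr
    have := h.length_lt_iff (z := 1) (by simp) hr t
    simpa using this
  ext t
  constructor
  · rintro ⟨ht, hN⟩
    have htm : t ∈ {r | cs.IsReflection r ∧ r ∈ H.map φ ∧ cs.length (r * t) < cs.length t} :=
      hN ▸ rfl
    obtain ⟨-, ⟨t, htH, rfl⟩, -⟩ := htm
    refine ⟨t, ⟨(h.isReflection_iff t).mp ht, ?_⟩, rfl⟩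
    ext r
    have := Set.ext_iff.mp hN (φ r)
    simp only [Set.mem_ofPred_eq, Set.mem_singleton_iff, h.isReflection_iff, h.injective.eq_iff,
      Subgroup.mem_map_iff_mem h.injective] at this ⊢
    rw [← this]
    exact and_congr_right fun hr => and_congr_right fun _ => (hlt r t hr).symm
  · rintro ⟨t, ⟨ht, hN⟩, rfl⟩
    refine ⟨(h.isReflection_iff t).mpr ht, ?_⟩
    ext r
    constructor
    · rintro ⟨hr, ⟨r, hrH, rfl⟩, hlt'⟩
      rw [h.isReflection_iff] at hr
      have : r ∈ {r | ds.IsReflection r ∧ r ∈ H ∧ ds.length (r * t) < ds.length t} :=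
        ⟨hr, hrH, (hlt r t hr).mp hlt'⟩
      rw [hN] at this
      exact congrArg φ this
    · rintro rfl
      have : t ∈ {r | ds.IsReflection r ∧ r ∈ H ∧ ds.length (r * t) < ds.length t} := hN ▸ rfl
      exact ⟨(h.isReflection_iff t).mpr ht, ⟨t, this.2.1, rfl⟩, (hlt t t ht).mpr this.2.2⟩

theorem isDihedralSubgroup_map {H : Subgroup G} (hH : ds.IsDihedralSubgroup H) :
    cs.IsDihedralSubgroup (H.map φ) := by
  obtain ⟨a, b, ha, hb, hab, -⟩ := hH.exists_closure_eq
  obtain ⟨-, M', cs', hcs'⟩ := hH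
  constructor
  · have : H.map φ = Subgroup.closure (φ '' {a, b}) := by rw [hab, MonoidHom.map_closure]
    rw [this]
    apply closure_eq_closure_reflectionsIn
    rintro _ ⟨t, rfl | rfl, rfl⟩
    exacts [(h.isReflection_iff _).mpr ha, (h.isReflection_iff _).mpr hb]
  · refine ⟨M', ⟨(H.equivMapOfInjective φ h.injective).symm.trans cs'.mulEquiv⟩, ?_⟩
    rw [h.canonicalGenerators_map, ← hcs', ← Set.range_comp]
    rfl

/-- The embedding carries dihedral subgroups to dihedral subgroups with corresponding canonical
generators, so each chain condition is inherited. -/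
theorem isReflectionOrdering_comap {le : W → W → Prop} (hle : cs.IsReflectionOrdering le) :
    ds.IsReflectionOrdering fun x y => le (φ x) (φ y) := by
  obtain ⟨hlin, hdih⟩ := hle
  constructor
  · let f : {t // ds.IsReflection t} → {t // cs.IsReflection t} :=
      fun t => ⟨φ t, (h.isReflection_iff _).mpr t.2⟩
    exact
    { refl := fun s => hlin.refl (f s)
      trans := fun s t r => hlin.trans (f s) (f t) (f r)
      antisymm := fun s t h1 h2 => Subtype.ext (h.injective
        (congrArg Subtype.val (hlin.antisymm (f s) (f t) h1 h2)))
      total := fun s t => hlin.total (f s) (f t) }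
  · intro H a b hH hab hcan
    have hword : ∀ (x y : G) (n : ℕ), φ (oddWord x y n) = oddWord (φ x) (φ y) n := by
      intro x y n
      simp [oddWord]
    have hred : ∀ (x y : G) (n : ℕ), OddWordReduced (φ x) (φ y) n ↔ OddWordReduced x y n := by
      intro x y n
      rw [OddWordReduced, OddWordReduced, ← map_mul, orderOf_injective φ h.injective]
    have hchain : ∀ x y : G, IsDihedralChain le (φ x) (φ y) →
        IsDihedralChain (fun x y => le (φ x) (φ y)) x y := by
      intro x y hc m n hm hn
      have := hc m n ((hred _ _ _).mpr hm) ((hred _ _ _).mpr hn)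
      simpa only [hword] using this
    refine (hdih (H.map φ) (φ a) (φ b) (h.isDihedralSubgroup_map hH) (h.injective.ne hab)
      ?_).imp (hchain a b) (hchain b a)
    rw [h.canonicalGenerators_map, hcan, Set.image_pair]

end IsDihedralEmbedding

end CoxeterSystem

/-! ### Times and covers in the time-support poset. -/

namespace Flipclass

variable {W : Type*} {h : ℕ} {F : Set (Fin (h + 1) → W)}

/-- The element of the time-support poset given by a path and a time. -/
def tsPoint {x : Fin (h + 1) → W} (hx : x ∈ F) (i : Fin (h + 1)) : TSP F := ⟨(x i, i), x, hx, rfl⟩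

theorem exists_eq_tsPoint (p : TSP F) : ∃ (x : Fin (h + 1) → W) (hx : x ∈ F) (i : Fin (h + 1)),
    p = tsPoint hx i := by
  obtain ⟨⟨a, i⟩, x, hx, hxi⟩ := p
  exact ⟨x, hx, i, Subtype.ext (Prod.ext hxi.symm rfl)⟩

theorem tsPoint_eq_iff {x y : Fin (h + 1) → W} (hx : x ∈ F) (hy : y ∈ F) {i j : Fin (h + 1)} :
    tsPoint hx i = tsPoint hy j ↔ x i = y j ∧ i = j :=
  Subtype.ext_iff.trans Prod.ext_iff

theorem tsPoint_le_tsPoint {x : Fin (h + 1) → W} (hx : x ∈ F) {i j : Fin (h + 1)} (hij : i ≤ j) :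
    tsPoint hx i ≤ tsPoint hx j := by
  obtain ⟨i, hi⟩ := i
  obtain ⟨j, hj⟩ := j
  have hij' : i ≤ j := hij
  clear hij
  induction j, hij' using Nat.le_induction with
  | base => exact le_rfl
  | succ j hij ih =>
    exact (ih (by omega)).trans (Relation.ReflTransGen.single ⟨x, hx, ⟨j, by omega⟩, rfl, rfl⟩)

theorem time_lt_of_lt {p q : TSP F} (hpq : p < q) : p.1.2 < q.1.2 :=
  (TSEdge.le_time hpq.le).resolve_left hpq.ne

theorem tsPoint_covBy {x : Fin (h + 1) → W} (hx : x ∈ F) (i : Fin h) :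
    tsPoint hx i.castSucc ⋖ tsPoint hx i.succ := by
  refine ⟨lt_of_le_of_ne (tsPoint_le_tsPoint hx (Fin.castSucc_lt_succ).le) fun he => ?_,
    fun c h1 h2 => ?_⟩
  · exact (Fin.castSucc_lt_succ (i := i)).ne ((tsPoint_eq_iff hx hx).mp he).2
  · have h3 : i.castSucc < c.1.2 := time_lt_of_lt h1
    have h4 : c.1.2 < i.succ := time_lt_of_lt h2
    simp only [Fin.lt_def, Fin.val_castSucc, Fin.val_succ] at h3 h4
    omega

end Flipclass

/-! ### The span of the labels is determined by the atoms or by the coatoms. -/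

namespace CoxeterSystem

variable {B W : Type*} [Group W] {M : CoxeterMatrix B} {cs : CoxeterSystem M W}

theorem exists_minimal_coset_representative {G : Type*} [Group G] (cs : CoxeterSystem M W)
    (φ : G →* W) (u : W) :
    ∃ z g, u = φ g * z ∧ ∀ g', cs.length z ≤ cs.length (φ g' * z) := by
  obtain ⟨g, hg⟩ : ∃ g, ∀ g', cs.length (φ g * u) ≤ cs.length (φ g' * u) :=
    ⟨_, fun g' => Function.argmin_le (fun g => cs.length (φ g * u)) g'⟩
  refine ⟨φ g * u, g⁻¹, by simp, fun g' => ?_⟩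
  rw [← mul_assoc, ← map_mul]
  exact hg _

theorem ne_of_mem_midpoints {u v x : W} (hx : x ∈ cs.midpoints u v) : x * u⁻¹ ≠ v * x⁻¹ := by
  intro he
  have h1 := hx.2.2.mul_self
  rw [← he] at h1
  have h2 : v * x⁻¹ * (x * u⁻¹) = 1 := by rw [← he, h1]
  rw [mul_assoc, inv_mul_cancel_left, mul_inv_eq_one] at h2
  have := hx.1.1.trans hx.2.1
  rw [h2] at this
  exact lt_irrefl _ this

theorem posRoot_mem_of_mem_midpoints {u v x y : W} (hx : x ∈ cs.midpoints u v)
    (hy : y ∈ cs.midpoints u v) {P : Submodule ℝ (B →₀ ℝ)} (h1 : cs.posRoot (x * u⁻¹) ∈ P)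
    (h2 : cs.posRoot (v * x⁻¹) ∈ P) :
    cs.posRoot (y * u⁻¹) ∈ P ∧ cs.posRoot (v * y⁻¹) ∈ P :=
  hx.1.2.posRoot_mem_span hx.2.2 hy.1.2 hy.2.2 (ne_of_mem_midpoints hy) (by simp [mul_assoc]) h1 h2

/-- The two labels of `u → x → v` span a plane, so the whole situation lies in a coset of a dihedral
subgroup, where the flip is `swap`. -/
theorem flipMid_spec {u v x : W} (hx : x ∈ cs.midpoints u v) :
    cs.flipMid u v x ∈ cs.midpoints u v ∧ cs.flipMid u v x ≠ x := by
  have hne := ne_of_mem_midpoints hx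
  have hfin := finrank_span_eq_card (posRoot_linearIndependent hx.1.2 hx.2.2 hne)
  rw [Fintype.card_fin] at hfin
  obtain ⟨D, φ, hφ, hmem⟩ := exists_isDihedralEmbedding hfin hx.1.2 hx.2.2 hne
    (Submodule.subset_span ⟨0, rfl⟩) (Submodule.subset_span ⟨1, rfl⟩)
  obtain ⟨z, u', hu, hz⟩ := cs.exists_minimal_coset_representative φ u
  obtain ⟨t₁, h1⟩ := hmem _ hx.1.2 (Submodule.subset_span ⟨0, rfl⟩)
  obtain ⟨t₂, h2⟩ := hmem _ hx.2.2 (Submodule.subset_span ⟨1, rfl⟩)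
  have hx' : x = φ (t₁ * u') * z := by
    rw [map_mul, h1, mul_assoc, ← hu, inv_mul_cancel_right]
  have hv' : v = φ (t₂ * t₁ * u') * z := by
    rw [mul_assoc, map_mul, h2, mul_assoc, ← hx', inv_mul_cancel_right]
  generalize t₂ * t₁ * u' = v' at *
  generalize t₁ * u' = x' at *
  subst hu hx' hv'
  have hx' := (hφ.mem_midpoints_iff hz).mp hx
  rw [hφ.flipMid_eq hz hx', hφ.mem_midpoints_iff hz, Ne, hφ.apply_mul_left_inj]
  exact ⟨swap_mem_midpoints _ hx', swap_ne_of_mem_midpoints _ hx'⟩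

theorem mem_of_mem_span_pair {V : Type*} [AddCommGroup V] [Module ℝ V] {P : Submodule ℝ V}
    {a b c : V} (h : LinearIndependent ℝ ![a, c]) (hc : c ∈ Submodule.span ℝ {a, b}) (haP : a ∈ P)
    (hcP : c ∈ P) : b ∈ P := by
  obtain ⟨p, q, hpq⟩ := Submodule.mem_span_pair.mp hc
  have hq : q ≠ 0 := by
    rintro rfl
    have := LinearIndependent.pair_iff.mp h p (-1) (by rw [← hpq]; module)
    simpa using this.2
  have : b = q⁻¹ • (c - p • a) := by
    rw [← hpq, add_sub_cancel_left, smul_smul, inv_mul_cancel₀ hq, one_smul]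
  rw [this]
  exact P.smul_mem _ (P.sub_mem hcP (P.smul_mem _ haP))

namespace IsFlipclass

variable {h : ℕ} {u v : W} {F : Set (Fin (h + 1) → W)} (hF : cs.IsFlipclass u v F)

include hF

theorem nonempty : F.Nonempty := hF.prop.1

theorem subset_bruhatPaths : F ⊆ cs.bruhatPaths h u v := hF.prop.2.1

theorem flip_mem {x : Fin (h + 1) → W} (hx : x ∈ F) (k : ℕ) (hk : k + 2 ≤ h) :
    cs.flip k hk x ∈ F := hF.prop.2.2 x hx k hk

theorem subset_of_closed {G : Set (Fin (h + 1) → W)} (hne : G.Nonempty) (hG : G ⊆ F)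
    (hflip : ∀ x ∈ G, ∀ (k : ℕ) (hk : k + 2 ≤ h), cs.flip k hk x ∈ G) : F ⊆ G :=
  hF.le_of_le ⟨hne, hG.trans hF.subset_bruhatPaths, hflip⟩ hG

theorem apply_zero {x : Fin (h + 1) → W} (hx : x ∈ F) : x 0 = u := (hF.subset_bruhatPaths hx).1

theorem apply_last {x : Fin (h + 1) → W} (hx : x ∈ F) : x (Fin.last h) = v :=
  (hF.subset_bruhatPaths hx).2.1

theorem mem_midpoints {x : Fin (h + 1) → W} (hx : x ∈ F) (k : ℕ) (hk : k + 2 ≤ h) :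
    x ⟨k + 1, by omega⟩ ∈ cs.midpoints (x ⟨k, by omega⟩) (x ⟨k + 2, by omega⟩) :=
  ⟨(hF.subset_bruhatPaths hx).2.2 ⟨k, by omega⟩, (hF.subset_bruhatPaths hx).2.2 ⟨k + 1, by omega⟩⟩

theorem isReflection_label {x : Fin (h + 1) → W} (hx : x ∈ F) (i : Fin h) :
    cs.IsReflection (Flipclass.label x i) := ((hF.subset_bruhatPaths hx).2.2 i).2

theorem isReflection_of_mem_labels {t : W} (ht : t ∈ Flipclass.labels F) :
    cs.IsReflection t := by
  obtain ⟨x, hx, i, rfl⟩ := ht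
  exact hF.isReflection_label hx i

theorem mem_roots_iff {α : B →₀ ℝ} :
    α ∈ Flipclass.roots cs F ↔ ∃ t ∈ Flipclass.labels F, α = cs.posRoot t := by
  constructor
  · rintro ⟨t, ht, hα⟩
    exact ⟨t, ht, (isPosRootOf_iff.mp hα).2⟩
  · rintro ⟨t, ht, hα⟩
    exact ⟨t, ht, isPosRootOf_iff.mpr ⟨hF.isReflection_of_mem_labels ht, hα⟩⟩

theorem exists_ne_labels (hh : 2 ≤ h) :
    ∃ c ∈ Flipclass.labels F, ∃ d ∈ Flipclass.labels F, c ≠ d := by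
  obtain ⟨x, hx⟩ := hF.nonempty
  exact ⟨_, ⟨x, hx, ⟨0, by omega⟩, rfl⟩, _, ⟨x, hx, ⟨1, by omega⟩, rfl⟩,
    ne_of_mem_midpoints (hF.mem_midpoints hx 0 hh)⟩

theorem finrank_span_roots (hh : 2 ≤ h) {P : Submodule ℝ (B →₀ ℝ)} (hfin : Module.Finite ℝ P)
    (hP : Module.finrank ℝ P ≤ 2) (hlab : ∀ t ∈ Flipclass.labels F, cs.posRoot t ∈ P) :
    Module.finrank ℝ (Submodule.span ℝ (Flipclass.roots cs F)) = 2 := by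
  obtain ⟨c, hc, d, hd, hcd⟩ := hF.exists_ne_labels hh
  refine finrank_span_eq_two hfin hP ?_ (hF.isReflection_of_mem_labels hc)
    (hF.isReflection_of_mem_labels hd) hcd (hF.mem_roots_iff.mpr ⟨c, hc, rfl⟩)
    (hF.mem_roots_iff.mpr ⟨d, hd, rfl⟩)
  intro α hα
  obtain ⟨t, ht, rfl⟩ := hF.mem_roots_iff.mp hα
  exact hlab t ht

/-- The four labels of a 2-path and its flip have coplanar roots. The first labels of the two paths
differ, as do the last ones, so either pair spans the plane. -/
theorem posRoot_label_mem_of_flip {x : Fin (h + 1) → W} (hx : x ∈ F) (k : ℕ) (hk : k + 2 ≤ h)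
    {P : Submodule ℝ (B →₀ ℝ)} :
    (cs.posRoot (Flipclass.label x ⟨k, by omega⟩) ∈ P →
      cs.posRoot (Flipclass.label (cs.flip k hk x) ⟨k, by omega⟩) ∈ P →
      cs.posRoot (Flipclass.label x ⟨k + 1, by omega⟩) ∈ P) ∧
    (cs.posRoot (Flipclass.label x ⟨k + 1, by omega⟩) ∈ P →
      cs.posRoot (Flipclass.label (cs.flip k hk x) ⟨k + 1, by omega⟩) ∈ P →
      cs.posRoot (Flipclass.label x ⟨k, by omega⟩) ∈ P) := by
  have hmid := hF.mem_midpoints hx k hk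
  have hspec := flipMid_spec hmid
  set a := x ⟨k, by omega⟩ with ha
  set m := x ⟨k + 1, by omega⟩ with hm
  set b := x ⟨k + 2, by omega⟩ with hb
  set m' := cs.flipMid a b m with hm'
  have e1 : Flipclass.label x ⟨k, by omega⟩ = m * a⁻¹ := rfl
  have e2 : Flipclass.label x ⟨k + 1, by omega⟩ = b * m⁻¹ := rfl
  have e3 : Flipclass.label (cs.flip k hk x) ⟨k, by omega⟩ = m' * a⁻¹ := by
    simp [Flipclass.label, flip, hm', ha, hb, hm]
  have e4 : Flipclass.label (cs.flip k hk x) ⟨k + 1, by omega⟩ = b * m'⁻¹ := by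
    simp [Flipclass.label, flip, hm', ha, hb, hm]
  rw [e1, e2, e3, e4]
  constructor
  · intro h1 h2
    refine mem_of_mem_span_pair (posRoot_linearIndependent hmid.1.2 hspec.1.1.2
      fun h => hspec.2 (mul_right_cancel h).symm) ?_ h1 h2
    exact (posRoot_mem_of_mem_midpoints hmid hspec.1 (Submodule.subset_span (by simp))
      (Submodule.subset_span (by simp))).1
  · intro h1 h2
    refine mem_of_mem_span_pair (posRoot_linearIndependent hmid.2.2 hspec.1.2.2
      fun h => hspec.2 (inv_injective (mul_left_cancel h)).symm) ?_ h1 h2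
    exact (posRoot_mem_of_mem_midpoints hmid hspec.1 (Submodule.subset_span (by simp))
      (Submodule.subset_span (by simp))).2

/-- Induction along the path: the `k`-th label of a path and that of its flip at the next vertex lie
in `P`, and together they force the following label into `P`. Closure of `F` under flips is
essential here. -/
theorem posRoot_mem_of_first_labels {P : Submodule ℝ (B →₀ ℝ)}
    (hP : ∀ x ∈ F, ∀ h0 : 0 < h, cs.posRoot (Flipclass.label x ⟨0, h0⟩) ∈ P) :
    ∀ t ∈ Flipclass.labels F, cs.posRoot t ∈ P := by
  rintro _ ⟨x, hx, ⟨k, hk⟩, rfl⟩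
  induction k generalizing x with
  | zero => exact hP x hx hk
  | succ k ih =>
    exact (hF.posRoot_label_mem_of_flip hx k (by omega)).1 (ih x hx (by omega))
      (ih _ (hF.flip_mem hx k (by omega)) (by omega))

theorem posRoot_mem_of_last_labels {P : Submodule ℝ (B →₀ ℝ)}
    (hP : ∀ x ∈ F, ∀ h0 : 0 < h, cs.posRoot (Flipclass.label x ⟨h - 1, by omega⟩) ∈ P) :
    ∀ t ∈ Flipclass.labels F, cs.posRoot t ∈ P := by
  rintro _ ⟨x, hx, ⟨k, hk⟩, rfl⟩
  obtain ⟨j, hj⟩ : ∃ j, k + j + 1 = h := ⟨h - 1 - k, by omega⟩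
  induction j generalizing x k with
  | zero =>
    have : k = h - 1 := by omega
    subst this
    exact hP x hx (by omega)
  | succ j ih =>
    exact (hF.posRoot_label_mem_of_flip hx k (by omega)).2 (ih x hx (k + 1) (by omega) (by omega))
      (ih _ (hF.flip_mem hx k (by omega)) (k + 1) (by omega) (by omega))

theorem isBot_tsPoint {x : Fin (h + 1) → W} (hx : x ∈ F) : IsBot (Flipclass.tsPoint hx 0) := by
  intro q
  obtain ⟨y, hy, j, rfl⟩ := Flipclass.exists_eq_tsPoint q
  have : Flipclass.tsPoint hx 0 = Flipclass.tsPoint hy 0 := by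
    rw [Flipclass.tsPoint_eq_iff, hF.apply_zero hx, hF.apply_zero hy]
    exact ⟨rfl, rfl⟩
  exact this ▸ Flipclass.tsPoint_le_tsPoint hy (Fin.zero_le j)

theorem isTop_tsPoint {x : Fin (h + 1) → W} (hx : x ∈ F) :
    IsTop (Flipclass.tsPoint hx (Fin.last h)) := by
  intro q
  obtain ⟨y, hy, j, rfl⟩ := Flipclass.exists_eq_tsPoint q
  have : Flipclass.tsPoint hx (Fin.last h) = Flipclass.tsPoint hy (Fin.last h) := by
    rw [Flipclass.tsPoint_eq_iff, hF.apply_last hx, hF.apply_last hy]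
    exact ⟨rfl, rfl⟩
  exact this ▸ Flipclass.tsPoint_le_tsPoint hy (Fin.le_last j)

/-- All paths start at `u`, so each vertex at time 1 is an atom and only two first labels occur. -/
theorem finrank_eq_two_of_atoms (hh : 2 ≤ h) (hat : (Flipclass.atoms (Flipclass.TSP F)).ncard = 2) :
    Module.finrank ℝ (Submodule.span ℝ (Flipclass.roots cs F)) = 2 := by
  classical
  obtain ⟨p, q, -, hpq⟩ := Set.ncard_eq_two.mp hat
  let S : Finset (B →₀ ℝ) := {cs.posRoot (p.1.1 * u⁻¹), cs.posRoot (q.1.1 * u⁻¹)}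
  refine hF.finrank_span_roots hh (P := Submodule.span ℝ (S : Set (B →₀ ℝ)))
    (FiniteDimensional.span_of_finite ℝ (Set.toFinite _))
    ((finrank_span_finset_le_card (R := ℝ) S).trans Finset.card_le_two) ?_
  apply hF.posRoot_mem_of_first_labels
  intro x hx h0
  apply Submodule.subset_span
  have hmem : Flipclass.tsPoint hx (Fin.succ ⟨0, h0⟩) ∈ Flipclass.atoms (Flipclass.TSP F) :=
    ⟨_, hF.isBot_tsPoint hx, Flipclass.tsPoint_covBy hx ⟨0, h0⟩⟩
  have hu : x (Fin.castSucc ⟨0, h0⟩) = u := hF.apply_zero hx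
  rw [hpq] at hmem
  rw [Flipclass.label, hu]
  rcases hmem with hmem | hmem
  · have := congrArg (fun p : Flipclass.TSP F => p.1.1) hmem
    simp only [Flipclass.tsPoint] at this
    rw [this]; simp [S]
  · have := congrArg (fun p : Flipclass.TSP F => p.1.1) hmem
    simp only [Flipclass.tsPoint] at this
    rw [this]; simp [S]

theorem finrank_eq_two_of_coatoms (hh : 2 ≤ h)
    (hat : (Flipclass.coatoms (Flipclass.TSP F)).ncard = 2) :
    Module.finrank ℝ (Submodule.span ℝ (Flipclass.roots cs F)) = 2 := by
  classical
  obtain ⟨p, q, -, hpq⟩ := Set.ncard_eq_two.mp hat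
  let S : Finset (B →₀ ℝ) := {cs.posRoot (v * p.1.1⁻¹), cs.posRoot (v * q.1.1⁻¹)}
  refine hF.finrank_span_roots hh (P := Submodule.span ℝ (S : Set (B →₀ ℝ)))
    (FiniteDimensional.span_of_finite ℝ (Set.toFinite _))
    ((finrank_span_finset_le_card (R := ℝ) S).trans Finset.card_le_two) ?_
  apply hF.posRoot_mem_of_last_labels
  intro x hx h0
  apply Submodule.subset_span
  have hlast : Fin.succ (⟨h - 1, by omega⟩ : Fin h) = Fin.last h := by
    ext; simp; omega
  have hmem : Flipclass.tsPoint hx (Fin.castSucc ⟨h - 1, by omega⟩) ∈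
      Flipclass.coatoms (Flipclass.TSP F) :=
    ⟨_, hF.isTop_tsPoint hx, hlast ▸ Flipclass.tsPoint_covBy hx ⟨h - 1, by omega⟩⟩
  have hv : x (Fin.succ ⟨h - 1, by omega⟩) = v := by rw [hlast]; exact hF.apply_last hx
  rw [hpq] at hmem
  rw [Flipclass.label, hv]
  rcases hmem with hmem | hmem
  · have := congrArg (fun p : Flipclass.TSP F => p.1.1) hmem
    simp only [Flipclass.tsPoint] at this
    rw [this]; simp [S]
  · have := congrArg (fun p : Flipclass.TSP F => p.1.1) hmem
    simp only [Flipclass.tsPoint] at this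
    rw [this]; simp [S]

end IsFlipclass

end CoxeterSystem

/-! ### Transfer of flipclasses to and from rank two. -/

namespace CoxeterSystem

variable {B W : Type*} [Group W] {M : CoxeterMatrix B} {cs : CoxeterSystem M W}
variable {D : CoxeterMatrix (Fin 2)} {G : Type*} [Group G] {ds : CoxeterSystem D G}

theorem mem_midpoints_of_edges {h : ℕ} {x : Fin (h + 1) → W}
    (hx : ∀ i : Fin h, cs.BruhatEdge (x i.castSucc) (x i.succ)) (k : ℕ) (hk : k + 2 ≤ h) :
    x ⟨k + 1, by omega⟩ ∈ cs.midpoints (x ⟨k, by omega⟩) (x ⟨k + 2, by omega⟩) :=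
  ⟨hx ⟨k, by omega⟩, hx ⟨k + 1, by omega⟩⟩

theorem flip_eq_update_swap {h : ℕ} {x : Fin (h + 1) → G}
    (hx : ∀ i : Fin h, ds.BruhatEdge (x i.castSucc) (x i.succ)) (k : ℕ) (hk : k + 2 ≤ h) :
    ds.flip k hk x = Function.update x ⟨k + 1, by omega⟩ (ds.swap (x ⟨k + 1, by omega⟩)) := by
  rw [flip, flipMid_eq_swap (mem_midpoints_of_edges hx k hk)]

theorem IsDihedralEmbedding.flip_apply {φ : G →* W} (hφ : IsDihedralEmbedding ds cs φ) {z : W}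
    (hz : ∀ g, cs.length z ≤ cs.length (φ g * z)) {h : ℕ} {x : Fin (h + 1) → G}
    (hx : ∀ i : Fin h, ds.BruhatEdge (x i.castSucc) (x i.succ)) (k : ℕ) (hk : k + 2 ≤ h) :
    cs.flip k hk (fun j => φ (x j) * z) = fun j => φ (ds.flip k hk x j) * z := by
  rw [flip_eq_update_swap hx, flip, hφ.flipMid_eq hz (mem_midpoints_of_edges hx k hk)]
  funext j
  by_cases hj : j = ⟨k + 1, by omega⟩
  · subst hj; simp
  · simp [Function.update_of_ne hj]

-- All labels lie in the dihedral group of the plane, so all paths stay in the coset of `u`. Pulling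
-- them back along `g ↦ φ g * z` respects edges, labels and flips.
open Flipclass in
theorem IsFlipclass.exists_iso {h : ℕ} {u v : W} {F : Set (Fin (h + 1) → W)}
    (hF : cs.IsFlipclass u v F) (hh : 2 ≤ h)
    (hfin : Module.finrank ℝ (Submodule.span ℝ (roots cs F)) = 2) :
    ∃ (D : CoxeterMatrix (Fin 2)) (u' v' : D.Group) (F' : Set (Fin (h + 1) → D.Group)),
      D.toCoxeterSystem.IsFlipclass u' v' F' ∧ Iso cs D.toCoxeterSystem F F' := by
  obtain ⟨c, hc, d, hd, hcd⟩ := hF.exists_ne_labels hh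
  have hroot : ∀ t ∈ labels F, cs.posRoot t ∈ Submodule.span ℝ (roots cs F) :=
    fun t ht => Submodule.subset_span (hF.mem_roots_iff.mpr ⟨t, ht, rfl⟩)
  obtain ⟨D, φ, hφ, hmem⟩ := exists_isDihedralEmbedding hfin (hF.isReflection_of_mem_labels hc)
    (hF.isReflection_of_mem_labels hd) hcd (hroot c hc) (hroot d hd)
  obtain ⟨z, u', hu, hz⟩ := cs.exists_minimal_coset_representative φ u
  set ds := D.toCoxeterSystem with hds
  have hverts : ∀ x ∈ F, ∃ x' : Fin (h + 1) → D.Group, x = fun j => φ (x' j) * z := by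
    intro x hx
    suffices hs : ∀ j, ∃ g, x j = φ g * z by
      choose x' hx' using hs
      exact ⟨x', funext hx'⟩
    intro j
    induction j using Fin.induction with
    | zero => exact ⟨u', by rw [hF.apply_zero hx, hu]⟩
    | succ i ih =>
      obtain ⟨g, hg⟩ := ih
      obtain ⟨t, ht⟩ := hmem _ (hF.isReflection_label hx i) (hroot _ ⟨x, hx, i, rfl⟩)
      refine ⟨t * g, ?_⟩
      rw [map_mul, ht, mul_assoc, ← hg, label, inv_mul_cancel_right]
  let m : (Fin (h + 1) → D.Group) → (Fin (h + 1) → W) := fun x' j => φ (x' j) * z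
  have hm_inj : Function.Injective m := fun x y hxy =>
    funext fun j => hφ.apply_mul_left_inj.mp (congrFun hxy j)
  let F' : Set (Fin (h + 1) → D.Group) := {x' | m x' ∈ F}
  have hedges : ∀ x' ∈ F', ∀ i : Fin h, ds.BruhatEdge (x' i.castSucc) (x' i.succ) := fun x' hx' i =>
    (hφ.bruhatEdge_iff hz).mp ((hF.subset_bruhatPaths hx').2.2 i)
  have hflip : ∀ x' ∈ F', ∀ (k : ℕ) (hk : k + 2 ≤ h), cs.flip k hk (m x') = m (ds.flip k hk x') :=
    fun x' hx' k hk => hφ.flip_apply hz (hedges x' hx') k hk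
  obtain ⟨x₀, hx₀⟩ := hF.nonempty
  obtain ⟨y₀, rfl⟩ := hverts x₀ hx₀
  have hy₀ : y₀ ∈ F' := hx₀
  have hF' : ds.IsFlipclass (y₀ 0) (y₀ (Fin.last h)) F' := by
    refine ⟨⟨⟨y₀, hy₀⟩, fun x' hx' => ⟨?_, ?_, hedges x' hx'⟩, fun x' hx' k hk => ?_⟩, ?_⟩
    · rw [← hφ.apply_mul_left_inj (z := z)]
      exact (hF.apply_zero hx').trans (hF.apply_zero hx₀).symm
    · rw [← hφ.apply_mul_left_inj (z := z)]
      exact (hF.apply_last hx').trans (hF.apply_last hx₀).symm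
    · change m _ ∈ F
      rw [← hflip x' hx' k hk]
      exact hF.flip_mem hx' k hk
    -- Minimality is inherited: the image of a flip-closed subset is flip-closed in `F`, hence all
    -- of `F`.
    · rintro G ⟨⟨y, hy⟩, -, hGflip⟩ hGF x' hx'
      have := hF.subset_of_closed (G := m '' G) ⟨m y, y, hy, rfl⟩
        (by rintro _ ⟨x, hx, rfl⟩; exact hGF hx)
        (by
          rintro _ ⟨x, hx, rfl⟩ k hk
          exact ⟨_, hGflip x hx k hk, (hflip x (hGF hx) k hk).symm⟩) hx'
      obtain ⟨w, hw, hwx⟩ := this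
      exact hm_inj hwx ▸ hw
  have hlabel : ∀ (x' : Fin (h + 1) → D.Group) (i : Fin h), label (m x') i = φ (label x' i) := by
    intro x' i
    simp [label, m, mul_assoc]
  let ε : elts F' ≃ elts F := Equiv.ofBijective
    (fun w => ⟨φ w.1 * z, by
      obtain ⟨_, x', hx', j, rfl⟩ := w
      exact ⟨m x', hx', j, rfl⟩⟩)
    ⟨fun w₁ w₂ h12 => Subtype.ext (hφ.apply_mul_left_inj.mp (congrArg Subtype.val h12)), by
      rintro ⟨_, x, hx, j, rfl⟩
      obtain ⟨x', rfl⟩ := hverts x hx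
      exact ⟨⟨x' j, x', hx, j, rfl⟩, rfl⟩⟩
  let τ : labels F' ≃ labels F := Equiv.ofBijective
    (fun t => ⟨φ t.1, by
      obtain ⟨_, x', hx', j, rfl⟩ := t
      exact ⟨m x', hx', j, hlabel x' j⟩⟩)
    ⟨fun t₁ t₂ h12 => Subtype.ext (hφ.injective (congrArg Subtype.val h12)), by
      rintro ⟨_, x, hx, j, rfl⟩
      obtain ⟨x', rfl⟩ := hverts x hx
      exact ⟨⟨label x' j, x', hx, j, rfl⟩, Subtype.ext (hlabel x' j).symm⟩⟩
  have hε : ∀ x' : Fin (h + 1) → elts F', (fun j => ((ε (x' j) : elts F) : W)) =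
      m fun j => (x' j : D.Group) := fun x' => rfl
  have hτ : ∀ t : labels F', (τ t : W) = φ t := fun t => rfl
  obtain ⟨le, hle⟩ := cs.exists_isReflectionOrdering
  refine ⟨D, _, _, F', hF', ε.symm, τ.symm, ?_, ?_, le, fun x y => le (φ x) (φ y), hle,
    hφ.isReflectionOrdering_comap hle, ?_⟩
  · intro x t
    obtain ⟨x', rfl⟩ := ε.surjective.comp_left x
    obtain ⟨t', rfl⟩ := τ.surjective.comp_left t
    simp only [Function.comp_apply, Equiv.symm_apply_apply]
    rw [hε]
    refine and_congr Iff.rfl (forall_congr' fun i => ?_)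
    rw [hlabel, hτ, hφ.injective.eq_iff]
  · intro x y hx hy k hk hxy
    obtain ⟨x', rfl⟩ := ε.surjective.comp_left x
    obtain ⟨y', rfl⟩ := ε.surjective.comp_left y
    simp only [Function.comp_apply, Equiv.symm_apply_apply] at hxy hx ⊢
    rw [hε] at hx hxy
    rw [hε, hflip _ hx] at hxy
    exact hm_inj hxy
  · intro s t
    obtain ⟨s, rfl⟩ := τ.surjective s
    obtain ⟨t, rfl⟩ := τ.surjective t
    rw [Equiv.symm_apply_apply, Equiv.symm_apply_apply, hτ, hτ]

theorem _root_.Flipclass.Iso.combIso {B' W' : Type*} [Group W'] {M' : CoxeterMatrix B'}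
    {cs' : CoxeterSystem M' W'} {h : ℕ} {F : Set (Fin (h + 1) → W)} {F' : Set (Fin (h + 1) → W')}
    (hFF' : Flipclass.Iso cs cs' F F') : Flipclass.CombIso cs cs' F F' := by
  obtain ⟨ε, τ, h1, h2, -⟩ := hFF'
  refine ⟨ε, fun x => ⟨fun hx => ?_, fun hx => ?_⟩, h2⟩
  · exact ((h1 x fun i => ⟨_, _, hx, i, rfl⟩).mp ⟨hx, fun i => rfl⟩).1
  · refine ((h1 x fun i => τ.symm ⟨_, _, hx, i, rfl⟩).mpr ⟨hx, fun i => ?_⟩).1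
    rw [Equiv.apply_symm_apply]

/-- This is all that the time-support poset needs: a map of paths under which two vertices coincide
exactly when their images do. -/
theorem _root_.Flipclass.CombIso.exists_surjective {B' W' : Type*} [Group W'] {M' : CoxeterMatrix B'}
    {cs' : CoxeterSystem M' W'} {h : ℕ} {F : Set (Fin (h + 1) → W)} {F' : Set (Fin (h + 1) → W')}
    (hFF' : Flipclass.CombIso cs cs' F F') : ∃ f : F → F', Function.Surjective f ∧
      ∀ x y i j, (f x).1 i = (f y).1 j ↔ x.1 i = y.1 j := by
  obtain ⟨ε, h1, -⟩ := hFF'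
  let l : F → (Fin (h + 1) → Flipclass.elts F) := fun x j => ⟨x.1 j, x.1, x.2, j, rfl⟩
  refine ⟨fun x => ⟨fun j => ε (l x j), (h1 (l x)).mp x.2⟩, fun y => ?_, fun x y i j => ?_⟩
  · let l' : Fin (h + 1) → Flipclass.elts F' := fun j => ⟨y.1 j, y.1, y.2, j, rfl⟩
    refine ⟨⟨fun j => ε.symm (l' j), (h1 fun j => ε.symm (l' j)).mpr ?_⟩, ?_⟩
    · simp only [Equiv.apply_symm_apply]
      exact y.2
    · ext j
      have : l ⟨fun j => ε.symm (l' j), (h1 fun j => ε.symm (l' j)).mpr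
        (by simp only [Equiv.apply_symm_apply]; exact y.2)⟩ j = ε.symm (l' j) := rfl
      simp only [this, Equiv.apply_symm_apply]
      rfl
  · change (ε (l x i) : W') = ε (l y j) ↔ _
    rw [Subtype.coe_inj, ε.apply_eq_iff_eq, ← Subtype.coe_inj]

namespace IsFlipclass

variable {h : ℕ} {u v : G} {F : Set (Fin (h + 1) → G)} (hF : ds.IsFlipclass u v F)

include hF

theorem update_swap_mem {x : Fin (h + 1) → G} (hx : x ∈ F) (k : ℕ) (hk : k + 2 ≤ h) :
    Function.update x ⟨k + 1, by omega⟩ (ds.swap (x ⟨k + 1, by omega⟩)) ∈ F := by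
  rw [← flip_eq_update_swap (hF.subset_bruhatPaths hx).2.2 k hk]
  exact hF.flip_mem hx k hk

/-- The paths with this property relative to `x` are closed under flips, because a flip applies
`swap` to one vertex; minimality of `F` does the rest. -/
theorem eq_or_eq_swap {x y : Fin (h + 1) → G} (hx : x ∈ F) (hy : y ∈ F) (i : Fin (h + 1)) :
    y i = x i ∨ y i = ds.swap (x i) := by
  have := hF.subset_of_closed (G := {y ∈ F | ∀ i, y i = x i ∨ y i = ds.swap (x i)})
    ⟨x, hx, fun i => Or.inl rfl⟩ (fun y hy => hy.1) ?_ hy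
  · exact this.2 i
  · rintro y ⟨hy, hyx⟩ k hk
    refine ⟨hF.flip_mem hy k hk, fun i => ?_⟩
    rw [flip_eq_update_swap (hF.subset_bruhatPaths hy).2.2 k hk]
    by_cases hi : i = ⟨k + 1, by omega⟩
    · subst hi
      rw [Function.update_self]
      rcases hyx ⟨k + 1, by omega⟩ with h1 | h1
      · exact Or.inr (by rw [h1])
      · exact Or.inl (by rw [h1, swap_swap])
    · rw [Function.update_of_ne hi]
      exact hyx i

theorem exists_mem_ne {i : Fin (h + 1)} (hi0 : i.val ≠ 0) (hih : i.val ≠ h) :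
    ∃ x ∈ F, ∃ y ∈ F, x i ≠ y i ∧ ∀ z ∈ F, z i = x i ∨ z i = y i := by
  obtain ⟨x, hx⟩ := hF.nonempty
  obtain ⟨i, hi⟩ := i
  obtain ⟨k, rfl⟩ := Nat.exists_eq_succ_of_ne_zero hi0
  have hkh : k + 1 ≠ h := hih
  have hki : k + 2 ≤ h := by omega
  refine ⟨x, hx, _, hF.update_swap_mem hx k hki, ?_, fun z hz => ?_⟩
  · rw [Function.update_self]
    exact (ds.swap_ne_of_mem_midpoints (hF.mem_midpoints hx k hki)).symm
  · rw [Function.update_self]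
    exact hF.eq_or_eq_swap hx hz _

/-- If the vertices of `x` and `y` at time `i + 1` differ, one is the `swap` of the other, and
flipping `x` there leaves its vertex at time `i` alone. At the last time the vertices agree anyway.
-/
theorem exists_mem_of_step {x y : Fin (h + 1) → G} (hx : x ∈ F) (hy : y ∈ F) (i : Fin h) :
    ∃ z ∈ F, z i.castSucc = x i.castSucc ∧ z i.succ = y i.succ := by
  rcases hF.eq_or_eq_swap hx hy i.succ with h1 | h1
  · exact ⟨x, hx, rfl, h1.symm⟩
  · obtain ⟨i, hi⟩ := i
    by_cases hih : i + 1 = h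
    · refine ⟨x, hx, rfl, ?_⟩
      have : (⟨i, hi⟩ : Fin h).succ = Fin.last h := Fin.ext hih
      rw [this, hF.apply_last hx, hF.apply_last hy]
    · refine ⟨_, hF.update_swap_mem hx i (by omega), ?_, ?_⟩
      · rw [Function.update_of_ne]
        simp [Fin.ext_iff]
      · rw [h1]
        exact Function.update_self _ _ _

end IsFlipclass

end CoxeterSystem

/-! ### Posets in which the order compares ranks. -/

section RankedPosets

/-- Such an order is determined by the cardinalities of its levels, so bijections between levels
glue to an isomorphism. -/
theorem nonempty_orderIso_of_rank {P Q : Type*} [LE P] [LE Q] (ρ : P → ℕ) (σ : Q → ℕ)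
    (hP : ∀ x y : P, x ≤ y ↔ x = y ∨ ρ x < ρ y) (hQ : ∀ x y : Q, x ≤ y ↔ x = y ∨ σ x < σ y)
    (hfib : ∀ n, Nonempty ({p // ρ p = n} ≃ {q // σ q = n})) : Nonempty (P ≃o Q) := by
  let e := fun n => Classical.choice (hfib n)
  let E : P ≃ Q := (Equiv.sigmaFiberEquiv ρ).symm.trans
    ((Equiv.sigmaCongrRight e).trans (Equiv.sigmaFiberEquiv σ))
  have hE : ∀ p, σ (E p) = ρ p := fun p => (e (ρ p) ⟨p, rfl⟩).2
  refine ⟨⟨E, fun {x y} => ?_⟩⟩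
  rw [hP, hQ, hE, hE, E.apply_eq_iff_eq]

theorem bijective_of_pair {α : Type*} {a₁ a₂ : α} (ha : a₁ ≠ a₂)
    (ha' : ∀ x, x = a₁ ∨ x = a₂) : Function.Bijective fun t : Bool => if t then a₁ else a₂ := by
  refine ⟨fun s t hst => ?_, fun x => ?_⟩
  · cases s <;> cases t <;> simp_all
  · rcases ha' x with rfl | rfl
    exacts [⟨true, rfl⟩, ⟨false, rfl⟩]

theorem nonempty_equiv_of_pairs {α β : Type*} {a₁ a₂ : α} (ha : a₁ ≠ a₂)
    (ha' : ∀ x, x = a₁ ∨ x = a₂) {b₁ b₂ : β} (hb : b₁ ≠ b₂) (hb' : ∀ x, x = b₁ ∨ x = b₂) :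
    Nonempty (α ≃ β) :=
  ⟨(Equiv.ofBijective _ (bijective_of_pair ha ha')).symm.trans
    (Equiv.ofBijective _ (bijective_of_pair hb hb'))⟩

variable {P : Type*} [PartialOrder P] {ρ : P → ℕ} (hρ : ∀ x y : P, x ≤ y ↔ x = y ∨ ρ x < ρ y)

include hρ

theorem lt_iff_rank_lt {x y : P} : x < y ↔ ρ x < ρ y := by
  rw [lt_iff_le_and_ne, hρ]
  constructor
  · rintro ⟨h1 | h1, h2⟩
    exacts [absurd h1 h2, h1]
  · intro h
    exact ⟨Or.inr h, fun he => by rw [he] at h; exact lt_irrefl _ h⟩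

theorem ncard_atoms_eq_two {b w₁ w₂ : P} (hb : IsBot b) (hne : w₁ ≠ w₂)
    (hw : ∀ q, ρ q = ρ b + 1 ↔ q = w₁ ∨ q = w₂) : (Flipclass.atoms P).ncard = 2 := by
  have : Flipclass.atoms P = {w₁, w₂} := by
    ext q
    rw [Set.mem_insert_iff, Set.mem_singleton_iff, ← hw]
    constructor
    · rintro ⟨p, hp, hpq⟩
      obtain rfl : p = b := le_antisymm (hp b) (hb p)
      have h1 := (lt_iff_rank_lt hρ).mp hpq.lt
      by_contra hne'
      have h2 := (hw w₁).mpr (Or.inl rfl)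
      exact hpq.2 (c := w₁) ((lt_iff_rank_lt hρ).mpr (by omega))
        ((lt_iff_rank_lt hρ).mpr (by omega))
    · intro hq
      refine ⟨b, hb, (lt_iff_rank_lt hρ).mpr (by omega), fun c h1 h2 => ?_⟩
      rw [lt_iff_rank_lt hρ] at h1 h2
      omega
  rw [this, Set.ncard_pair hne]

theorem ncard_coatoms_eq_two {t w₁ w₂ : P} (ht : IsTop t) (hne : w₁ ≠ w₂)
    (hw : ∀ q, ρ q + 1 = ρ t ↔ q = w₁ ∨ q = w₂) : (Flipclass.coatoms P).ncard = 2 := by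
  have : Flipclass.coatoms P = {w₁, w₂} := by
    ext q
    rw [Set.mem_insert_iff, Set.mem_singleton_iff, ← hw]
    constructor
    · rintro ⟨p, hp, hpq⟩
      obtain rfl : p = t := le_antisymm (ht p) (hp t)
      have h1 := (lt_iff_rank_lt hρ).mp hpq.lt
      by_contra hne'
      have h2 := (hw w₁).mpr (Or.inl rfl)
      exact hpq.2 (c := w₁) ((lt_iff_rank_lt hρ).mpr (by omega))
        ((lt_iff_rank_lt hρ).mpr (by omega))
    · intro hq
      refine ⟨t, ht, (lt_iff_rank_lt hρ).mpr (by omega), fun c h1 h2 => ?_⟩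
      rw [lt_iff_rank_lt hρ] at h1 h2
      omega
  rw [this, Set.ncard_pair hne]

end RankedPosets

/-! ### Time-support posets and dihedral Bruhat intervals. -/

namespace Flipclass

/-- For `q` later than `p`, follow the path through `p` to the time just before `q`; the hypothesis
supplies the last step to `q`. -/
theorem tsp_le_iff {W : Type*} {h : ℕ} {F : Set (Fin (h + 1) → W)}
    (hstep : ∀ x ∈ F, ∀ y ∈ F, ∀ i : Fin h,
      ∃ z ∈ F, z i.castSucc = x i.castSucc ∧ z i.succ = y i.succ) (p q : TSP F) :
    p ≤ q ↔ p = q ∨ p.1.2.val < q.1.2.val := by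
  refine ⟨TSEdge.le_time, ?_⟩
  rintro (rfl | hlt)
  · exact le_rfl
  obtain ⟨x, hx, i, rfl⟩ := exists_eq_tsPoint p
  obtain ⟨y, hy, j, rfl⟩ := exists_eq_tsPoint q
  have hij : i.val < j.val := hlt
  obtain ⟨k, rfl⟩ := Fin.exists_succ_eq.mpr (show j ≠ 0 by rintro rfl; simp at hij)
  obtain ⟨z, hz, h1, h2⟩ := hstep x hx y hy k
  have e1 : tsPoint hx k.castSucc = tsPoint hz k.castSucc :=
    (tsPoint_eq_iff _ _).mpr ⟨h1.symm, rfl⟩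
  have e2 : tsPoint hz k.succ = tsPoint hy k.succ := (tsPoint_eq_iff _ _).mpr ⟨h2, rfl⟩
  refine (tsPoint_le_tsPoint hx (j := k.castSucc) ?_).trans (e1.le.trans (LE.le.trans ?_ e2.le))
  · rw [Fin.le_def]
    simp only [Fin.val_succ, Fin.val_castSucc] at hij ⊢
    omega
  · exact tsPoint_le_tsPoint hz (Fin.castSucc_lt_succ).le

end Flipclass

namespace CoxeterSystem

variable {B W : Type*} [Group W] {M : CoxeterMatrix B} {cs : CoxeterSystem M W}
variable {D : CoxeterMatrix (Fin 2)} {G : Type*} [Group G] {ds : CoxeterSystem D G}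

open Flipclass

theorem bruhatInterval_le_iff {u v : G} (x y : ds.BruhatInterval u v) :
    x ≤ y ↔ x = y ∨ ds.length x.1 < ds.length y.1 :=
  ds.bruhatLE_iff.trans (or_congr_left Subtype.ext_iff.symm)

/-- Both sides have one element on the bottom and top levels and two on each level between, and both
orders compare levels. The interval is `[1, w]` with `ℓ(w) = h`, unrelated to the endpoints of `F'`.
-/
theorem IsFlipclass.exists_orderIso {h : ℕ} {u v : W} {F : Set (Fin (h + 1) → W)}
    (hF : cs.IsFlipclass u v F) {u' v' : G} {F' : Set (Fin (h + 1) → G)}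
    (hF' : ds.IsFlipclass u' v' F') (hFF' : CombIso cs ds F F') :
    ∃ u'' v'' : G, Nonempty (TSP F ≃o ds.BruhatInterval u'' v'') := by
  obtain ⟨f, hf, hfij⟩ := hFF'.exists_surjective
  have hstep : ∀ x ∈ F, ∀ y ∈ F, ∀ i : Fin h,
      ∃ z ∈ F, z i.castSucc = x i.castSucc ∧ z i.succ = y i.succ := by
    intro x hx y hy i
    obtain ⟨z', hz', h1, h2⟩ := hF'.exists_mem_of_step (f ⟨x, hx⟩).2 (f ⟨y, hy⟩).2 i
    obtain ⟨z, hz⟩ := hf ⟨z', hz'⟩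
    have hz2 : (f z).1 = z' := congrArg Subtype.val hz
    rw [← hz2, hfij] at h1 h2
    exact ⟨z.1, z.2, h1, h2⟩
  have hpair : ∀ i : Fin (h + 1), i.val ≠ 0 → i.val ≠ h →
      ∃ x ∈ F, ∃ y ∈ F, x i ≠ y i ∧ ∀ z ∈ F, z i = x i ∨ z i = y i := by
    intro i hi0 hih
    obtain ⟨x', hx', y', hy', hne, hall⟩ := hF'.exists_mem_ne hi0 hih
    obtain ⟨x, hx⟩ := hf ⟨x', hx'⟩
    obtain ⟨y, hy⟩ := hf ⟨y', hy'⟩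
    have hx2 : (f x).1 = x' := congrArg Subtype.val hx
    have hy2 : (f y).1 = y' := congrArg Subtype.val hy
    rw [← hx2, ← hy2, Ne, hfij] at hne
    refine ⟨x.1, x.2, y.1, y.2, hne, fun z hz => ?_⟩
    have := hall (f ⟨z, hz⟩).1 (f ⟨z, hz⟩).2
    rwa [← hx2, ← hy2, hfij, hfij] at this
  obtain ⟨x₀, hx₀⟩ := hF.nonempty
  -- Lengths increase along a path of `F'`, so its last vertex has length at least `h`, and all
  -- smaller lengths occur.
  obtain ⟨w, hw⟩ : ∃ w, ds.length w = h := by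
    obtain ⟨x', hx'⟩ := hF'.nonempty
    apply ds.exists_length_eq (x' (Fin.last h))
    have : ∀ i : Fin (h + 1), i.val ≤ ds.length (x' i) := by
      intro i
      induction i using Fin.induction with
      | zero => exact Nat.zero_le _
      | succ i ih =>
        have := ((hF'.subset_bruhatPaths hx').2.2 i).1
        simp only [Fin.val_succ, Fin.val_castSucc] at ih ⊢
        omega
    exact this (Fin.last h)
  have hle1 : ∀ x : G, ds.BruhatLE 1 x := fun x => by
    rw [bruhatLE_iff]
    by_cases hx : x = 1
    · exact Or.inl hx.symm
    · right
      rw [length_one]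
      exact Nat.pos_of_ne_zero fun h0 => hx (ds.length_eq_zero_iff.mp h0)
  have hmem : ∀ {x : G}, ds.length x < h → ds.BruhatLE 1 x ∧ ds.BruhatLE x w := fun hx =>
    ⟨hle1 _, ds.bruhatLE_iff.mpr (Or.inr (by rw [hw]; exact hx))⟩
  have hQle : ∀ x : ds.BruhatInterval 1 w, x.1 = w ∨ ds.length x.1 < h := fun x => by
    have := ds.bruhatLE_iff.mp x.2.2
    rwa [hw] at this
  refine ⟨1, w, nonempty_orderIso_of_rank (fun p : TSP F => p.1.2.val) (fun q => ds.length q.1)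
    (tsp_le_iff hstep) bruhatInterval_le_iff fun n => ?_⟩
  have hP : ∀ p : {p : TSP F // p.1.2.val = n}, ∃ (x : Fin (h + 1) → W) (hx : x ∈ F)
      (i : Fin (h + 1)), i.val = n ∧ p.1 = tsPoint hx i := by
    rintro ⟨p, hp⟩
    obtain ⟨x, hx, i, rfl⟩ := exists_eq_tsPoint p
    exact ⟨x, hx, i, hp, rfl⟩
  rcases lt_trichotomy n h with hn | rfl | hn
  · by_cases hn0 : n = 0
    · subst hn0
      have : Unique {p : TSP F // p.1.2.val = 0} := by
        refine ⟨⟨⟨tsPoint hx₀ 0, rfl⟩⟩, fun p => ?_⟩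
        obtain ⟨x, hx, i, hi, hp⟩ := hP p
        have hi' : i = 0 := Fin.ext hi
        rw [hi'] at hp
        exact Subtype.ext (hp.trans ((tsPoint_eq_iff hx hx₀).mpr
          ⟨by rw [hF.apply_zero hx, hF.apply_zero hx₀], rfl⟩))
      have : Unique {q : ds.BruhatInterval 1 w // ds.length q.1 = 0} := by
        refine ⟨⟨⟨⟨1, hle1 1, hle1 w⟩, ds.length_one⟩⟩, fun q => ?_⟩
        exact Subtype.ext (Subtype.ext (ds.length_eq_zero_iff.mp q.2))
      exact ⟨Equiv.ofUnique _ _⟩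
    · obtain ⟨x, hx, y, hy, hne, hall⟩ := hpair ⟨n, by omega⟩ hn0 (by simpa using hn.ne)
      obtain ⟨a, ha⟩ := ds.exists_length_eq w (k := n) (by omega)
      have hsw : ds.swap a ≠ a := ds.swap_ne (x := a) (y := w) (by omega) (by omega)
      refine nonempty_equiv_of_pairs (a₁ := ⟨tsPoint hx ⟨n, by omega⟩, rfl⟩)
        (a₂ := ⟨tsPoint hy ⟨n, by omega⟩, rfl⟩) (fun he => hne ?_) (fun p => ?_)
        (b₁ := ⟨⟨a, hmem (by omega)⟩, ha⟩)
        (b₂ := ⟨⟨ds.swap a, hmem (by rw [length_swap]; omega)⟩, by rw [length_swap, ha]⟩)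
        (fun he => hsw ?_) fun q => ?_
      · exact ((tsPoint_eq_iff hx hy).mp (congrArg Subtype.val he)).1
      · obtain ⟨z, hz, i, hi, hp⟩ := hP p
        have hi' : i = ⟨n, by omega⟩ := Fin.ext hi
        rw [hi'] at hp
        exact (hall z hz).imp
          (fun h1 => Subtype.ext (hp.trans ((tsPoint_eq_iff hz hx).mpr ⟨h1, rfl⟩)))
          (fun h1 => Subtype.ext (hp.trans ((tsPoint_eq_iff hz hy).mpr ⟨h1, rfl⟩)))
      · exact (congrArg (fun q => q.1.1) he).symm
      · refine (ds.eq_or_eq_swap (x := a) (y := q.1.1) (by rw [q.2, ha])).imp ?_ ?_ <;>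
        exact fun h1 => Subtype.ext (Subtype.ext h1)
  · have : Unique {p : TSP F // p.1.2.val = n} := by
      refine ⟨⟨⟨tsPoint hx₀ (Fin.last n), rfl⟩⟩, fun p => ?_⟩
      obtain ⟨x, hx, i, hi, hp⟩ := hP p
      have hi' : i = Fin.last n := Fin.ext hi
      rw [hi'] at hp
      exact Subtype.ext (hp.trans ((tsPoint_eq_iff hx hx₀).mpr
        ⟨by rw [hF.apply_last hx, hF.apply_last hx₀], rfl⟩))
    have : Unique {q : ds.BruhatInterval 1 w // ds.length q.1 = n} := by
      refine ⟨⟨⟨⟨w, hle1 w, Relation.ReflTransGen.refl⟩, hw⟩⟩, fun q => ?_⟩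
      rcases hQle q.1 with h1 | h1
      · exact Subtype.ext (Subtype.ext h1)
      · exact absurd q.2 h1.ne
    exact ⟨Equiv.ofUnique _ _⟩
  · have : IsEmpty {p : TSP F // p.1.2.val = n} :=
      ⟨fun p => by have := p.1.1.2.isLt; have := p.2; omega⟩
    have : IsEmpty {q : ds.BruhatInterval 1 w // ds.length q.1 = n} := by
      refine ⟨fun q => ?_⟩
      have h1 := q.2
      rcases hQle q.1 with h2 | h2
      · rw [h2, hw] at h1; omega
      · omega
    exact ⟨Equiv.equivOfIsEmpty _ _⟩

theorem IsFlipclass.ncard_atoms_coatoms {h : ℕ} {u v : W} {F : Set (Fin (h + 1) → W)}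
    (hF : cs.IsFlipclass u v F) (hh : 2 ≤ h) {u' v' : G} (e : TSP F ≃o ds.BruhatInterval u' v') :
    (atoms (TSP F)).ncard = 2 ∧ (coatoms (TSP F)).ncard = 2 := by
  obtain ⟨x, hx⟩ := hF.nonempty
  let ρ : TSP F → ℕ := fun p => ds.length (e p).1
  have hρ : ∀ p q : TSP F, p ≤ q ↔ p = q ∨ ρ p < ρ q := fun p q => by
    rw [← e.le_iff_le, bruhatInterval_le_iff, e.apply_eq_iff_eq]
  have hmono : ∀ i : Fin h, ρ (tsPoint hx i.castSucc) < ρ (tsPoint hx i.succ) := fun i =>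
    (lt_iff_rank_lt hρ).mp (tsPoint_covBy hx i).lt
  have h01 : ρ (tsPoint hx ⟨0, by omega⟩) < ρ (tsPoint hx ⟨1, by omega⟩) := hmono ⟨0, by omega⟩
  have h12 : ρ (tsPoint hx ⟨1, by omega⟩) < ρ (tsPoint hx ⟨2, by omega⟩) := hmono ⟨1, by omega⟩
  have hu : ∀ p, ds.length u' ≤ ρ p := fun p => by
    rcases ds.bruhatLE_iff.mp (e p).2.1 with h1 | h1
    · exact (congrArg ds.length h1).le
    · exact h1.le
  have hv : ∀ p, ρ p ≤ ds.length v' := fun p => by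
    rcases ds.bruhatLE_iff.mp (e p).2.2 with h1 | h1
    · exact (congrArg ds.length h1).le
    · exact h1.le
  have h0 := hu (tsPoint hx ⟨0, by omega⟩)
  have h2 := hv (tsPoint hx ⟨2, by omega⟩)
  -- Three consecutive points of a path have increasing ranks, so `ℓ(v') ≥ ℓ(u') + 2`. The levels
  -- next to the two ends are therefore strictly between them and have exactly two elements.
  have huv : ds.BruhatLE u' v' := ds.bruhatLE_iff.mpr (Or.inr (by omega))
  have key : ∀ n, ds.length u' < n → n < ds.length v' → ∃ w₁ w₂ : TSP F, w₁ ≠ w₂ ∧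
      ∀ q, ρ q = n ↔ q = w₁ ∨ q = w₂ := by
    intro n hn1 hn2
    obtain ⟨a, ha⟩ := ds.exists_length_eq v' hn2.le
    have hmem : ∀ y, ds.length y = n → ds.BruhatLE u' y ∧ ds.BruhatLE y v' := fun y hy =>
      ⟨ds.bruhatLE_iff.mpr (Or.inr (by omega)), ds.bruhatLE_iff.mpr (Or.inr (by omega))⟩
    have hsw : ds.length (ds.swap a) = n := by rw [length_swap, ha]
    obtain ⟨A, hA⟩ : ∃ A : ds.BruhatInterval u' v', A.1 = a := ⟨⟨a, hmem a ha⟩, rfl⟩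
    obtain ⟨A', hA'⟩ : ∃ A : ds.BruhatInterval u' v', A.1 = ds.swap a :=
      ⟨⟨ds.swap a, hmem _ hsw⟩, rfl⟩
    refine ⟨e.symm A, e.symm A', fun he => ?_, fun q => ?_⟩
    · refine ds.swap_ne (x := a) (y := v') (by omega) (by omega) ?_
      rw [← hA', ← e.symm.injective he, hA]
    · rw [← e.apply_eq_iff_eq, ← e.apply_eq_iff_eq (y := e.symm A'),
        e.apply_symm_apply, e.apply_symm_apply]
      constructor
      · intro hq
        refine (ds.eq_or_eq_swap (x := a) (y := (e q).1) (ha.trans hq.symm)).imp ?_ ?_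
        · exact fun h1 => Subtype.ext (h1.trans hA.symm)
        · exact fun h1 => Subtype.ext (h1.trans hA'.symm)
      · rintro (h1 | h1)
        · simp only [ρ, h1, hA, ha]
        · simp only [ρ, h1, hA', hsw]
  obtain ⟨U, hU⟩ : ∃ A : ds.BruhatInterval u' v', A.1 = u' :=
    ⟨⟨u', Relation.ReflTransGen.refl, huv⟩, rfl⟩
  obtain ⟨V, hV⟩ : ∃ A : ds.BruhatInterval u' v', A.1 = v' :=
    ⟨⟨v', huv, Relation.ReflTransGen.refl⟩, rfl⟩
  constructor
  · obtain ⟨w₁, w₂, hne, hw⟩ := key (ds.length u' + 1) (by omega) (by omega)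
    have hb : ρ (e.symm U) = ds.length u' := by simp only [ρ, e.apply_symm_apply, hU]
    refine ncard_atoms_eq_two hρ (b := e.symm U) (fun p => ?_) hne (by rwa [hb])
    rw [← e.le_iff_le, e.apply_symm_apply]
    change ds.BruhatLE U.1 (e p).1
    rw [hU]
    exact (e p).2.1
  · obtain ⟨w₁, w₂, hne, hw⟩ := key (ds.length v' - 1) (by omega) (by omega)
    have hb : ρ (e.symm V) = ds.length v' := by simp only [ρ, e.apply_symm_apply, hV]
    refine ncard_coatoms_eq_two hρ (t := e.symm V) (fun p => ?_) hne (fun q => ?_)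
    · rw [← e.le_iff_le, e.apply_symm_apply]
      change ds.BruhatLE (e p).1 V.1
      rw [hV]
      exact (e p).2.2
    · rw [hb, ← hw]
      omega

end CoxeterSystem

/-! ### The equivalence. -/

theorem mainTheorem6 {B W : Type*} [Group W] {M : CoxeterMatrix B} (cs : CoxeterSystem M W)
    {h : ℕ} (hh : 2 ≤ h) (u v : W) (F : Set (Fin (h + 1) → W)) (hF : cs.IsFlipclass u v F) :
    List.TFAE [
      -- `F` is isomorphic to a flipclass of a dihedral group
      ∃ (D : CoxeterMatrix (Fin 2)) (u' v' : D.Group) (F' : Set (Fin (h + 1) → D.Group)),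
        D.toCoxeterSystem.IsFlipclass u' v' F' ∧ Flipclass.Iso cs D.toCoxeterSystem F F',
      -- `F` is combinatorially isomorphic to a flipclass of a dihedral group
      ∃ (D : CoxeterMatrix (Fin 2)) (u' v' : D.Group) (F' : Set (Fin (h + 1) → D.Group)),
        D.toCoxeterSystem.IsFlipclass u' v' F' ∧ Flipclass.CombIso cs D.toCoxeterSystem F F',
      -- the time-support poset is isomorphic to an interval of a dihedral group
      ∃ (D : CoxeterMatrix (Fin 2)) (u' v' : D.Group),
        Nonempty (Flipclass.TSP F ≃o D.toCoxeterSystem.BruhatInterval u' v'),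
      -- the time-support poset has two atoms
      (Flipclass.atoms (Flipclass.TSP F)).ncard = 2,
      -- the time-support poset has two coatoms
      (Flipclass.coatoms (Flipclass.TSP F)).ncard = 2,
      -- `span Φ(F)` has dimension 2
      Module.finrank ℝ (Submodule.span ℝ (Flipclass.roots cs F)) = 2,
      -- the reflections in the roots of `span Φ(F)` generate a dihedral Coxeter group
      cs.IsDihedralSubgroup (Subgroup.closure
        {t | ∃ α ∈ Submodule.span ℝ (Flipclass.roots cs F), cs.IsRootOf α t}),
      -- `W(F)` is a dihedral Coxeter group
      cs.IsDihedralSubgroup (Flipclass.reflSubgroup F)] := by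
  have hspan : ∀ t ∈ Flipclass.labels F,
      cs.posRoot t ∈ Submodule.span ℝ (Flipclass.roots cs F) :=
    fun t ht => Submodule.subset_span (hF.mem_roots_iff.mpr ⟨t, ht, rfl⟩)
  obtain ⟨c, hc, d, hd, hcd⟩ := hF.exists_ne_labels hh
  tfae_have 1 → 2
  | ⟨D, u', v', F', hF', hiso⟩ => ⟨D, u', v', F', hF', hiso.combIso⟩
  tfae_have 2 → 3
  | ⟨D, _, _, _, hF', hiso⟩ => ⟨D, hF.exists_orderIso hF' hiso⟩
  tfae_have 3 → 4
  | ⟨_, _, _, ⟨e⟩⟩ => (hF.ncard_atoms_coatoms hh e).1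
  tfae_have 3 → 5
  | ⟨_, _, _, ⟨e⟩⟩ => (hF.ncard_atoms_coatoms hh e).2
  tfae_have 4 → 6 := hF.finrank_eq_two_of_atoms hh
  tfae_have 5 → 6 := hF.finrank_eq_two_of_coatoms hh
  tfae_have 6 → 1 := hF.exists_iso hh
  tfae_have 6 → 7 := by
    intro hfin
    refine CoxeterSystem.isDihedralSubgroup_closure hfin ?_
      ⟨_, hspan c hc, (hF.isReflection_of_mem_labels hc).isRootOf⟩
      ⟨_, hspan d hd, (hF.isReflection_of_mem_labels hd).isRootOf⟩ hcd
    rintro t ⟨α, hα, hαt⟩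
    refine ⟨hαt.isReflection, ?_⟩
    rcases hαt.eq_posRoot_or with h1 | h1
    · rwa [← h1]
    · rw [← neg_neg (cs.posRoot t), ← h1]
      exact Submodule.neg_mem _ hα
  tfae_have 6 → 8 := fun hfin => CoxeterSystem.isDihedralSubgroup_closure hfin
    (fun t ht => ⟨hF.isReflection_of_mem_labels ht, hspan t ht⟩) hc hd hcd
  -- The roots of a dihedral subgroup lie in a space of dimension at most two, and two distinct
  -- labels make the dimension exactly two.
  have hback : ∀ H : Subgroup W, cs.IsDihedralSubgroup H → (∀ t ∈ Flipclass.labels F, t ∈ H) →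
      Module.finrank ℝ (Submodule.span ℝ (Flipclass.roots cs F)) = 2 := by
    intro H hH hlab
    obtain ⟨P, hfin, hP, hmem⟩ := hH.exists_plane
    exact hF.finrank_span_roots hh hfin hP
      fun t ht => hmem t (hlab t ht) (hF.isReflection_of_mem_labels ht)
  tfae_have 7 → 6 := fun hdih => hback _ hdih fun t ht => Subgroup.subset_closure
    ⟨_, hspan t ht, (hF.isReflection_of_mem_labels ht).isRootOf⟩
  tfae_have 8 → 6 := fun hdih => hback _ hdih fun t ht => Subgroup.subset_closure ht
  tfae_finish
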